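/- For $n\ge 0$ let $\Pi(n)$ be the set of set partitions of $[n]=\{1,\dots,n\}$ and let $B_n=|\Pi(n)|$ (the Bell number). For $\lambda\in\Pi(n)$ with blocks $A_1,\dots,A_\ell$ let $M_i=\max A_i$, $m_i=\min A_i$, and let $$d(\lambda)=\sum_{i=1}^{\ell}(M_i-m_i+1)-n$$ be the dimension exponent of $\lambda$. Let $$E(d(\lambda))=\frac1{B_n}\sum_{\lambda\in\Pi(n)}d(\lambda),\qquad S_k(d;n)=\frac1{B_n}\sum_{\lambda\in\Pi(n)}\bigl(d(\lambda)-E(d(\lambda))\bigr)^k .$$ Let $\alpha_n$ be the unique positive real solution of $ue^u=n+1$. Theorem 3.3. As $n\to\infty$, $\alpha_n=\log n-\log\log n+o(1)$, $$E(d(\lambda))=\frac{\alpha_n-2}{\alpha_n^2}\,n^2+O\!\left(\frac{n}{\alpha_n}\right),$$ $$S_2(d;n)=\frac{\alpha_n^2-7\alpha_n+17}{\alpha_n^3(\alpha_n+1)}\,n^3+O\!\left(\frac{n^2}{\alpha_n}\right),$$ $$S_3(d;n)=\left(-\frac{881}{3}-244\,\alpha_n+145\,\alpha_n^2-\frac{83}{3}\,\alpha_n^3+2\,\alpha_n^4\right)\frac{n^4}{\alpha_n^4(\alpha_n+1)^3}+O\!\left(\frac{n^3}{\alpha_n}\right).$$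 -/

import Mathlib

open Filter Topology Asymptotics

/-- `Π(n)`: the set partitions of `[n] = {1, …, n}`. -/
abbrev SetPartition (n : ℕ) : Type := Finpartition (Finset.Icc 1 n)

/-- The dimension exponent `d(λ) = ∑ᵢ (Mᵢ - mᵢ + 1) - n`, the sum being over the blocks of `λ`,
where `Mᵢ` and `mᵢ` are the largest and the smallest element of the `i`-th block. -/
def dimExponent {n : ℕ} (P : SetPartition n) : ℤ :=
  (∑ b ∈ P.parts.attach,
    ((b.1.max' (P.nonempty_of_mem_parts b.2) : ℤ)
      - (b.1.min' (P.nonempty_of_mem_parts b.2) : ℤ) + 1)) - n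

/-- The Bell number `B_n`, the number of set partitions of `[n]`. -/
def bellNumber (n : ℕ) : ℕ := Fintype.card (SetPartition n)

/-- The mean `E(d(λ)) = M(d; n) / B_n` of `d` for `λ` uniformly distributed on `Π(n)`. -/
noncomputable def meanDim (n : ℕ) : ℝ :=
  (∑ P : SetPartition n, (dimExponent P : ℝ)) / bellNumber n

/-- The centered moment `S_k(d; n) = (1 / B_n) ∑_{λ ∈ Π(n)} (d(λ) - M(d; n) / B_n) ^ k`. -/
noncomputable def centeredMomentDim (k n : ℕ) : ℝ :=
  (1 / (bellNumber n : ℝ)) * ∑ P : SetPartition n, ((dimExponent P : ℝ) - meanDim n) ^ k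

theorem existsUnique_pos_mul_exp (n : ℕ) :
    ∃! u : ℝ, 0 < u ∧ u * Real.exp u = (n : ℝ) + 1 := by
  have hn : (0 : ℝ) < (n : ℝ) + 1 := by positivity
  have hcont : ContinuousOn (fun u : ℝ => u * Real.exp u) (Set.Icc 0 ((n : ℝ) + 1)) := by
    fun_prop
  have hmem : (n : ℝ) + 1 ∈ Set.Icc ((fun u : ℝ => u * Real.exp u) 0)
      ((fun u : ℝ => u * Real.exp u) ((n : ℝ) + 1)) := by
    refine ⟨by simpa using hn.le, ?_⟩
    have h1 : (1 : ℝ) ≤ Real.exp ((n : ℝ) + 1) := Real.one_le_exp hn.le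
    simpa using le_mul_of_one_le_right hn.le h1
  obtain ⟨u, hu, hue⟩ := intermediate_value_Icc hn.le hcont hmem
  have hue' : u * Real.exp u = (n : ℝ) + 1 := hue
  have hu0 : 0 < u := by
    rcases hu.1.lt_or_eq with h | h
    · exact h
    · rw [← h, zero_mul] at hue'
      exact absurd hue' hn.ne
  have key : ∀ x y : ℝ, 0 < x → x < y → x * Real.exp x < y * Real.exp y := fun x y hx hxy =>
    mul_lt_mul hxy (Real.exp_le_exp.2 hxy.le) (Real.exp_pos x) (hx.trans hxy).le
  refine ⟨u, ⟨hu0, hue'⟩, ?_⟩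
  rintro v ⟨hv0, hve⟩
  rcases lt_trichotomy v u with h | h | h
  · exact absurd (hve.trans hue'.symm) (key v u hv0 h).ne
  · exact h
  · exact absurd (hue'.trans hve.symm) (key u v hu0 h).ne

/-- `α_n`, the unique positive real solution `u` of `u e^u = n + 1`. -/
noncomputable def alpha (n : ℕ) : ℝ := (existsUnique_pos_mul_exp n).choose

theorem alpha_spec (n : ℕ) : 0 < alpha n ∧ alpha n * Real.exp (alpha n) = (n : ℝ) + 1 :=
  (existsUnique_pos_mul_exp n).choose_spec.1

/-! Write c = exp(α_n), so that n + 1 = α_n c. The proof has three ingredients.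

Exact moments. A partition of [n+1] arises from one of [n] by inserting n+1: as a new singleton,
which leaves d unchanged, or into a block b, which raises d by the gap n − max b. Weighting
partitions by q^d ∏(1 + q^gap X) turns this into G_{n+1}(X) = (1 + X)(G_n + G_n')(qX)
(`dimGen_succ`). With q = 1 + h, the coefficients of h, h², h³ at X = 0 are the binomial moments of
d. They have closed forms in the derivatives of A_n, the polynomial counting partitions with marked
blocks, so the power sums of d are combinations of the Bell numbers B_n, …, B_{n+2k} with
coefficients polynomial in n (`sum_dimExponent`, `sum_dimExponent_sq`, `sum_dimExponent_cube`).

Ratios of Bell numbers. The linear form E : X^j ↦ B_{n+j}/B_n is a Cauchy integral over |z| = α_n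
with kernel exp(e^z)/z^{n+1}, a polynomial p entering as the mean of p(N), N Poisson of parameter
e^z (`contourMean_poissonFun`). Laplace's method is replaced by a recursion. Integration by parts
gives E[(X − c)p] = −c E[(1 − α_n/z)p]; near the saddle point 1 − α_n/z is a power series in e^z −
c, and multiplication by e^z − c is again an operator on polynomials (`poissonFun_raise`). Hence a
recursion for μ_k = E(X − c)^k (`moment_recursion`). Its remainder is bounded crudely, with the loss
of a fixed power of c (`factorial_mul_exp_le`, `norm_contourMean_le_of_norm_le_pow`), which an
expansion of high order absorbs. Bootstrapping yields μ_k = O(c^⌊k/2⌋) and the leading terms of μ_1,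
…, μ_4.

Assembly. Put Q = (n+4)X − 2X². For suitable polynomials V and T, formally a conditional variance
and a conditional third central moment, the mean of d is E Q, S_2 = E V + Var Q and S_3 = E T + 3
Cov(Q, V) + κ_3(Q). Inserting the asymptotics of μ_k gives the main terms; what remains is α_n^{k−1}
c^k times a bounded sequence, which is the claimed n^k/α_n. -/

/-! ### Partitions of a set with one more element. -/

section Insertion

variable {s t : Finset ℕ} {a : ℕ}

/-- Adding the singleton block `{a}` to a partition of `s`. -/
def insertSingleton (ha : a ∉ s) (ht : insert a s = t) (P : Finpartition s) : Finpartition t :=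
  P.extend (b := {a}) (Finset.singleton_ne_empty a) (by simpa using ha)
    (by rw [← ht, Finset.insert_eq, Finset.union_comm]; rfl)

/-- Adding the element `a` to the block `b` of a partition of `s`. -/
def insertIntoBlock (ha : a ∉ s) (ht : insert a s = t) (P : Finpartition s) (b : Finset ℕ)
    (hb : b ∈ P.parts) : Finpartition t :=
  Finpartition.ofExistsUnique (insert (insert a b) (P.parts.erase b))
    (by
      subst ht
      intro p hp
      rcases Finset.mem_insert.1 hp with rfl | hp
      · exact Finset.insert_subset_insert _ (P.subset hb)
      · exact (P.subset (Finset.mem_of_mem_erase hp)).trans (Finset.subset_insert _ _))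
    (by
      subst ht
      intro x hx
      rcases Finset.mem_insert.1 hx with rfl | hx
      · refine ⟨insert x b, ⟨by simp, by simp⟩, ?_⟩
        rintro y ⟨hy, hxy⟩
        rcases Finset.mem_insert.1 hy with rfl | hy
        · rfl
        · exact absurd (P.subset (Finset.mem_of_mem_erase hy) hxy) ha
      · have hxa : x ≠ a := fun h => ha (h ▸ hx)
        by_cases hxb : x ∈ b
        · refine ⟨insert a b, ⟨by simp, by simp [hxb]⟩, ?_⟩
          rintro y ⟨hy, hxy⟩
          rcases Finset.mem_insert.1 hy with rfl | hy
          · rfl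
          · rw [Finset.mem_erase] at hy
            exact absurd (P.eq_of_mem_parts hy.2 hb hxy hxb) hy.1
        · obtain ⟨u, hu, hxu⟩ := P.exists_mem hx
          refine ⟨u, ⟨?_, hxu⟩, ?_⟩
          · simp only [Finset.mem_insert, Finset.mem_erase]
            exact Or.inr ⟨fun h => hxb (h ▸ hxu), hu⟩
          · rintro y ⟨hy, hxy⟩
            rcases Finset.mem_insert.1 hy with rfl | hy
            · rcases Finset.mem_insert.1 hxy with h | h
              · exact absurd h hxa
              · exact absurd h hxb
            · exact P.eq_of_mem_parts (Finset.mem_of_mem_erase hy) hu hxy hxu)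
    (by
      intro h
      rcases Finset.mem_insert.1 h with h | h
      · exact (Finset.insert_ne_empty a b) h.symm
      · exact P.empty_notMem_parts (Finset.mem_of_mem_erase h))

/-- Insertion of `a`, as a new block or into an existing one. -/
def insertElement (ha : a ∉ s) (ht : insert a s = t) :
    (Σ P : Finpartition s, Option {b // b ∈ P.parts}) → Finpartition t
  | ⟨P, none⟩ => insertSingleton ha ht P
  | ⟨P, some b⟩ => insertIntoBlock ha ht P b.1 b.2

theorem notMem_of_mem_parts (ha : a ∉ s) (P : Finpartition s) {b : Finset ℕ} (hb : b ∈ P.parts) :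
    a ∉ b := fun h => ha (P.subset hb h)

theorem image_erase_parts (ha : a ∉ s) (P : Finpartition s) :
    P.parts.image (fun b => b.erase a) = P.parts := by
  conv_rhs => rw [← Finset.image_id (s := P.parts)]
  exact Finset.image_congr fun b hb =>
    Finset.erase_eq_of_notMem (notMem_of_mem_parts ha P (Finset.mem_coe.1 hb))

/-- Deleting `a` from every block and dropping the empty block undoes the insertion; this recovers
the partition in the proof of injectivity. -/
theorem erase_image_insertElement (ha : a ∉ s) (ht : insert a s = t)
    (x : Σ P : Finpartition s, Option {b // b ∈ P.parts}) :
    ((insertElement ha ht x).parts.image (fun b => b.erase a)).erase ∅ = x.1.parts := by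
  rcases x with ⟨P, _ | ⟨b, hb⟩⟩
  · change ((insert {a} P.parts).image (fun b => b.erase a)).erase ∅ = P.parts
    rw [Finset.image_insert, image_erase_parts ha, Finset.erase_singleton,
      Finset.erase_insert P.empty_notMem_parts]
  · change ((insert (insert a b) (P.parts.erase b)).image (fun b => b.erase a)).erase ∅ = P.parts
    have h : (P.parts.erase b).image (fun b => b.erase a) = P.parts.erase b := by
      conv_rhs => rw [← Finset.image_id (s := P.parts.erase b)]
      exact Finset.image_congr fun b hb => Finset.erase_eq_of_notMem
        (notMem_of_mem_parts ha P (Finset.mem_of_mem_erase (Finset.mem_coe.1 hb)))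
    rw [Finset.image_insert, h, Finset.erase_insert (notMem_of_mem_parts ha P hb),
      Finset.insert_erase hb, Finset.erase_eq_of_notMem P.empty_notMem_parts]

theorem insertElement_injective (ha : a ∉ s) (ht : insert a s = t) :
    Function.Injective (insertElement ha ht) := by
  rintro ⟨P, o⟩ ⟨Q, o'⟩ h
  have hPQ : P = Q := by
    have h1 := erase_image_insertElement ha ht ⟨P, o⟩
    rw [h, erase_image_insertElement ha ht ⟨Q, o'⟩] at h1
    exact Finpartition.ext h1.symm
  subst hPQ
  have h2 : (insertElement ha ht ⟨P, o⟩).parts = (insertElement ha ht ⟨P, o'⟩).parts := by rw [h]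
  -- The block containing `a` determines where `a` was inserted; the value `c = ∅` stands for the
  -- singleton.
  have aux : ∀ (b c : Finset ℕ), c ∈ P.parts ∨ c = ∅ → a ∉ b →
      insert a b ∈ insert (insert a c) P.parts → b = c := by
    intro b c hc hb hm
    rcases Finset.mem_insert.1 hm with hm | hm
    · have hc' : a ∉ c := by
        rcases hc with hc | rfl
        · exact notMem_of_mem_parts ha P hc
        · simp
      rw [← Finset.erase_insert hb, hm, Finset.erase_insert hc']
    · exact absurd (Finset.mem_insert_self a b) (notMem_of_mem_parts ha P hm)
  rcases o with _ | ⟨b, hb⟩ <;> rcases o' with _ | ⟨c, hc⟩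
  · rfl
  · change insert {a} P.parts = insert (insert a c) (P.parts.erase c) at h2
    have h3 : insert a (∅ : Finset ℕ) ∈ insert (insert a c) (P.parts.erase c) := by
      rw [← h2]; simp
    have := aux ∅ c (Or.inl hc) (by simp)
      (Finset.insert_subset_insert _ (Finset.erase_subset _ _) h3)
    exact absurd (this ▸ hc) P.empty_notMem_parts
  · change insert (insert a b) (P.parts.erase b) = insert {a} P.parts at h2
    have h3 : insert a b ∈ insert (insert a ∅) P.parts := by
      have : insert a b ∈ insert {a} P.parts := by rw [← h2]; simp
      simpa using this
    have := aux b ∅ (Or.inr rfl) (notMem_of_mem_parts ha P hb) h3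
    exact absurd (this ▸ hb) P.empty_notMem_parts
  · change insert (insert a b) (P.parts.erase b) = insert (insert a c) (P.parts.erase c) at h2
    have h3 : insert a b ∈ insert (insert a c) (P.parts.erase c) := by rw [← h2]; simp
    have := aux b c (Or.inl hc) (notMem_of_mem_parts ha P hb)
      (Finset.insert_subset_insert _ (Finset.erase_subset _ _) h3)
    subst this
    rfl

theorem insertElement_surjective (ha : a ∉ s) (ht : insert a s = t) :
    Function.Surjective (insertElement ha ht) := by
  subst ht
  intro P'
  obtain ⟨B, hB, haB⟩ := P'.exists_mem (Finset.mem_insert_self a s)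
  have huniq : ∀ C ∈ P'.parts, a ∈ C → C = B := fun C hC h => P'.eq_of_mem_parts hC hB h haB
  have hsub : ∀ C ∈ P'.parts, C ≠ B → C ⊆ s := by
    intro C hC hne x hx
    rcases Finset.mem_insert.1 (P'.subset hC hx) with rfl | h
    · exact absurd (huniq C hC hx) hne
    · exact h
  have hBs : B.erase a ⊆ s := by
    intro x hx
    rw [Finset.mem_erase] at hx
    exact (Finset.mem_insert.1 (P'.subset hB hx.2)).resolve_left hx.1
  by_cases h1 : B = {a}
  · let P : Finpartition s := Finpartition.ofExistsUnique (P'.parts.erase B)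
      (fun p hp => hsub p (Finset.mem_of_mem_erase hp) (Finset.ne_of_mem_erase hp))
      (by
        intro x hx
        obtain ⟨u, hu, hxu⟩ := P'.exists_mem (Finset.mem_insert_of_mem hx : x ∈ insert a s)
        refine ⟨u, ⟨Finset.mem_erase.2 ⟨?_, hu⟩, hxu⟩, fun y hy => 
          P'.eq_of_mem_parts (Finset.mem_of_mem_erase hy.1) hu hy.2 hxu⟩
        rintro rfl
        rw [h1, Finset.mem_singleton] at hxu
        exact ha (hxu ▸ hx))
      (fun h => P'.empty_notMem_parts (Finset.mem_of_mem_erase h))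
    refine ⟨⟨P, none⟩, Finpartition.ext ?_⟩
    change insert {a} (P'.parts.erase B) = P'.parts
    rw [← h1, Finset.insert_erase hB]
  · have hne : B.erase a ≠ ∅ := by
      intro h
      rw [Finset.erase_eq_empty_iff] at h
      rcases h with h | h
      · exact P'.empty_notMem_parts (h ▸ hB)
      · exact h1 h
    have hnot : B.erase a ∉ P'.parts.erase B := by
      intro h
      obtain ⟨x, hx⟩ := Finset.nonempty_iff_ne_empty.2 hne
      exact (Finset.ne_of_mem_erase h) (P'.eq_of_mem_parts (Finset.mem_of_mem_erase h) hB hx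
        (Finset.mem_of_mem_erase hx))
    let P : Finpartition s := Finpartition.ofExistsUnique (insert (B.erase a) (P'.parts.erase B))
      (by
        intro p hp
        rcases Finset.mem_insert.1 hp with rfl | hp
        · exact hBs
        · exact hsub p (Finset.mem_of_mem_erase hp) (Finset.ne_of_mem_erase hp))
      (by
        intro x hx
        have hxa : x ≠ a := fun h => ha (h ▸ hx)
        obtain ⟨u, hu, hxu⟩ := P'.exists_mem (Finset.mem_insert_of_mem hx : x ∈ insert a s)
        by_cases huB : u = B
        · subst huB
          refine ⟨u.erase a, ⟨by simp, Finset.mem_erase.2 ⟨hxa, hxu⟩⟩, ?_⟩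
          rintro y ⟨hy, hxy⟩
          rcases Finset.mem_insert.1 hy with rfl | hy
          · rfl
          · exact absurd (P'.eq_of_mem_parts (Finset.mem_of_mem_erase hy) hu hxy hxu)
              (Finset.ne_of_mem_erase hy)
        · refine ⟨u, ⟨Finset.mem_insert_of_mem (Finset.mem_erase.2 ⟨huB, hu⟩), hxu⟩, ?_⟩
          rintro y ⟨hy, hxy⟩
          rcases Finset.mem_insert.1 hy with rfl | hy
          · exact absurd (P'.eq_of_mem_parts hu hB hxu (Finset.mem_of_mem_erase hxy)) huB
          · exact P'.eq_of_mem_parts (Finset.mem_of_mem_erase hy) hu hxy hxu)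
      (by
        intro h
        rcases Finset.mem_insert.1 h with h | h
        · exact hne h.symm
        · exact P'.empty_notMem_parts (Finset.mem_of_mem_erase h))
    refine ⟨⟨P, some ⟨B.erase a, Finset.mem_insert_self _ _⟩⟩, Finpartition.ext ?_⟩
    change insert (insert a (B.erase a)) ((insert (B.erase a) (P'.parts.erase B)).erase (B.erase a))
      = P'.parts
    rw [Finset.erase_insert hnot, Finset.insert_erase haB, Finset.insert_erase hB]

theorem sum_finpartition_insert {M : Type*} [AddCommMonoid M] (ha : a ∉ s) (ht : insert a s = t)
    (F : Finset (Finset ℕ) → M) :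
    ∑ P : Finpartition t, F P.parts = ∑ P : Finpartition s, (F (insert {a} P.parts)
      + ∑ b ∈ P.parts, F (insert (insert a b) (P.parts.erase b))) := by
  rw [← Fintype.sum_bijective (insertElement ha ht)
    ⟨insertElement_injective ha ht, insertElement_surjective ha ht⟩
    (fun x => F (insertElement ha ht x).parts) _ (fun _ => rfl), Fintype.sum_sigma]
  refine Finset.sum_congr rfl fun P _ => ?_
  rw [Fintype.sum_option]
  exact congrArg₂ _ rfl (Finset.sum_coe_sort P.parts
    (fun b => F (insert (insert a b) (P.parts.erase b))))

end Insertion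

/-! ### Effect of inserting n + 1 on the dimension exponent and on the gaps. -/

/-- `max b - min b + 1` for a nonempty block `b`. -/
def spanLength (b : Finset ℕ) : ℤ :=
  if h : b.Nonempty then (b.max' h : ℤ) - (b.min' h : ℤ) + 1 else 0

/-- The dimension exponent in terms of the set of blocks. -/
def dimOfParts (n : ℕ) (parts : Finset (Finset ℕ)) : ℤ := ∑ b ∈ parts, spanLength b - n

theorem dimExponent_eq {n : ℕ} (P : SetPartition n) : dimExponent P = dimOfParts n P.parts := by
  unfold dimExponent dimOfParts
  rw [← Finset.sum_attach P.parts]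
  congr 1
  refine Finset.sum_congr rfl fun b _ => ?_
  rw [spanLength, dif_pos (P.nonempty_of_mem_parts b.2)]

theorem card_le_spanLength {b : Finset ℕ} (h : b.Nonempty) : (b.card : ℤ) ≤ spanLength b := by
  rw [spanLength, dif_pos h]
  have h1 : b ⊆ Finset.Icc (b.min' h) (b.max' h) := fun x hx =>
    Finset.mem_Icc.2 ⟨Finset.min'_le _ _ hx, Finset.le_max' _ _ hx⟩
  have h2 := Finset.card_le_card h1
  rw [Nat.card_Icc] at h2
  have h3 : b.min' h ≤ b.max' h := Finset.min'_le_max' b h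
  omega

theorem dimOfParts_nonneg {n : ℕ} (P : SetPartition n) : 0 ≤ dimOfParts n P.parts := by
  have h : ((∑ b ∈ P.parts, b.card : ℕ) : ℤ) ≤ ∑ b ∈ P.parts, spanLength b := by
    push_cast
    exact Finset.sum_le_sum fun b hb => card_le_spanLength (P.nonempty_of_mem_parts hb)
  rw [P.sum_card_parts, Nat.card_Icc] at h
  unfold dimOfParts
  push_cast at h ⊢
  omega

/-- The distance from the largest element of a block to `n`. -/
def blockGap (n : ℕ) (b : Finset ℕ) : ℕ := n - b.sup id

theorem sup_le_of_mem_parts {n : ℕ} (P : SetPartition n) {b : Finset ℕ} (hb : b ∈ P.parts) :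
    b.sup id ≤ n :=
  Finset.sup_le fun _ hx => (Finset.mem_Icc.1 (P.subset hb hx)).2

theorem blockGap_succ {n : ℕ} (P : SetPartition n) {b : Finset ℕ} (hb : b ∈ P.parts) :
    blockGap (n + 1) b = blockGap n b + 1 := by
  have := sup_le_of_mem_parts P hb
  unfold blockGap
  omega

theorem max'_eq_sup (b : Finset ℕ) (h : b.Nonempty) : b.max' h = b.sup id := by
  rw [Finset.max'_eq_sup', Finset.sup'_eq_sup]

theorem blockGap_insert {n : ℕ} (b : Finset ℕ) : blockGap (n + 1) (insert (n + 1) b) = 0 := by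
  unfold blockGap
  have : n + 1 ≤ (insert (n + 1) b).sup id :=
    Finset.le_sup (f := id) (Finset.mem_insert_self (n + 1) b)
  omega

theorem succ_notMem_Icc (n : ℕ) : n + 1 ∉ Finset.Icc 1 n := by simp

theorem insert_Icc_one (n : ℕ) : insert (n + 1) (Finset.Icc 1 n) = Finset.Icc 1 (n + 1) := by
  ext x
  simp only [Finset.mem_insert, Finset.mem_Icc]
  omega

theorem spanLength_insert {n : ℕ} (P : SetPartition n) {b : Finset ℕ} (hb : b ∈ P.parts) :
    spanLength (insert (n + 1) b) = spanLength b + blockGap n b + 1 := by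
  have hne := P.nonempty_of_mem_parts hb
  have hsup := sup_le_of_mem_parts P hb
  rw [spanLength, spanLength, dif_pos hne, dif_pos (Finset.insert_nonempty _ _),
    Finset.min'_insert (n + 1) b hne, Finset.max'_insert (n + 1) b hne, max'_eq_sup b hne, blockGap]
  have h1 : b.min' hne ≤ b.sup id := Finset.le_sup (f := id) (b.min'_mem hne)
  rw [max_eq_left (by omega : b.sup id ≤ n + 1), min_eq_right (by omega : b.min' hne ≤ n + 1)]
  omega

theorem dimOfParts_insert_singleton {n : ℕ} (P : SetPartition n) :
    dimOfParts (n + 1) (insert {n + 1} P.parts) = dimOfParts n P.parts := by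
  have h : ({n + 1} : Finset ℕ) ∉ P.parts := fun h =>
    notMem_of_mem_parts (succ_notMem_Icc n) P h (by simp)
  unfold dimOfParts
  rw [Finset.sum_insert h, spanLength, dif_pos (Finset.singleton_nonempty _)]
  simp
  ring

theorem insert_notMem_erase {n : ℕ} (P : SetPartition n) (b : Finset ℕ) :
    insert (n + 1) b ∉ P.parts.erase b := fun h =>
  notMem_of_mem_parts (succ_notMem_Icc n) P (Finset.mem_of_mem_erase h) (by simp)

theorem dimOfParts_insert_block {n : ℕ} (P : SetPartition n) {b : Finset ℕ} (hb : b ∈ P.parts) :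
    dimOfParts (n + 1) (insert (insert (n + 1) b) (P.parts.erase b))
      = dimOfParts n P.parts + blockGap n b := by
  unfold dimOfParts
  rw [Finset.sum_insert (insert_notMem_erase P b), spanLength_insert P hb,
    ← Finset.add_sum_erase P.parts spanLength hb]
  push_cast
  ring

/-! ### The q-generating polynomial and its recursion. -/

section GeneratingFunction

open Polynomial

variable {R : Type*} [CommRing R] (q : R)

/-- The weight `q ^ d ∏ (1 + q ^ g X)` of a set partition, `g` running over the gaps of the
blocks. -/
noncomputable def dimWeight (n : ℕ) (parts : Finset (Finset ℕ)) : R[X] :=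
  C (q ^ (dimOfParts n parts).toNat) * ∏ b ∈ parts, (1 + C (q ^ blockGap n b) * X)

/-- The generating polynomial of the dimension exponent and the marked blocks. -/
noncomputable def dimGen (n : ℕ) : R[X] := ∑ P : SetPartition n, dimWeight q n P.parts

theorem dimGen_zero : dimGen q 0 = 1 := by
  unfold dimGen
  have : (Finset.Icc 1 0 : Finset ℕ) = ⊥ := by simp
  have hP : ∀ P : SetPartition 0, dimWeight q 0 P.parts = 1 := by
    intro P
    have h : P.parts = ∅ := P.parts_eq_empty_iff.2 this
    simp [dimWeight, h, dimOfParts]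
  rw [Finset.sum_congr rfl fun P _ => hP P, Finset.sum_const, Finset.card_univ]
  have : Fintype.card (SetPartition 0) = 1 := by
    unfold SetPartition
    rw [this]
    exact Fintype.card_unique
  rw [this, one_smul]

/-- All old gaps grow by one, which is the substitution X ↦ qX; the new block has gap 0 and
contributes 1 + X. -/
theorem dimWeight_insert_singleton {n : ℕ} (P : SetPartition n) :
    dimWeight q (n + 1) (insert {n + 1} P.parts)
      = (1 + X) * (dimWeight q n P.parts).comp (C q * X) := by
  have h : ({n + 1} : Finset ℕ) ∉ P.parts := fun h =>
    notMem_of_mem_parts (succ_notMem_Icc n) P h (by simp)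
  unfold dimWeight
  rw [dimOfParts_insert_singleton, Finset.prod_insert h,
    show ({n + 1} : Finset ℕ) = insert (n + 1) ∅ from rfl, blockGap_insert, mul_comp, C_comp,
    prod_comp]
  have : ∀ b ∈ P.parts, (1 + C (q ^ blockGap (n + 1) b) * X : R[X])
      = (1 + C (q ^ blockGap n b) * X).comp (C q * X) := by
    intro b hb
    rw [blockGap_succ P hb]
    simp
    ring
  rw [Finset.prod_congr rfl this]
  simp
  ring

/-- This is the product rule: the factor of `b` has derivative q^gap, which is exactly the growth of
q^d, and the enlarged block has gap 0. -/
theorem dimWeight_insert_block {n : ℕ} (P : SetPartition n) :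
    ∑ b ∈ P.parts, dimWeight q (n + 1) (insert (insert (n + 1) b) (P.parts.erase b))
      = (1 + X) * (derivative (dimWeight q n P.parts)).comp (C q * X) := by
  unfold dimWeight
  rw [derivative_C_mul, derivative_prod_finset, mul_comp, C_comp, Polynomial.sum_comp, Finset.mul_sum,
    Finset.mul_sum]
  refine Finset.sum_congr rfl fun b hb => ?_
  rw [dimOfParts_insert_block P hb, Finset.prod_insert (insert_notMem_erase P b), blockGap_insert,
    Int.toNat_add (dimOfParts_nonneg P) (by positivity), Int.toNat_natCast, mul_comp, prod_comp]
  have : ∀ b' ∈ P.parts.erase b, (1 + C (q ^ blockGap (n + 1) b') * X : R[X])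
      = (1 + C (q ^ blockGap n b') * X).comp (C q * X) := by
    intro b' hb'
    rw [blockGap_succ P (Finset.mem_of_mem_erase hb')]
    simp
    ring
  have hd : derivative (1 + C (q ^ blockGap n b) * X : R[X]) = C (q ^ blockGap n b) := by
    rw [derivative_add, derivative_one, derivative_C_mul, derivative_X, zero_add, mul_one]
  rw [Finset.prod_congr rfl this, hd]
  simp
  ring

theorem dimGen_succ (n : ℕ) :
    dimGen q (n + 1) = (1 + X) * (dimGen q n + derivative (dimGen q n)).comp (C q * X) := by
  unfold dimGen
  rw [sum_finpartition_insert (succ_notMem_Icc n) (insert_Icc_one n) (dimWeight q (n + 1)),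
    derivative_sum, add_comp, Polynomial.sum_comp, Polynomial.sum_comp, mul_add, Finset.mul_sum,
    Finset.mul_sum, ← Finset.sum_add_distrib]
  refine Finset.sum_congr rfl fun P _ => ?_
  rw [dimWeight_insert_singleton, dimWeight_insert_block]

theorem dimGen_eval_zero (n : ℕ) :
    (dimGen q n).eval 0 = ∑ P : SetPartition n, q ^ (dimExponent P).toNat := by
  unfold dimGen dimWeight
  rw [eval_finsetSum]
  refine Finset.sum_congr rfl fun P _ => ?_
  rw [eval_mul, eval_prod, dimExponent_eq]
  simp

end GeneratingFunction

/-! ### Expansion of the generating polynomial to third order at q = 1. -/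

section Jets

open Polynomial

/-- The polynomials `A`, with `A₀ = 1` and `A_{n + 1} = (1 + X) (A_n + A_n')`, which count set
partitions with marked blocks. -/
noncomputable def markedBell : ℕ → ℝ[X]
  | 0 => 1
  | n + 1 => (1 + X) * (markedBell n + derivative (markedBell n))

/-- First order part in `q - 1` of the generating polynomial of the dimension exponent. -/
noncomputable def dimJetOne : ℕ → ℝ[X]
  | 0 => 0
  | n + 1 => (1 + X) * (dimJetOne n + derivative (dimJetOne n)
      + X * derivative (markedBell n + derivative (markedBell n)))

/-- Second order part in `q - 1` of the generating polynomial of the dimension exponent. -/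
noncomputable def dimJetTwo : ℕ → ℝ[X]
  | 0 => 0
  | n + 1 => (1 + X) * (dimJetTwo n + derivative (dimJetTwo n)
      + X * derivative (dimJetOne n + derivative (dimJetOne n))
      + C (1 / 2) * X ^ 2 * derivative (derivative (markedBell n + derivative (markedBell n))))

/-- Third order part in `q - 1` of the generating polynomial of the dimension exponent. -/
noncomputable def dimJetThree : ℕ → ℝ[X]
  | 0 => 0
  | n + 1 => (1 + X) * (dimJetThree n + derivative (dimJetThree n)
      + X * derivative (dimJetTwo n + derivative (dimJetTwo n))
      + C (1 / 2) * X ^ 2 * derivative (derivative (dimJetOne n + derivative (dimJetOne n)))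
      + C (1 / 6) * X ^ 3 * derivative (derivative (derivative
        (markedBell n + derivative (markedBell n)))))

/-- The expansion of `p ((1 + h) x)` to third order in `h`. -/
theorem exists_comp_scale_eq {R : Type*} [CommRing R] (h u : R) (hu : 6 * u = 1) (p : R[X]) :
    ∃ e : R[X], p.comp (C (1 + h) * X) = p + C h * (X * derivative p)
      + C h ^ 2 * (C (3 * u) * X ^ 2 * derivative (derivative p))
      + C h ^ 3 * (C u * X ^ 3 * derivative (derivative (derivative p))) + C h ^ 4 * e := by
  have hu' : 6 * (C u : R[X]) = 1 := by
    rw [← C_1, ← hu, C_mul]; rfl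
  have h3 : (C (3 * u) : R[X]) = 3 * C u := by rw [C_mul]; rfl
  rw [h3]
  induction p using Polynomial.induction_on with
  | C a => exact ⟨0, by simp⟩
  | add p q hp hq =>
    obtain ⟨e, he⟩ := hp
    obtain ⟨f, hf⟩ := hq
    refine ⟨e + f, ?_⟩
    rw [add_comp, he, hf]
    simp only [derivative_add]
    ring
  | monomial n a ih =>
    obtain ⟨e, he⟩ := ih
    rw [pow_succ, ← mul_assoc]
    generalize C a * X ^ n = p at he
    refine ⟨C (1 + h) * X * e + C u * X ^ 4 * derivative (derivative (derivative p)), ?_⟩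
    rw [mul_comp, he, X_comp]
    simp only [derivative_add, derivative_mul, derivative_X, mul_one, C_add, C_1]
    linear_combination (-C h ^ 2 * X ^ 2 * derivative p) * hu'

theorem exists_dimGen_eq (n : ℕ) : ∃ e : ℝ[X][X], dimGen (1 + X : ℝ[X]) n
    = (markedBell n).map C + C X * (dimJetOne n).map C + C X ^ 2 * (dimJetTwo n).map C
      + C X ^ 3 * (dimJetThree n).map C + C X ^ 4 * e := by
  induction n with
  | zero => exact ⟨0, by simp [dimGen_zero, markedBell, dimJetOne, dimJetTwo, dimJetThree]⟩
  | succ n ih =>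
    obtain ⟨e, he⟩ := ih
    have hu : 6 * (C (1 / 6) : ℝ[X]) = 1 := by
      rw [← C_1, show (6 : ℝ[X]) = C 6 from rfl, ← C_mul]; norm_num
    have hhalf : (3 * C (1 / 6) : ℝ[X]) = C (1 / 2) := by
      rw [show (3 : ℝ[X]) = C 3 from rfl, ← C_mul]; norm_num
    have key := fun p : ℝ[X][X] => exists_comp_scale_eq (X : ℝ[X]) (C (1 / 6)) hu p
    simp only [hhalf] at key
    obtain ⟨e0, h0⟩ := key ((markedBell n).map C + derivative ((markedBell n).map C))
    obtain ⟨e1, h1⟩ := key ((dimJetOne n).map C + derivative ((dimJetOne n).map C))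
    obtain ⟨e2, h2⟩ := key ((dimJetTwo n).map C + derivative ((dimJetTwo n).map C))
    obtain ⟨e3, h3⟩ := key ((dimJetThree n).map C + derivative ((dimJetThree n).map C))
    have hsplit : dimGen (1 + X : ℝ[X]) n + derivative (dimGen (1 + X : ℝ[X]) n)
        = ((markedBell n).map C + derivative ((markedBell n).map C))
          + C X * ((dimJetOne n).map C + derivative ((dimJetOne n).map C))
          + C X ^ 2 * ((dimJetTwo n).map C + derivative ((dimJetTwo n).map C))
          + C X ^ 3 * ((dimJetThree n).map C + derivative ((dimJetThree n).map C))
          + C X ^ 4 * (e + derivative e) := by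
      rw [he]
      simp only [derivative_add, ← C_pow, derivative_C_mul]
      ring
    rw [dimGen_succ, hsplit]
    simp only [markedBell, dimJetOne, dimJetTwo, dimJetThree, Polynomial.map_mul,
      Polynomial.map_add, Polynomial.map_one, Polynomial.map_pow, map_X, map_C, ← derivative_map]
    generalize (markedBell n).map C + derivative ((markedBell n).map C) = g0 at h0 ⊢
    generalize (dimJetOne n).map C + derivative ((dimJetOne n).map C) = g1 at h1 ⊢
    generalize (dimJetTwo n).map C + derivative ((dimJetTwo n).map C) = g2 at h2 ⊢
    generalize (dimJetThree n).map C + derivative ((dimJetThree n).map C) = g3 at h3 ⊢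
    simp only [add_comp, mul_comp, pow_comp, C_comp]
    rw [h0, h1, h2, h3]
    refine ⟨(1 + X) * (e0 + C X * e1 + C X ^ 2 * e2 + C X ^ 3 * e3
      + C (C (1 / 6)) * X ^ 3 * (derivative (derivative (derivative g1))
        + C X * derivative (derivative (derivative g2))
        + C X ^ 2 * derivative (derivative (derivative g3)))
      + C (C (1 / 2)) * X ^ 2 * (derivative (derivative g2) + C X * derivative (derivative g3))
      + X * derivative g3 + (e + derivative e).comp (C (1 + X) * X)), ?_⟩
    simp only [add_comp]
    ring

end Jets

/-! ### Power sums of the dimension exponent as combinations of Bell numbers. -/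

section ClosedForms

open Polynomial

theorem iterate_derivative_one_add_X_mul (p : ℝ[X]) (i : ℕ) :
    derivative^[i] ((1 + X) * p) = (1 + X) * derivative^[i] p + (i : ℝ[X]) * derivative^[i - 1] p := by
  induction i with
  | zero => simp
  | succ i ih =>
    rw [Function.iterate_succ_apply', ih]
    rcases i with _ | i
    · simp
      ring
    · simp only [derivative_add, derivative_mul, derivative_one, derivative_X, derivative_natCast,
        ← Function.iterate_succ_apply' derivative, Nat.add_sub_cancel, Nat.succ_eq_add_one]
      push_cast
      ring

/-- The action of `p ↦ (1 + X) (p + p')` on the sequence of the iterated derivatives of `p`. -/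
noncomputable def derivSeqStep (p : ℕ → ℝ[X]) (i : ℕ) : ℝ[X] :=
  (1 + X) * (p i + p (i + 1)) + C (i : ℝ) * (p (i - 1) + p (i - 1 + 1))

theorem iterate_derivative_markedBell_succ (n : ℕ) :
    (fun i => derivative^[i] (markedBell (n + 1)))
      = derivSeqStep fun i => derivative^[i] (markedBell n) := by
  have h : ∀ j, derivative^[j] (markedBell n + derivative (markedBell n))
      = derivative^[j] (markedBell n) + derivative^[j + 1] (markedBell n) := fun j => by
    rw [iterate_map_add, ← Function.iterate_succ_apply]
  funext i
  rw [markedBell, iterate_derivative_one_add_X_mul, h, h]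
  rfl

/-- Closed form of `dimJetOne` in terms of `p i`, the `i`-th derivative of `markedBell n`. -/
noncomputable def dimJetOneForm (n : ℝ) (p : ℕ → ℝ[X]) : ℝ[X] :=
    (C (n)
      + C (n) * X) * p 0
    + (C (n - 2)
      + C (n - 3) * X
      + C (-1) * X ^ 2) * p 1
    + (C (-2)
      + C (-3) * X
      + C (-1) * X ^ 2) * p 2

/-- Closed form of `dimJetTwo` in terms of `p i`, the `i`-th derivative of `markedBell n`. -/
noncomputable def dimJetTwoForm (n : ℝ) (p : ℕ → ℝ[X]) : ℝ[X] :=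
    (C (n ^ 2 - 4 * n)
      + C (3/2 * n ^ 2 - 11/2 * n) * X
      + C (1/2 * n ^ 2 - n) * X ^ 2) * p 0
    + (C (3/2 * n ^ 2 - 21/2 * n + 12)
      + C (5/2 * n ^ 2 - 33/2 * n + 21) * X
      + C (n ^ 2 - 7 * n + 21/2) * X ^ 2
      + C (-n + 3/2) * X ^ 3) * p 1
    + (C (1/2 * n ^ 2 - 8 * n + 45/2)
      + C (n ^ 2 - 16 * n + 45) * X
      + C (1/2 * n ^ 2 - 10 * n + 115/4) * X ^ 2
      + C (-2 * n + 27/4) * X ^ 3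
      + C (1/2) * X ^ 4) * p 2
    + (C (-2 * n + 25/2)
      + C (-5 * n + 30) * X
      + C (-4 * n + 99/4) * X ^ 2
      + C (-n + 33/4) * X ^ 3
      + C (1) * X ^ 4) * p 3
    + (C (2)
      + C (6) * X
      + C (13/2) * X ^ 2
      + C (3) * X ^ 3
      + C (1/2) * X ^ 4) * p 4

/-- Closed form of `dimJetThree` in terms of `p i`, the `i`-th derivative of `markedBell n`. -/
noncomputable def dimJetThreeForm (n : ℝ) (p : ℕ → ℝ[X]) : ℝ[X] :=
    (C (5/6 * n ^ 3 - 19/2 * n ^ 2 + 24 * n)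
      + C (5/3 * n ^ 3 - 33/2 * n ^ 2 + 233/6 * n) * X
      + C (n ^ 3 - 8 * n ^ 2 + 16 * n) * X ^ 2
      + C (1/6 * n ^ 3 - n ^ 2 + 3/2 * n) * X ^ 3) * p 0
    + (C (5/3 * n ^ 3 - 24 * n ^ 2 + 295/3 * n - 274/3)
      + C (11/3 * n ^ 3 - 97/2 * n ^ 2 + 1163/6 * n - 565/3) * X
      + C (5/2 * n ^ 3 - 31 * n ^ 2 + 245/2 * n - 127) * X ^ 2
      + C (1/2 * n ^ 3 - 7 * n ^ 2 + 59/2 * n - 98/3) * X ^ 3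
      + C (-1/2 * n ^ 2 + 5/2 * n - 8/3) * X ^ 4) * p 1
    + (C (n ^ 3 - 43/2 * n ^ 2 + 139 * n - 752/3)
      + C (5/2 * n ^ 3 - 103/2 * n ^ 2 + 325 * n - 1766/3) * X
      + C (2 * n ^ 3 - 42 * n ^ 2 + 529/2 * n - 973/2) * X ^ 2
      + C (1/2 * n ^ 3 - 27/2 * n ^ 2 + 363/4 * n - 1043/6) * X ^ 3
      + C (-3/2 * n ^ 2 + 51/4 * n - 161/6) * X ^ 4
      + C (1/2 * n - 3/2) * X ^ 5) * p 2
    + (C (1/6 * n ^ 3 - 8 * n ^ 2 + 171/2 * n - 4511/18)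
      + C (1/2 * n ^ 3 - 23 * n ^ 2 + 473/2 * n - 6124/9) * X
      + C (1/2 * n ^ 3 - 47/2 * n ^ 2 + 955/4 * n - 8203/12) * X ^ 2
      + C (1/6 * n ^ 3 - 10 * n ^ 2 + 431/4 * n - 11423/36) * X ^ 3
      + C (-3/2 * n ^ 2 + 43/2 * n - 2525/36) * X ^ 4
      + C (3/2 * n - 27/4) * X ^ 5
      + C (-1/6) * X ^ 6) * p 3
    + (C (-n ^ 2 + 45/2 * n - 1997/18)
      + C (-7/2 * n ^ 2 + 149/2 * n - 6365/18) * X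
      + C (-9/2 * n ^ 2 + 373/4 * n - 5185/12) * X ^ 2
      + C (-5/2 * n ^ 2 + 109/2 * n - 2294/9) * X ^ 3
      + C (-1/2 * n ^ 2 + 59/4 * n - 2717/36) * X ^ 4
      + C (3/2 * n - 21/2) * X ^ 5
      + C (-1/2) * X ^ 6) * p 4
    + (C (2 * n - 21)
      + C (8 * n - 159/2) * X
      + C (25/2 * n - 119) * X ^ 2
      + C (19/2 * n - 357/4) * X ^ 3
      + C (7/2 * n - 35) * X ^ 4
      + C (1/2 * n - 27/4) * X ^ 5
      + C (-1/2) * X ^ 6) * p 5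
    + (C (-4/3)
      + C (-6) * X
      + C (-11) * X ^ 2
      + C (-21/2) * X ^ 3
      + C (-11/2) * X ^ 4
      + C (-3/2) * X ^ 5
      + C (-1/6) * X ^ 6) * p 6

-- The coefficients of the closed forms come from an ansatz. Since only p_i' = p_{i+1} enters, the
-- induction step is a polynomial identity in n, x and the values p_i(x).
set_option maxHeartbeats 4000000 in
theorem dimJetOneForm_succ (n : ℝ) (p : ℕ → ℝ[X]) (hp : ∀ i, derivative (p i) = p (i + 1)) :
    (1 + X) * (dimJetOneForm n p + derivative (dimJetOneForm n p)
      + X * (p 1 + p 2))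
      = dimJetOneForm (n + 1) (derivSeqStep p) := by
  refine Polynomial.funext fun x => ?_
  unfold dimJetOneForm
  simp only [derivative_add, derivative_mul, derivative_C, derivative_X, derivative_X_pow, hp,
    derivSeqStep, zero_mul, zero_add, mul_one]
  simp only [eval_add, eval_mul, eval_C, eval_X, eval_pow, eval_one, Nat.reduceSub,
    Nat.reduceAdd, Nat.cast_ofNat, Nat.cast_one, Nat.cast_zero, pow_one, zero_mul, zero_add, one_mul, add_zero]
  ring

set_option maxHeartbeats 4000000 in
theorem dimJetTwoForm_succ (n : ℝ) (p : ℕ → ℝ[X]) (hp : ∀ i, derivative (p i) = p (i + 1)) :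
    (1 + X) * (dimJetTwoForm n p + derivative (dimJetTwoForm n p)
      + X * derivative (dimJetOneForm n p + derivative (dimJetOneForm n p))
      + C (1 / 2) * X ^ 2 * (p 2 + p 3))
      = dimJetTwoForm (n + 1) (derivSeqStep p) := by
  refine Polynomial.funext fun x => ?_
  unfold dimJetOneForm dimJetTwoForm
  simp only [derivative_add, derivative_mul, derivative_C, derivative_X, derivative_X_pow, hp,
    derivSeqStep, zero_mul, zero_add, mul_one]
  simp only [eval_add, eval_mul, eval_C, eval_X, eval_pow, eval_one, Nat.reduceSub,
    Nat.reduceAdd, Nat.cast_ofNat, Nat.cast_one, Nat.cast_zero, pow_zero, pow_one, zero_mul, zero_add, mul_one, one_mul, add_zero]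
  ring

set_option maxHeartbeats 4000000 in
theorem dimJetThreeForm_succ (n : ℝ) (p : ℕ → ℝ[X]) (hp : ∀ i, derivative (p i) = p (i + 1)) :
    (1 + X) * (dimJetThreeForm n p + derivative (dimJetThreeForm n p)
      + X * derivative (dimJetTwoForm n p + derivative (dimJetTwoForm n p))
      + C (1 / 2) * X ^ 2 * derivative (derivative (dimJetOneForm n p + derivative (dimJetOneForm n p)))
      + C (1 / 6) * X ^ 3 * (p 3 + p 4))
      = dimJetThreeForm (n + 1) (derivSeqStep p) := by
  refine Polynomial.funext fun x => ?_
  unfold dimJetOneForm dimJetTwoForm dimJetThreeForm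
  simp only [derivative_add, derivative_mul, derivative_C, derivative_X, derivative_X_pow, hp,
    derivSeqStep, zero_mul, zero_add, mul_one]
  simp only [eval_add, eval_mul, eval_C, eval_X, eval_pow, eval_one, Nat.reduceSub,
    Nat.reduceAdd, Nat.cast_ofNat, Nat.cast_one, Nat.cast_zero, pow_zero, pow_one, zero_mul, zero_add, mul_one, one_mul, add_zero, mul_zero]
  ring

theorem iterate_derivative_markedBell_zero (i : ℕ) :
    derivative^[i] (markedBell 0) = if i = 0 then 1 else 0 := by
  rcases i with _ | i
  · rfl
  · rw [if_neg (Nat.succ_ne_zero i), markedBell]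
    exact iterate_derivative_one (Nat.succ_pos i)

theorem dimJetOne_eq (n : ℕ) :
    dimJetOne n = dimJetOneForm n fun i => derivative^[i] (markedBell n) := by
  induction n with
  | zero =>
    rw [show (fun i => derivative^[i] (markedBell 0)) = fun i => if i = 0 then 1 else 0 from
      funext iterate_derivative_markedBell_zero]
    -- For n = 0 only p_0 = 1 survives, and its coefficient is divisible by n.
    simp [dimJetOne, dimJetOneForm]
  | succ n ih =>
    rw [iterate_derivative_markedBell_succ, Nat.cast_succ, ← dimJetOneForm_succ _ _ fun i =>
      (Function.iterate_succ_apply' derivative i _).symm, ← ih, dimJetOne]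
    simp only [derivative_add, Function.iterate_succ_apply', Function.iterate_zero, id]

theorem dimJetTwo_eq (n : ℕ) :
    dimJetTwo n = dimJetTwoForm n fun i => derivative^[i] (markedBell n) := by
  induction n with
  | zero =>
    rw [show (fun i => derivative^[i] (markedBell 0)) = fun i => if i = 0 then 1 else 0 from
      funext iterate_derivative_markedBell_zero]
    simp [dimJetTwo, dimJetTwoForm]
  | succ n ih =>
    rw [iterate_derivative_markedBell_succ, Nat.cast_succ, ← dimJetTwoForm_succ _ _ fun i =>
      (Function.iterate_succ_apply' derivative i _).symm, ← ih, ← dimJetOne_eq, dimJetTwo]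
    simp only [derivative_add, Function.iterate_succ_apply', Function.iterate_zero, id]

theorem dimJetThree_eq (n : ℕ) :
    dimJetThree n = dimJetThreeForm n fun i => derivative^[i] (markedBell n) := by
  induction n with
  | zero =>
    rw [show (fun i => derivative^[i] (markedBell 0)) = fun i => if i = 0 then 1 else 0 from
      funext iterate_derivative_markedBell_zero]
    simp [dimJetThree, dimJetThreeForm]
  | succ n ih =>
    rw [iterate_derivative_markedBell_succ, Nat.cast_succ, ← dimJetThreeForm_succ _ _ fun i =>
      (Function.iterate_succ_apply' derivative i _).symm, ← ih, ← dimJetOne_eq, ← dimJetTwo_eq, dimJetThree]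
    simp only [derivative_add, Function.iterate_succ_apply', Function.iterate_zero, id]

/-- The derivatives of `markedBell n` at zero. -/
noncomputable def markedBellDeriv (n i : ℕ) : ℝ := (derivative^[i] (markedBell n)).eval 0

/-- The truncated difference `i - 1` is harmless at `i = 0`, being multiplied by `i`. -/
theorem markedBellDeriv_succ (n i : ℕ) : markedBellDeriv (n + 1) i
    = markedBellDeriv n i + markedBellDeriv n (i + 1)
      + i * (markedBellDeriv n (i - 1) + markedBellDeriv n (i - 1 + 1)) := by
  have h := congrFun (iterate_derivative_markedBell_succ n) i
  simp only [derivSeqStep] at h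
  simp only [markedBellDeriv, h]
  simp

theorem sum_one_add_X_pow_dimExponent (n : ℕ) : ∃ e : ℝ[X],
    ∑ P : SetPartition n, (1 + X : ℝ[X]) ^ (dimExponent P).toNat
      = C ((markedBell n).eval 0) + X * C ((dimJetOne n).eval 0)
        + X ^ 2 * C ((dimJetTwo n).eval 0) + X ^ 3 * C ((dimJetThree n).eval 0) + X ^ 4 * e := by
  obtain ⟨e, he⟩ := exists_dimGen_eq n
  refine ⟨e.eval 0, ?_⟩
  rw [← dimGen_eval_zero, he]
  have h : ∀ p : ℝ[X], (p.map C).eval 0 = C (p.eval 0) := fun p => by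
    rw [← C_0, eval_map, eval₂_at_apply]
  simp [h]

/-- The coefficient of h^j in (1 + h)^d is a binomial coefficient, so the jets at X = 0 are the
binomial moments of d. -/
theorem sum_choose_dimExponent (n j : ℕ) (hj : j < 4) :
    ∑ P : SetPartition n, (((dimExponent P).toNat.choose j : ℕ) : ℝ)
      = ![(markedBell n).eval 0, (dimJetOne n).eval 0, (dimJetTwo n).eval 0,
          (dimJetThree n).eval 0] ⟨j, hj⟩ := by
  obtain ⟨e, he⟩ := sum_one_add_X_pow_dimExponent n
  have h := congrArg (fun p => coeff p j) he
  simp only [finsetSum_coeff, coeff_one_add_X_pow] at h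
  rw [h]
  have hX : ∀ p : ℝ[X], X * p = X ^ 1 * p := fun p => by rw [pow_one]
  rw [hX]
  simp only [coeff_add, coeff_X_pow_mul', coeff_C]
  interval_cases j <;> simp

theorem bellNumber_eq (n : ℕ) : (bellNumber n : ℝ) = (markedBell n).eval 0 := by
  have := sum_choose_dimExponent n 0 (by norm_num)
  simpa [bellNumber] using this

theorem bellNumber_eq_markedBellDeriv (n : ℕ) : (bellNumber n : ℝ) = markedBellDeriv n 0 :=
  bellNumber_eq n

theorem cast_toNat_dimExponent {n : ℕ} (P : SetPartition n) :
    (((dimExponent P).toNat : ℕ) : ℝ) = dimExponent P := by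
  have h : ((dimExponent P).toNat : ℤ) = dimExponent P :=
    Int.toNat_of_nonneg (by rw [dimExponent_eq]; exact dimOfParts_nonneg P)
  exact_mod_cast congrArg (Int.cast : ℤ → ℝ) h

theorem markedBellDeriv_def (n i : ℕ) :
    (derivative^[i] (markedBell n)).eval 0 = markedBellDeriv n i := rfl

/-- Through `markedBellDeriv_succ` each B_{n+j} becomes a combination of the derivatives of A_n at
0, and so does the jet; the two combinations coincide. -/
theorem sum_dimExponent (n : ℕ) : ∑ P : SetPartition n, (dimExponent P : ℝ)
    = -2 * bellNumber (n + 2) + (n + 4) * bellNumber (n + 1) := by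
  have h1 : ∑ P : SetPartition n, (dimExponent P : ℝ) = (dimJetOne n).eval 0 := by
    have := sum_choose_dimExponent n 1 (by norm_num)
    simpa [cast_toNat_dimExponent] using this
  rw [h1, dimJetOne_eq]
  unfold dimJetOneForm
  simp only [bellNumber_eq_markedBellDeriv, markedBellDeriv_succ]
  simp only [eval_add, eval_mul, eval_C, eval_X, eval_pow, markedBellDeriv_def]
  push_cast
  ring

theorem sum_dimExponent_sq (n : ℕ) : ∑ P : SetPartition n, (dimExponent P : ℝ) ^ 2
    = 4 * bellNumber (n + 4) - (4 * n + 15) * bellNumber (n + 3)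
      + (n ^ 2 + 8 * n + 9) * bellNumber (n + 2) - (4 * n + 3) * bellNumber (n + 1)
      + n * bellNumber n := by
  have h1 : ∑ P : SetPartition n, (dimExponent P : ℝ) ^ 2
      = 2 * (dimJetTwo n).eval 0 + ∑ P : SetPartition n, (dimExponent P : ℝ) := by
    have := sum_choose_dimExponent n 2 (by norm_num)
    rw [show (dimJetTwo n).eval 0 = ∑ P : SetPartition n,
      (((dimExponent P).toNat.choose 2 : ℕ) : ℝ) by simpa using this.symm, Finset.mul_sum,
      ← Finset.sum_add_distrib]
    refine Finset.sum_congr rfl fun P _ => ?_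
    rw [Nat.cast_choose_two, cast_toNat_dimExponent]
    ring
  rw [h1, sum_dimExponent, dimJetTwo_eq]
  unfold dimJetTwoForm
  simp only [bellNumber_eq_markedBellDeriv, markedBellDeriv_succ]
  simp only [eval_add, eval_mul, eval_C, eval_X, eval_pow, markedBellDeriv_def]
  push_cast
  ring

theorem sum_dimExponent_cube (n : ℕ) : ∑ P : SetPartition n, (dimExponent P : ℝ) ^ 3
    = -8 * bellNumber (n + 6) + (12 * n + 42) * bellNumber (n + 5)
      + (-6 * n ^ 2 - 45 * n - 131 / 3) * bellNumber (n + 4)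
      + (n ^ 3 + 12 * n ^ 2 + 51 * n + 18) * bellNumber (n + 3)
      + (-12 * n ^ 2 - 45 * n + 8 / 3) * bellNumber (n + 2)
      + (3 * n ^ 2 + 6 * n - 1 / 3) * bellNumber (n + 1) + n * bellNumber n := by
  have h1 : ∑ P : SetPartition n, (dimExponent P : ℝ) ^ 3
      = 6 * (dimJetThree n).eval 0 + 3 * ∑ P : SetPartition n, (dimExponent P : ℝ) ^ 2
        - 2 * ∑ P : SetPartition n, (dimExponent P : ℝ) := by
    have := sum_choose_dimExponent n 3 (by norm_num)
    rw [show (dimJetThree n).eval 0 = ∑ P : SetPartition n,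
      (((dimExponent P).toNat.choose 3 : ℕ) : ℝ) by simpa using this.symm, Finset.mul_sum,
      Finset.mul_sum, Finset.mul_sum, ← Finset.sum_add_distrib, ← Finset.sum_sub_distrib]
    refine Finset.sum_congr rfl fun P _ => ?_
    -- From 6·binom(d,3) = d(d−1)(d−2) one gets d³ = 6·binom(d,3) + 3d² − 2d.
    have h6 : (((dimExponent P).toNat.descFactorial 3 : ℕ) : ℝ)
        = 6 * (((dimExponent P).toNat.choose 3 : ℕ) : ℝ) := by
      rw [Nat.descFactorial_eq_factorial_mul_choose]
      push_cast
      norm_num [Nat.factorial]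
    have hd : ∀ d : ℕ, ((d.descFactorial 3 : ℕ) : ℝ) = d * (d - 1) * (d - 2) := by
      intro d
      rcases d with _ | _ | d
      · simp
      · simp [Nat.descFactorial]
      · simp only [Nat.descFactorial_succ, Nat.descFactorial_zero]
        rw [show d + 1 + 1 - 2 = d by omega, show d + 1 + 1 - 1 = d + 1 by omega, Nat.sub_zero]
        push_cast
        ring
    rw [← h6, hd, cast_toNat_dimExponent]
    ring
  rw [h1, sum_dimExponent, sum_dimExponent_sq, dimJetThree_eq]
  unfold dimJetThreeForm
  simp only [bellNumber_eq_markedBellDeriv, markedBellDeriv_succ]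
  simp only [eval_add, eval_mul, eval_C, eval_X, eval_pow, markedBellDeriv_def]
  push_cast
  ring

end ClosedForms

/-! ### Bell numbers as contour integrals, and Poisson moments. -/

section ContourRepresentation

open Polynomial

theorem bellNumber_pos (n : ℕ) : 0 < bellNumber n := by
  unfold bellNumber
  exact Fintype.card_pos_iff.2 ⟨⊥⟩

/-- The linear map `X ^ j ↦ A_j`, which is `p ↦ E p(N)` for `N` Poisson of parameter `1 + X`. -/
noncomputable def poissonMap : ℝ[X] →ₗ[ℝ] ℝ[X] :=
  lsum fun j => LinearMap.toSpanSingleton ℝ ℝ[X] (markedBell j)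

theorem poissonMap_C_mul_X_pow (r : ℝ) (j : ℕ) :
    poissonMap (C r * X ^ j) = C r * markedBell j := by
  rw [C_mul_X_pow_eq_monomial]
  simp [poissonMap, sum_monomial_index, smul_eq_C_mul]

theorem poissonMap_C (r : ℝ) : poissonMap (C r) = C r := by
  have := poissonMap_C_mul_X_pow r 0
  simpa [markedBell] using this

theorem poissonMap_one : poissonMap 1 = 1 := by
  rw [← C_1, poissonMap_C]

theorem poissonMap_C_mul (r : ℝ) (p : ℝ[X]) : poissonMap (C r * p) = C r * poissonMap p := by
  rw [← smul_eq_C_mul, map_smul, smul_eq_C_mul]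

theorem poissonMap_X_mul (p : ℝ[X]) :
    poissonMap (X * p) = (1 + X) * (poissonMap p + derivative (poissonMap p)) := by
  induction p using Polynomial.induction_on with
  | C r =>
    have h := poissonMap_C_mul_X_pow r 1
    rw [pow_one] at h
    rw [mul_comm, h, poissonMap_C]
    simp [markedBell]
    ring
  | add p q hp hq =>
    rw [mul_add, map_add, map_add, hp, hq, derivative_add]
    ring
  | monomial j r _ =>
    rw [show X * (C r * X ^ (j + 1)) = C r * X ^ (j + 1 + 1) by ring, poissonMap_C_mul_X_pow,
      poissonMap_C_mul_X_pow, derivative_C_mul, markedBell]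
    ring

/-- The Chen–Stein identity λ E p(N) = E[N p(N − 1)] for N Poisson of parameter λ = 1 + X. It lets
multiplication by e^z act on polynomials. -/
theorem one_add_X_mul_poissonMap (p : ℝ[X]) :
    (1 + X) * poissonMap p = poissonMap (X * p.comp (X - 1)) := by
  induction p using Polynomial.induction_on with
  | C r =>
    rw [C_comp, poissonMap_X_mul, poissonMap_C]
    simp
  | add p q hp hq => rw [map_add, add_comp, mul_add, mul_add, map_add, hp, hq]
  | monomial j r ih =>
    rw [pow_succ', ← mul_assoc, mul_comm (C r) X, mul_assoc]
    generalize C r * X ^ j = p at ih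
    rw [mul_comp, X_comp, show X * ((X - 1) * p.comp (X - 1))
      = X * (X * p.comp (X - 1)) - X * p.comp (X - 1) by ring, map_sub,
      poissonMap_X_mul (X * _), ← ih, poissonMap_X_mul p]
    simp only [derivative_mul, derivative_add, derivative_one, derivative_X]
    ring

/-- The linear form `X ^ j ↦ B_{n + j} / B_n`. -/
noncomputable def bellMean (n : ℕ) : ℝ[X] →ₗ[ℝ] ℝ :=
  lsum fun j => LinearMap.toSpanSingleton ℝ ℝ ((bellNumber (n + j) : ℝ) / bellNumber n)

theorem bellMean_C_mul_X_pow (n : ℕ) (r : ℝ) (j : ℕ) :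
    bellMean n (C r * X ^ j) = r * (bellNumber (n + j) / bellNumber n) := by
  rw [C_mul_X_pow_eq_monomial]
  simp [bellMean, sum_monomial_index]

theorem bellMean_C_mul (n : ℕ) (r : ℝ) (p : ℝ[X]) : bellMean n (C r * p) = r * bellMean n p := by
  rw [← smul_eq_C_mul, map_smul, smul_eq_mul]

/-- The polynomial `poissonMap p` as a function of `z`, where `1 + X = exp z`. -/
noncomputable def poissonFun (p : ℝ[X]) (z : ℂ) : ℂ := aeval (Complex.exp z - 1) (poissonMap p)

/-- With λ = e^z the function is ∑ p(k) e^{kz}/k!, and differentiation multiplies the k-th term by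
k. -/
theorem hasDerivAt_poissonFun_mul (p : ℝ[X]) (z : ℂ) :
    HasDerivAt (fun z => poissonFun p z * Complex.exp (Complex.exp z))
      (poissonFun (X * p) z * Complex.exp (Complex.exp z)) z := by
  have h1 : HasDerivAt (fun z : ℂ => Complex.exp z - 1) (Complex.exp z) z :=
    (Complex.hasDerivAt_exp z).sub_const 1
  have h2 := (Polynomial.hasDerivAt_aeval (poissonMap p) (Complex.exp z - 1)).comp z h1
  have h3 := h2.mul (Complex.hasDerivAt_exp z).cexp
  refine h3.congr_deriv ?_
  simp only [poissonFun, poissonMap_X_mul, map_mul, map_add, map_one, aeval_X, Function.comp]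
  ring

theorem differentiable_poissonFun_mul (p : ℝ[X]) :
    Differentiable ℂ fun z => poissonFun p z * Complex.exp (Complex.exp z) :=
  fun z => (hasDerivAt_poissonFun_mul p z).differentiableAt

theorem continuous_poissonFun (p : ℝ[X]) : Continuous (poissonFun p) :=
  (Polynomial.continuous_aeval (R := ℝ) (A := ℂ) (poissonMap p)).comp
    (Complex.continuous_exp.sub continuous_const)

theorem iteratedDeriv_poissonFun (n : ℕ) (p : ℝ[X]) :
    iteratedDeriv n (fun z => poissonFun p z * Complex.exp (Complex.exp z))
      = fun z => poissonFun (X ^ n * p) z * Complex.exp (Complex.exp z) := by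
  induction n with
  | zero => simp
  | succ n ih =>
    rw [iteratedDeriv_succ, ih]
    funext z
    rw [(hasDerivAt_poissonFun_mul _ z).deriv, pow_succ', mul_assoc]

/-- The integrand of the contour integral for the Bell numbers. -/
noncomputable def bellKernel (n : ℕ) (z : ℂ) : ℂ := Complex.exp (Complex.exp z) / z ^ (n + 1)

/-- The normalized contour integral on the circle `|z| = a`. -/
noncomputable def contourMean (n : ℕ) (a : ℝ) (F : ℂ → ℂ) : ℂ :=
  (∮ z in C(0, a), F z * bellKernel n z)
    / (2 * Real.pi * Complex.I / n.factorial * (Complex.exp 1 * bellNumber n))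

/-- Cauchy's formula gives the n-th derivative at 0, which replaces p by X^n p; at z = 0 the Poisson
parameter is 1, whose moments are the Bell numbers. The factor e in the normalization is exp(exp 0).
-/
theorem contourMean_poissonFun (n : ℕ) {a : ℝ} (ha : 0 < a) (p : ℝ[X]) :
    contourMean n a (poissonFun p) = bellMean n p := by
  have key : (∮ z in C(0, a), poissonFun p z * bellKernel n z)
      = 2 * Real.pi * Complex.I / n.factorial
        * (poissonFun (X ^ n * p) 0 * Complex.exp 1) := by
    have h := (differentiable_poissonFun_mul p).diffContOnCl
      (s := Metric.ball (0 : ℂ) a) |>.circleIntegral_one_div_sub_center_pow_smul ha n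
    rw [iteratedDeriv_poissonFun] at h
    simp only [sub_zero, smul_eq_mul, Complex.exp_zero] at h
    rw [← h]
    congr 1
    funext z
    rw [bellKernel]
    ring
  rw [contourMean, key, mul_div_mul_left _ _ (div_ne_zero Complex.two_pi_I_ne_zero
    (Nat.cast_ne_zero.2 n.factorial_ne_zero)), mul_comm, mul_div_mul_left _ _
    (Complex.exp_ne_zero 1)]
  have hB : (bellNumber n : ℂ) ≠ 0 := Nat.cast_ne_zero.2 (bellNumber_pos n).ne'
  rw [div_eq_iff hB]
  have h0 : ∀ q : ℝ[X], poissonFun q 0 = ((poissonMap q).eval 0 : ℝ) := by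
    intro q
    rw [poissonFun, Complex.exp_zero, sub_self, show (0 : ℂ) = algebraMap ℝ ℂ 0 by simp,
      aeval_algebraMap_apply]
    simp [coe_aeval_eq_eval]
  rw [h0, ← Complex.ofReal_natCast, ← Complex.ofReal_mul, Complex.ofReal_inj]
  have hB' : (bellNumber n : ℝ) ≠ 0 := Nat.cast_ne_zero.2 (bellNumber_pos n).ne'
  clear key
  induction p using Polynomial.induction_on with
  | C r =>
    have := bellMean_C_mul_X_pow n r 0
    rw [pow_zero, mul_one] at this
    rw [this, mul_comm, poissonMap_C_mul_X_pow, eval_mul, eval_C, ← bellNumber_eq]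
    field_simp
    simp
  | add p q hp hq => rw [mul_add, map_add, map_add, eval_add, hp, hq, add_mul]
  | monomial j r _ =>
    rw [show X ^ n * (C r * X ^ (j + 1)) = C r * X ^ (n + (j + 1)) by ring,
      poissonMap_C_mul_X_pow, bellMean_C_mul_X_pow, eval_mul, eval_C, ← bellNumber_eq]
    field_simp

theorem circleIntegrable_mul_bellKernel (n : ℕ) {a : ℝ} (ha : 0 < a) {F : ℂ → ℂ}
    (hF : ContinuousOn F (Metric.sphere 0 a)) :
    CircleIntegrable (fun z => F z * bellKernel n z) 0 a := by
  refine ContinuousOn.circleIntegrable ha.le (hF.mul (ContinuousOn.div ?_ ?_ ?_))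
  · exact (Complex.continuous_exp.comp Complex.continuous_exp).continuousOn
  · exact (continuous_pow _).continuousOn
  · intro z hz h
    have : z = 0 := pow_eq_zero_iff (Nat.succ_ne_zero n) |>.1 h
    rw [this, Metric.mem_sphere, dist_self] at hz
    exact ha.ne hz

theorem contourMean_add (n : ℕ) {a : ℝ} (ha : 0 < a) {F G : ℂ → ℂ}
    (hF : ContinuousOn F (Metric.sphere 0 a)) (hG : ContinuousOn G (Metric.sphere 0 a)) :
    contourMean n a (fun z => F z + G z) = contourMean n a F + contourMean n a G := by
  unfold contourMean
  rw [← add_div, ← circleIntegral.integral_add (circleIntegrable_mul_bellKernel n ha hF)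
    (circleIntegrable_mul_bellKernel n ha hG)]
  simp only [add_mul]

theorem contourMean_const_mul (n : ℕ) (a : ℝ) (k : ℂ) (F : ℂ → ℂ) :
    contourMean n a (fun z => k * F z) = k * contourMean n a F := by
  unfold contourMean
  rw [← mul_div_assoc, ← circleIntegral.integral_const_mul]
  simp only [mul_assoc]

theorem contourMean_congr (n : ℕ) {a : ℝ} (ha : 0 < a) {F G : ℂ → ℂ}
    (h : ∀ z ∈ Metric.sphere (0 : ℂ) a, F z = G z) : contourMean n a F = contourMean n a G := by
  unfold contourMean
  rw [circleIntegral.integral_congr ha.le fun z hz => by rw [h z hz]]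

theorem contourMean_sum (n : ℕ) {a : ℝ} (ha : 0 < a) {ι : Type*} (s : Finset ι) (F : ι → ℂ → ℂ)
    (hF : ∀ i ∈ s, ContinuousOn (F i) (Metric.sphere 0 a)) :
    contourMean n a (fun z => ∑ i ∈ s, F i z) = ∑ i ∈ s, contourMean n a (F i) := by
  classical
  induction s using Finset.induction_on with
  | empty => simp [contourMean, circleIntegral]
  | insert i s hi ih =>
    simp only [Finset.sum_insert hi]
    rw [contourMean_add n ha (hF i (Finset.mem_insert_self i s))
      (continuousOn_finsetSum s fun j hj => hF j (Finset.mem_insert_of_mem hj)),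
      ih fun j hj => hF j (Finset.mem_insert_of_mem hj)]

/-- Integration by parts. -/
theorem bellMean_X_mul (n : ℕ) {a : ℝ} (ha : 0 < a) (p : ℝ[X]) :
    (bellMean n (X * p) : ℂ) = (n + 1) * contourMean n a (fun z => z⁻¹ * poissonFun p z) := by
  rw [← contourMean_poissonFun n ha, ← contourMean_const_mul]
  unfold contourMean
  congr 1
  have hne : ∀ z ∈ Metric.sphere (0 : ℂ) a, z ≠ 0 := by
    rintro z hz rfl
    rw [Metric.mem_sphere, dist_self] at hz
    exact ha.ne hz
  -- The difference of the integrands is the derivative of a function that is single-valued on the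
  -- circle.
  have hi : (∮ z in C(0, a), (poissonFun (X * p) z * bellKernel n z
      - (n + 1) * (z⁻¹ * poissonFun p z) * bellKernel n z)) = 0 := by
    refine circleIntegral.integral_eq_zero_of_hasDerivWithinAt
      (f := fun z => poissonFun p z * Complex.exp (Complex.exp z) * (z ^ (n + 1))⁻¹) ha.le
      fun z hz => HasDerivAt.hasDerivWithinAt ?_
    have hz0 := hne z hz
    have h1 := (hasDerivAt_pow (n + 1) z).inv (pow_ne_zero _ hz0)
    refine ((hasDerivAt_poissonFun_mul p z).mul h1).congr_deriv ?_
    simp only [bellKernel, Nat.add_sub_cancel, Pi.inv_apply]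
    field_simp
    push_cast
    ring
  have hc : ContinuousOn (fun z => (n + 1 : ℂ) * (z⁻¹ * poissonFun p z)) (Metric.sphere 0 a) :=
    continuousOn_const.mul ((continuousOn_inv₀.mono fun z hz => hne z hz).mul
      (continuous_poissonFun p).continuousOn)
  rw [circleIntegral.integral_sub (circleIntegrable_mul_bellKernel n ha
    (continuous_poissonFun _).continuousOn) (circleIntegrable_mul_bellKernel n ha hc)] at hi
  exact sub_eq_zero.1 hi

end ContourRepresentation

/-! ### A lower bound for the Bell numbers. -/

section BellLowerBound

theorem markedBell_eq_sum_stirlingSecond (n : ℕ) :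
    markedBell n = ∑ k ∈ Finset.range (n + 1),
      Polynomial.C (Nat.stirlingSecond n k : ℝ) * (1 + Polynomial.X) ^ k := by
  induction n with
  | zero => simp [markedBell]
  | succ n ih =>
    rw [markedBell, Finset.sum_range_succ', Nat.stirlingSecond_succ_zero]
    simp only [Nat.stirlingSecond_succ_succ]
    have h1 : ∀ k : ℕ, Polynomial.C (((k + 1) * Nat.stirlingSecond n (k + 1)
        + Nat.stirlingSecond n k : ℕ) : ℝ) * (1 + Polynomial.X : Polynomial ℝ) ^ (k + 1)
        = Polynomial.C (((k + 1 : ℕ) : ℝ) * Nat.stirlingSecond n (k + 1))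
            * (1 + Polynomial.X) ^ (k + 1)
          + (1 + Polynomial.X) * (Polynomial.C (Nat.stirlingSecond n k : ℝ)
            * (1 + Polynomial.X) ^ k) := by
      intro k
      push_cast
      simp only [map_add, map_mul]
      ring
    simp only [h1]
    rw [Finset.sum_add_distrib, ← Finset.mul_sum, ← ih]
    have h2 : (1 + Polynomial.X) * Polynomial.derivative (markedBell n)
        = ∑ k ∈ Finset.range (n + 1), Polynomial.C (((k + 1 : ℕ) : ℝ)
          * Nat.stirlingSecond n (k + 1)) * (1 + Polynomial.X) ^ (k + 1) := by
      rw [ih, Polynomial.derivative_sum, Finset.mul_sum, Finset.sum_range_succ',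
        Finset.sum_range_succ (n := n), Nat.stirlingSecond_eq_zero_of_lt (Nat.lt_succ_self n)]
      simp only [Polynomial.derivative_C_mul, Polynomial.derivative_pow, Polynomial.derivative_add,
        Polynomial.derivative_one, Polynomial.derivative_X, Nat.cast_zero, mul_zero, pow_zero,
        Polynomial.C_0, zero_mul, add_zero, Nat.add_sub_cancel]
      refine Finset.sum_congr rfl fun k _ => ?_
      rw [map_mul]
      ring
    rw [mul_add, h2, Nat.cast_zero, Polynomial.C_0, zero_mul, add_zero, add_comm]

theorem sum_stirlingSecond_mul_descFactorial (n m : ℕ) :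
    ∑ k ∈ Finset.range (n + 1), Nat.stirlingSecond n k * m.descFactorial k = m ^ n := by
  induction n with
  | zero => simp
  | succ n ih =>
    rw [Finset.sum_range_succ', Nat.stirlingSecond_succ_zero, zero_mul, add_zero, pow_succ', ← ih,
      Finset.mul_sum]
    have h1 : ∀ k, m * (Nat.stirlingSecond n k * m.descFactorial k)
        = k * Nat.stirlingSecond n k * m.descFactorial k
          + Nat.stirlingSecond n k * m.descFactorial (k + 1) := by
      intro k
      rcases le_or_gt k m with h | h
      · obtain ⟨d, rfl⟩ := Nat.exists_eq_add_of_le h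
        rw [Nat.descFactorial_succ, Nat.add_sub_cancel_left]
        ring
      · rw [Nat.descFactorial_of_lt h, Nat.descFactorial_of_lt (h.trans (Nat.lt_succ_self k))]
        simp
    have h2 := (Finset.sum_range_succ' (fun k => k * Nat.stirlingSecond n k * m.descFactorial k)
      (n + 1)).symm.trans (Finset.sum_range_succ
        (fun k => k * Nat.stirlingSecond n k * m.descFactorial k) (n + 1))
    rw [Nat.stirlingSecond_eq_zero_of_lt (Nat.lt_succ_self n)] at h2
    simp only [zero_mul, mul_zero, add_zero] at h2
    rw [Finset.sum_congr rfl fun k _ => h1 k, Finset.sum_add_distrib, ← h2,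
      ← Finset.sum_add_distrib]
    refine Finset.sum_congr rfl fun k _ => ?_
    rw [Nat.stirlingSecond_succ_succ, add_mul]

/-- Expand m^n in falling factorials with Stirling coefficients: each falling factorial is at most
m!, and the Stirling numbers sum to B_n. -/
theorem pow_le_factorial_mul_bellNumber (n m : ℕ) : m ^ n ≤ m.factorial * bellNumber n := by
  have hB : bellNumber n = ∑ k ∈ Finset.range (n + 1), Nat.stirlingSecond n k := by
    have h := bellNumber_eq n
    rw [markedBell_eq_sum_stirlingSecond, Polynomial.eval_finsetSum] at h
    simp only [Polynomial.eval_mul, Polynomial.eval_pow, Polynomial.eval_add, Polynomial.eval_one,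
      Polynomial.eval_X, Polynomial.eval_C, add_zero, one_pow, mul_one] at h
    exact_mod_cast h
  rw [← sum_stirlingSecond_mul_descFactorial, hB, Finset.mul_sum]
  refine Finset.sum_le_sum fun k _ => ?_
  rw [mul_comm]
  refine Nat.mul_le_mul_right _ ?_
  rcases le_or_gt k m with h | h
  · rw [← Nat.factorial_mul_descFactorial h]
    exact Nat.le_mul_of_pos_left _ (Nat.factorial_pos _)
  · rw [Nat.descFactorial_of_lt h]
    exact Nat.zero_le _

theorem factorial_le_pow_mul_exp (n : ℕ) :
    (n.factorial : ℝ) ≤ ((n : ℝ) + 1) ^ (n + 1) * Real.exp (-n) := by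
  induction n with
  | zero => simp
  | succ n ih =>
    have hpos : (0 : ℝ) < (n : ℝ) + 2 := by positivity
    have h1 : Real.exp 1 * ((n : ℝ) + 1) ^ (n + 2) ≤ ((n : ℝ) + 2) ^ (n + 2) := by
      have h2 : ((n : ℝ) + 1) / (n + 2) ≤ Real.exp (-(1 / ((n : ℝ) + 2))) := by
        have := Real.add_one_le_exp (-(1 / ((n : ℝ) + 2)))
        refine le_trans (le_of_eq ?_) this
        field_simp
        ring
      have h3 : (((n : ℝ) + 1) / (n + 2)) ^ (n + 2) ≤ Real.exp (-1) := by
        refine (pow_le_pow_left₀ (by positivity) h2 _).trans (le_of_eq ?_)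
        rw [← Real.exp_nat_mul]
        congr 1
        push_cast
        field_simp
      rw [div_pow, div_le_iff₀ (by positivity)] at h3
      calc Real.exp 1 * ((n : ℝ) + 1) ^ (n + 2)
          ≤ Real.exp 1 * (Real.exp (-1) * ((n : ℝ) + 2) ^ (n + 2)) := by gcongr
        _ = ((n : ℝ) + 2) ^ (n + 2) := by
          rw [← mul_assoc, ← Real.exp_add]; simp
    rw [Nat.factorial_succ]
    push_cast
    calc ((n : ℝ) + 1) * n.factorial
        ≤ ((n : ℝ) + 1) * (((n : ℝ) + 1) ^ (n + 1) * Real.exp (-n)) := by gcongr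
      _ = (Real.exp 1 * ((n : ℝ) + 1) ^ (n + 2)) * Real.exp (-(n + 1)) := by
          have : Real.exp (-(n : ℝ)) = Real.exp 1 * Real.exp (-(n + 1)) := by
            rw [← Real.exp_add]; congr 1; ring
          rw [this]; ring
      _ ≤ ((n : ℝ) + 2) ^ (n + 2) * Real.exp (-(n + 1)) := by gcongr
      _ = _ := by ring_nf

/-- The loss in the crude bound for the contour integral is a power of `exp (alpha n)`. -/
theorem factorial_mul_exp_le (n : ℕ) (ha : 1 ≤ alpha n) :
    n.factorial * Real.exp (Real.exp (alpha n))
      ≤ Real.exp 4 * Real.exp (alpha n) ^ 5 * (alpha n ^ n * bellNumber n) := by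
  have hN := (alpha_spec n).2
  set a := alpha n with ha'
  set c := Real.exp a with hc
  have hc2 : 2 ≤ c := by
    have := Real.add_one_le_exp a
    linarith
  have hac : a ≤ c := by
    have := Real.add_one_le_exp a
    linarith
  -- The quotient m^n/m! is largest near m log m = n, that is, near m = c.
  set m := ⌊c⌋₊ with hm
  have hmc : (m : ℝ) ≤ c := Nat.floor_le (by linarith)
  have hcm : c < m + 1 := Nat.lt_floor_add_one c
  have hm1 : c / 2 ≤ m := by linarith
  have hm0 : (0 : ℝ) < m := by linarith
  have h1 : c ^ n ≤ c ^ 2 * (m : ℝ) ^ n := by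
    have h2 : c / m ≤ Real.exp (1 / m) := by
      have h3 := Real.add_one_le_exp (1 / (m : ℝ))
      refine le_trans ?_ h3
      rw [div_add_one hm0.ne']
      gcongr
      linarith
    -- Since c ≤ 2m, n/m ≤ ac/m ≤ 2a, and exp(2a) = c².
    have h4 : (c / m) ^ n ≤ c ^ 2 := by
      refine (pow_le_pow_left₀ (by positivity) h2 n).trans ?_
      rw [← Real.exp_nat_mul, hc, ← Real.exp_nat_mul]
      refine Real.exp_le_exp.2 ?_
      rw [mul_one_div, div_le_iff₀ hm0]
      push_cast
      nlinarith
    rw [div_pow, div_le_iff₀ (by positivity)] at h4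
    exact h4
  have h2 : ((m : ℝ) + 1) ^ (m + 1) ≤ Real.exp (a * c + a + 2) := by
    have h3 : (m : ℝ) + 1 ≤ Real.exp (a + 1 / c) := by
      rw [Real.exp_add, ← hc]
      have := Real.add_one_le_exp (1 / c)
      calc (m : ℝ) + 1 ≤ c * (1 / c + 1) := by
            rw [mul_add, mul_one_div_cancel (by linarith)]; linarith
        _ ≤ _ := by gcongr
    refine (pow_le_pow_left₀ (by positivity) h3 _).trans ?_
    rw [← Real.exp_nat_mul]
    refine Real.exp_le_exp.2 ?_
    push_cast
    have h5 : ((m : ℝ) + 1) * (a + 1 / c) ≤ (c + 1) * (a + 1 / c) := by gcongr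
    have h6 : (c + 1) * (a + 1 / c) = a * c + a + 1 + 1 / c := by field_simp; ring
    have h7 : 1 / c ≤ 1 := by rw [div_le_one (by linarith)]; linarith
    linarith
  have h3 := factorial_le_pow_mul_exp n
  have h4 := factorial_le_pow_mul_exp m
  have h5 : ((n : ℝ) + 1) ^ (n + 1) = a ^ n * c ^ n * (a * c) := by rw [← hN]; ring
  have h6 : (n.factorial : ℝ) * Real.exp c * m.factorial
      ≤ Real.exp 4 * c ^ 5 * (a ^ n * (m : ℝ) ^ n) := by
    calc (n.factorial : ℝ) * Real.exp c * m.factorial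
        ≤ (a ^ n * (c ^ 2 * (m : ℝ) ^ n) * (a * c) * Real.exp (-n)) * Real.exp c
          * (Real.exp (a * c + a + 2) * Real.exp (-m)) := by
          rw [h5] at h3
          refine mul_le_mul (mul_le_mul_of_nonneg_right (h3.trans ?_) (by positivity))
            (h4.trans (mul_le_mul_of_nonneg_right h2 (by positivity))) (by positivity)
            (by positivity)
          gcongr
      _ = a ^ n * (m : ℝ) ^ n * c ^ 3 * a * Real.exp (-n + c + (a * c + a + 2) + -m) := by
          rw [Real.exp_add (-n + c + (a * c + a + 2)), Real.exp_add (-(n : ℝ) + c),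
            Real.exp_add (-(n : ℝ))]
          ring
      _ ≤ a ^ n * (m : ℝ) ^ n * c ^ 3 * c * Real.exp (a + 4) := by
          -- Here ac − n = 1 and c − m ≤ 1.
          have : -n + c + (a * c + a + 2) + -m ≤ a + 4 := by linarith
          have := Real.exp_le_exp.2 this
          gcongr
      _ = _ := by rw [Real.exp_add, ← hc]; ring
  have h7 : (m : ℝ) ^ n ≤ m.factorial * bellNumber n := by
    exact_mod_cast pow_le_factorial_mul_bellNumber n m
  have h8 : (0 : ℝ) < m.factorial := by exact_mod_cast m.factorial_pos
  refine le_of_mul_le_mul_right ?_ h8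
  refine h6.trans ?_
  calc Real.exp 4 * c ^ 5 * (a ^ n * (m : ℝ) ^ n)
      ≤ Real.exp 4 * c ^ 5 * (a ^ n * (m.factorial * bellNumber n)) := by
        have : 0 ≤ a := by linarith
        gcongr
    _ = _ := by ring

end BellLowerBound

/-! ### Crude bounds for contour integrals over the saddle circle. -/

section ContourBound

theorem re_eq_of_mem_sphere {a : ℝ} (ha : 0 < a) {z : ℂ} (hz : ‖z‖ = a) :
    z.re = a - ‖z - a‖ ^ 2 / (2 * a) := by
  have h1 : ‖z - a‖ ^ 2 = 2 * a ^ 2 - 2 * a * z.re := by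
    have h2 : ‖z‖ ^ 2 = a ^ 2 := by rw [hz]
    rw [← Complex.normSq_eq_norm_sq, Complex.normSq_apply] at h2 ⊢
    simp only [Complex.sub_re, Complex.sub_im, Complex.ofReal_re, Complex.ofReal_im]
    linarith
  rw [h1]
  field_simp
  ring

/-- On the circle Re z = a − x with x = ‖z − a‖²/(2a), so Re e^z ≤ e^a e^{−x}. The Gaussian decay
obtained holds on the whole circle, and no splitting into arcs is needed. -/
theorem exp_re_exp_le {a : ℝ} (ha : 1 ≤ a) {z : ℂ} (hz : ‖z‖ = a) :
    Real.exp (Complex.exp z).re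
      ≤ Real.exp (Real.exp a) * Real.exp (-(Real.exp a * ‖z - a‖ ^ 2 / (6 * a ^ 2))) := by
  rw [← Real.exp_add]
  refine Real.exp_le_exp.2 ?_
  have ha0 : 0 < a := by linarith
  have h1 : (Complex.exp z).re ≤ Real.exp z.re :=
    (Complex.re_le_norm _).trans (le_of_eq (Complex.norm_exp z))
  have h2 : ‖z - a‖ ≤ 2 * a := by
    refine (norm_sub_le _ _).trans ?_
    rw [hz, Complex.norm_real, Real.norm_of_nonneg ha0.le]
    linarith
  set x := ‖z - a‖ ^ 2 / (2 * a) with hx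
  have hx0 : 0 ≤ x := by positivity
  have hx2 : x ≤ 2 * a := by
    rw [hx, div_le_iff₀ (by positivity)]
    nlinarith [norm_nonneg (z - a)]
  have h3 : Real.exp (-x) ≤ 1 - x / (3 * a) := by
    have h4 : Real.exp (-x) * (1 + x) ≤ 1 := by
      have := Real.add_one_le_exp x
      calc Real.exp (-x) * (1 + x) ≤ Real.exp (-x) * Real.exp x := by
            gcongr; linarith
        _ = 1 := by rw [← Real.exp_add]; simp
    have h5 : Real.exp (-x) ≤ 1 / (1 + x) := by rw [le_div_iff₀ (by positivity)]; exact h4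
    refine h5.trans ?_
    have h6 : 1 / (1 + x) = 1 - x / (1 + x) := by field_simp; ring
    rw [h6]
    -- 1 + x ≤ 3a because x ≤ 2a and a ≥ 1.
    have : x / (3 * a) ≤ x / (1 + x) := by gcongr; linarith
    linarith
  rw [re_eq_of_mem_sphere ha0 hz, ← hx, sub_eq_add_neg, Real.exp_add] at h1
  refine h1.trans ?_
  have h7 : Real.exp a * ‖z - a‖ ^ 2 / (6 * a ^ 2) = Real.exp a * (x / (3 * a)) := by
    rw [hx]; field_simp; ring
  rw [h7]
  nlinarith [Real.exp_pos a]

theorem pow_mul_exp_neg_sq_le (k : ℕ) (t : ℝ) :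
    t ^ k * Real.exp (-(t ^ 2 / 6)) ≤ 1 + 6 ^ k * k.factorial := by
  have h1 : t ^ k ≤ 1 + (t ^ 2) ^ k := by
    rw [← pow_mul, mul_comm, pow_mul]
    nlinarith [sq_nonneg (t ^ k - 1)]
  have h2 : (t ^ 2) ^ k * Real.exp (-(t ^ 2 / 6)) ≤ 6 ^ k * k.factorial := by
    have h3 := Real.pow_div_factorial_le_exp (x := t ^ 2 / 6) (by positivity) k
    rw [div_pow, div_div, div_le_iff₀ (by positivity)] at h3
    calc (t ^ 2) ^ k * Real.exp (-(t ^ 2 / 6))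
        ≤ (Real.exp (t ^ 2 / 6) * (6 ^ k * k.factorial)) * Real.exp (-(t ^ 2 / 6)) := by gcongr
      _ = 6 ^ k * k.factorial := by
          rw [mul_right_comm, ← Real.exp_add]; simp
  have h4 : Real.exp (-(t ^ 2 / 6)) ≤ 1 := Real.exp_le_one_iff.2 (by
    have : 0 ≤ t ^ 2 / 6 := by positivity
    linarith)
  calc t ^ k * Real.exp (-(t ^ 2 / 6)) ≤ (1 + (t ^ 2) ^ k) * Real.exp (-(t ^ 2 / 6)) := by gcongr
    _ = Real.exp (-(t ^ 2 / 6)) + (t ^ 2) ^ k * Real.exp (-(t ^ 2 / 6)) := by ring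
    _ ≤ _ := add_le_add h4 h2

theorem norm_contourMean_le {n : ℕ} {a S : ℝ} (ha : 0 < a) {F : ℂ → ℂ}
    (hF : ∀ z, ‖z‖ = a → ‖F z‖ * Real.exp (Complex.exp z).re ≤ S) :
    ‖contourMean n a F‖ ≤ n.factorial * S / (a ^ n * bellNumber n) := by
  have h1 : ‖∮ z in C(0, a), F z * bellKernel n z‖ ≤ 2 * Real.pi * a * (S / a ^ (n + 1)) := by
    refine circleIntegral.norm_integral_le_of_norm_le_const ha.le fun z hz => ?_
    have hz' : ‖z‖ = a := by simpa using hz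
    rw [bellKernel, norm_mul, norm_div, norm_pow, hz', Complex.norm_exp, ← mul_div_assoc]
    gcongr
    exact hF z hz'
  have hB : (0 : ℝ) < bellNumber n := by exact_mod_cast bellNumber_pos n
  have hf : (0 : ℝ) < n.factorial := by exact_mod_cast n.factorial_pos
  have hS : 0 ≤ S := le_trans (by positivity) (hF a (by simp [abs_of_pos ha]))
  have h2 : ‖(2 * Real.pi * Complex.I / n.factorial * (Complex.exp 1 * bellNumber n) : ℂ)‖
      = 2 * Real.pi / n.factorial * (Real.exp 1 * bellNumber n) := by
    simp [Complex.norm_exp, abs_of_pos Real.pi_pos]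
  rw [contourMean, norm_div, h2]
  have h3 : 2 * Real.pi / n.factorial * bellNumber n
      ≤ 2 * Real.pi / n.factorial * (Real.exp 1 * bellNumber n) := by
    have : (1 : ℝ) ≤ Real.exp 1 := Real.one_le_exp (by norm_num)
    have hp := Real.pi_pos
    gcongr
    nlinarith
  refine (div_le_div₀ (by positivity) h1 (by have := Real.pi_pos; positivity) h3).trans
    (le_of_eq ?_)
  have hp := Real.pi_pos
  rw [pow_succ]
  field_simp

/-- Each order of vanishing at the saddle point gains a factor α/√c by the Gaussian decay; the tenth
power of √c is the loss c⁵ of `factorial_mul_exp_le`. -/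
theorem norm_contourMean_le_of_norm_le_pow (k : ℕ) {n : ℕ} (ha : 1 ≤ alpha n) {M : ℝ} (hM : 0 ≤ M)
    {F : ℂ → ℂ} (hF : ∀ z, ‖z‖ = alpha n → ‖F z‖ ≤ M * ‖z - alpha n‖ ^ k) :
    ‖contourMean n (alpha n) F‖ ≤ Real.exp 4 * (1 + 6 ^ k * k.factorial) * M
      * Real.exp (alpha n / 2) ^ 10 * (alpha n / Real.exp (alpha n / 2)) ^ k := by
  have hfac := factorial_mul_exp_le n ha
  set a := alpha n
  set g := Real.exp (a / 2) with hg
  have hg0 : 0 < g := Real.exp_pos _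
  have hgc : Real.exp a = g ^ 2 := by rw [hg, ← Real.exp_nat_mul]; congr 1; push_cast; ring
  have ha0 : 0 < a := by linarith
  set K : ℝ := 1 + 6 ^ k * k.factorial with hK
  have hK0 : 0 ≤ K := by positivity
  have h1 : ∀ z : ℂ, ‖z‖ = a → ‖F z‖ * Real.exp (Complex.exp z).re
      ≤ M * (K * (a / g) ^ k) * Real.exp (Real.exp a) := by
    intro z hz
    have h2 := pow_mul_exp_neg_sq_le k (g * ‖z - a‖ / a)
    have h3 : Real.exp a * ‖z - a‖ ^ 2 / (6 * a ^ 2) = (g * ‖z - a‖ / a) ^ 2 / 6 := by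
      rw [hgc]; field_simp
    have h4 := exp_re_exp_le ha hz
    rw [h3] at h4
    have h5 : ‖z - a‖ ^ k = (g * ‖z - a‖ / a) ^ k * (a / g) ^ k := by
      rw [← mul_pow]; congr 1; field_simp
    calc ‖F z‖ * Real.exp (Complex.exp z).re
        ≤ (M * ‖z - a‖ ^ k) * (Real.exp (Real.exp a)
          * Real.exp (-((g * ‖z - a‖ / a) ^ 2 / 6))) := by
          gcongr
          exact hF z hz
      _ = M * (((g * ‖z - a‖ / a) ^ k * Real.exp (-((g * ‖z - a‖ / a) ^ 2 / 6)))
          * (a / g) ^ k) * Real.exp (Real.exp a) := by rw [h5]; ring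
      _ ≤ _ := by gcongr
  refine (norm_contourMean_le ha0 h1).trans ?_
  have hB : (0 : ℝ) < bellNumber n := by exact_mod_cast bellNumber_pos n
  rw [div_le_iff₀ (by positivity)]
  calc n.factorial * (M * (K * (a / g) ^ k) * Real.exp (Real.exp a))
      = (M * (K * (a / g) ^ k)) * (n.factorial * Real.exp (Real.exp a)) := by ring
    _ ≤ (M * (K * (a / g) ^ k)) * (Real.exp 4 * Real.exp a ^ 5 * (a ^ n * bellNumber n)) := by
        gcongr
    _ = _ := by rw [hgc]; ring

end ContourBound

/-! ### Expansion of 1 − a/z in powers of exp(z − a) − 1. -/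

section SaddleExpansion

open Polynomial

/-- The Taylor polynomial of `log (1 + X)` of degree `K`. -/
noncomputable def logPoly (K : ℕ) : ℝ[X] :=
  ∑ j ∈ Finset.range (K + 1), C ((-1) ^ (j + 1) / (j : ℝ)) * X ^ j

theorem aeval_logPoly (K : ℕ) (s : ℂ) : aeval s (logPoly K) = Complex.logTaylor (K + 1) s := by
  rw [logPoly, map_sum, Complex.logTaylor]
  refine Finset.sum_congr rfl fun j _ => ?_
  simp
  ring

theorem norm_exp_sub_one_le_two {ζ : ℂ} (h : ζ.re ≤ 0) : ‖Complex.exp ζ - 1‖ ≤ 2 := by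
  refine (norm_sub_le _ _).trans ?_
  rw [Complex.norm_exp, norm_one]
  have := Real.exp_le_one_iff.2 h
  linarith

theorem exists_norm_aeval_le (p : ℝ[X]) : ∃ L : ℝ, 0 ≤ L ∧ ∀ s : ℂ, ‖s‖ ≤ 2 → ‖aeval s p‖ ≤ L := by
  obtain ⟨L, hL⟩ := (isCompact_closedBall (0 : ℂ) 2).exists_bound_of_continuousOn
    (Polynomial.continuous_aeval (R := ℝ) (A := ℂ) p).continuousOn
  refine ⟨max L 0, le_max_right _ _, fun s hs => (hL s ?_).trans (le_max_left _ _)⟩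
  simpa using hs

/-- For ‖ζ‖ ≤ 1/4 this is Taylor's formula for ζ = log(1 + s), s = e^ζ − 1. For larger ζ both terms
are estimated separately, using 1 ≤ 4‖ζ‖ and, as Re ζ ≤ 0, ‖s‖ ≤ 2. -/
theorem exists_norm_pow_sub_logPoly_pow_le (K i : ℕ) (hi : i ≤ K + 1) :
    ∃ M : ℝ, 0 ≤ M ∧ ∀ ζ : ℂ, ζ.re ≤ 0 →
      ‖ζ ^ i - aeval (Complex.exp ζ - 1) (logPoly K) ^ i‖ ≤ M * ‖ζ‖ ^ (K + 1) := by
  obtain ⟨L, hL0, hL⟩ := exists_norm_aeval_le (logPoly K)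
  have hsmall : ∃ M : ℝ, 0 ≤ M ∧ ∀ ζ : ℂ, ζ.re ≤ 0 → ‖ζ‖ ≤ 1 / 4 →
      ‖ζ ^ i - aeval (Complex.exp ζ - 1) (logPoly K) ^ i‖ ≤ M * ‖ζ‖ ^ (K + 1) := by
    clear hi
    induction i with
    | zero => exact ⟨0, le_rfl, fun ζ _ _ => by simp⟩
    | succ i ih =>
      obtain ⟨M, hM0, hM⟩ := ih
      refine ⟨M + 2 * 2 ^ (K + 1) * L ^ i, by positivity, fun ζ h0 h1 => ?_⟩
      have h2 : ‖Complex.exp ζ - 1‖ ≤ 2 * ‖ζ‖ := Complex.norm_exp_sub_one_le (by linarith)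
      have h3 : ‖ζ - aeval (Complex.exp ζ - 1) (logPoly K)‖ ≤ 2 * 2 ^ (K + 1) * ‖ζ‖ ^ (K + 1) := by
        have h4 := Complex.norm_log_sub_logTaylor_le K (z := Complex.exp ζ - 1) (by linarith)
        have him : |ζ.im| ≤ 1 / 4 := (Complex.abs_im_le_norm ζ).trans h1
        have hpi := Real.pi_gt_three
        rw [abs_le] at him
        rw [add_sub_cancel, Complex.log_exp (by linarith) (by linarith), ← aeval_logPoly] at h4
        refine h4.trans ?_
        have h5 : (1 - ‖Complex.exp ζ - 1‖)⁻¹ ≤ 2 := by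
          rw [inv_le_comm₀ (by linarith) (by norm_num)]
          linarith
        have h7 : ‖Complex.exp ζ - 1‖ ^ (K + 1) ≤ (2 * ‖ζ‖) ^ (K + 1) :=
          pow_le_pow_left₀ (norm_nonneg _) h2 _
        have h6 : ‖Complex.exp ζ - 1‖ ^ (K + 1) * (1 - ‖Complex.exp ζ - 1‖)⁻¹
            ≤ (2 * ‖ζ‖) ^ (K + 1) * 2 :=
          mul_le_mul h7 h5 (inv_nonneg.2 (by linarith)) (by positivity)
        refine (div_le_self ?_ ?_).trans (h6.trans (le_of_eq (by rw [mul_pow]; ring)))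
        · exact mul_nonneg (by positivity) (inv_nonneg.2 (by linarith))
        · have : (0 : ℝ) ≤ K := Nat.cast_nonneg K
          linarith
      have h4 := hL (Complex.exp ζ - 1) (by linarith)
      set y := aeval (Complex.exp ζ - 1) (logPoly K)
      have h5 : ζ ^ (i + 1) - y ^ (i + 1) = ζ * (ζ ^ i - y ^ i) + (ζ - y) * y ^ i := by ring
      rw [h5]
      refine (norm_add_le _ _).trans ?_
      rw [norm_mul, norm_mul, norm_pow]
      have h6 : ‖ζ‖ * ‖ζ ^ i - y ^ i‖ ≤ 1 * (M * ‖ζ‖ ^ (K + 1)) :=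
        mul_le_mul (by linarith) (hM ζ h0 h1) (norm_nonneg _) zero_le_one
      have h7 : ‖ζ - y‖ * ‖y‖ ^ i ≤ (2 * 2 ^ (K + 1) * ‖ζ‖ ^ (K + 1)) * L ^ i :=
        mul_le_mul h3 (pow_le_pow_left₀ (norm_nonneg _) h4 _) (by positivity) (by positivity)
      linarith
  obtain ⟨M, hM0, hM⟩ := hsmall
  refine ⟨M + (1 + L ^ i) * 4 ^ (K + 1), by positivity, fun ζ h0 => ?_⟩
  rcases le_or_gt ‖ζ‖ (1 / 4) with h1 | h1
  · refine (hM ζ h0 h1).trans ?_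
    gcongr
    have : 0 ≤ (1 + L ^ i) * 4 ^ (K + 1) := by positivity
    linarith
  · refine (norm_sub_le _ _).trans ?_
    rw [norm_pow, norm_pow]
    have h2 : 1 ≤ 4 * ‖ζ‖ := by linarith
    have h3 : ‖ζ‖ ^ i ≤ (4 * ‖ζ‖) ^ (K + 1) := by
      calc ‖ζ‖ ^ i ≤ (4 * ‖ζ‖) ^ i := by
            gcongr; linarith
        _ ≤ _ := pow_le_pow_right₀ h2 hi
    have h4 : ‖aeval (Complex.exp ζ - 1) (logPoly K)‖ ^ i ≤ L ^ i * (4 * ‖ζ‖) ^ (K + 1) := by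
      calc _ ≤ L ^ i * 1 := by
            rw [mul_one]
            exact pow_le_pow_left₀ (norm_nonneg _) (hL _ (norm_exp_sub_one_le_two h0)) _
        _ ≤ _ := by
            gcongr
            exact one_le_pow₀ h2
    have h5 : 0 ≤ M * ‖ζ‖ ^ (K + 1) := by positivity
    calc ‖ζ‖ ^ i + ‖aeval (Complex.exp ζ - 1) (logPoly K)‖ ^ i
        ≤ (1 + L ^ i) * (4 * ‖ζ‖) ^ (K + 1) := by linarith
      _ = (1 + L ^ i) * 4 ^ (K + 1) * ‖ζ‖ ^ (K + 1) := by rw [mul_pow]; ring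
      _ ≤ _ := by
          rw [add_mul]
          linarith

/-- The polynomial in `s = exp (z - a) - 1` which approximates `1 - a / z` near `z = a`,
where `b = 1 / a`. -/
noncomputable def saddlePoly (K : ℕ) (b : ℝ) : ℝ[X] :=
  ∑ i ∈ Finset.range K, C ((-1) ^ i * b ^ (i + 1)) * logPoly K ^ (i + 1)

/-- With u = (z − a)/a one has 1 − a/z = u/(1 + u), a finite geometric sum plus (−u)^K (1 − a/z);
then z − a is replaced by the Taylor polynomial of log(1 + s). The constant does not depend on a. -/
theorem exists_norm_sub_saddlePoly_le (K : ℕ) : ∃ M : ℝ, 0 ≤ M ∧ ∀ a : ℝ, 1 ≤ a → ∀ z : ℂ,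
    ‖z‖ = a → ‖1 - a * z⁻¹ - aeval (Complex.exp (z - a) - 1) (saddlePoly K a⁻¹)‖
      ≤ M * ‖z - a‖ ^ (K + 1) := by
  choose! M hM0 hM using exists_norm_pow_sub_logPoly_pow_le K
  refine ⟨1 + ∑ i ∈ Finset.range K, M (i + 1), ?_, fun a ha z hz => ?_⟩
  · refine add_nonneg zero_le_one (Finset.sum_nonneg fun i hi => hM0 _ ?_)
    rw [Finset.mem_range] at hi
    omega
  have ha0 : 0 < a := by linarith
  have hac : (a : ℂ) ≠ 0 := Complex.ofReal_ne_zero.2 ha0.ne'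
  have hz0 : z ≠ 0 := by
    rintro rfl
    rw [norm_zero] at hz
    exact ha0.ne hz
  have hre : (z - a).re ≤ 0 := by
    rw [Complex.sub_re, Complex.ofReal_re, ← hz]
    have := Complex.re_le_norm z
    linarith
  set v : ℂ := 1 - a * z⁻¹ with hv
  set u : ℂ := (a : ℂ)⁻¹ * (z - a) with hu
  have huv : v = u - u * v := by
    rw [hv, hu]
    field_simp
    ring
  have hgeom : ∀ k : ℕ, v = ∑ i ∈ Finset.range k, (-1) ^ i * u ^ (i + 1) + (-u) ^ k * v := by
    intro k
    induction k with
    | zero => simp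
    | succ k ih =>
      rw [Finset.sum_range_succ]
      have h1 : (-u) ^ (k + 1) = (-u) ^ k * (-u) := pow_succ _ _
      have h2 : (-u) ^ k = (-1) ^ k * u ^ k := by rw [← mul_pow]; congr 1; ring
      calc v = ∑ i ∈ Finset.range k, (-1) ^ i * u ^ (i + 1) + (-u) ^ k * v := ih
        _ = ∑ i ∈ Finset.range k, (-1) ^ i * u ^ (i + 1) + (-u) ^ k * (u - u * v) := by
            rw [← huv]
        _ = _ := by rw [h1, h2]; ring
  have hinv : a⁻¹ ≤ 1 := inv_le_one_of_one_le₀ ha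
  have hinv0 : 0 ≤ a⁻¹ := by positivity
  have hun : ‖u‖ ≤ ‖z - a‖ := by
    rw [hu, norm_mul, norm_inv, Complex.norm_real, Real.norm_of_nonneg ha0.le]
    exact mul_le_of_le_one_left (norm_nonneg _) hinv
  have hvn : ‖v‖ ≤ ‖z - a‖ := by
    have : v = (z - a) * z⁻¹ := by rw [hv]; field_simp
    rw [this, norm_mul, norm_inv, hz]
    exact mul_le_of_le_one_right (norm_nonneg _) hinv
  have hsum : v - aeval (Complex.exp (z - a) - 1) (saddlePoly K a⁻¹)
      = ∑ i ∈ Finset.range K, (-1) ^ i * (a : ℂ)⁻¹ ^ (i + 1) * ((z - a) ^ (i + 1)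
        - aeval (Complex.exp (z - a) - 1) (logPoly K) ^ (i + 1)) + (-u) ^ K * v := by
    conv_lhs => rw [hgeom K]
    rw [saddlePoly, map_sum, add_sub_right_comm, ← Finset.sum_sub_distrib]
    congr 1
    refine Finset.sum_congr rfl fun i _ => ?_
    rw [hu, mul_pow]
    simp
    ring
  rw [hsum]
  refine (norm_add_le _ _).trans ?_
  have h1 : ‖(-u) ^ K * v‖ ≤ ‖z - a‖ ^ (K + 1) := by
    rw [norm_mul, norm_pow, norm_neg, pow_succ]
    exact mul_le_mul (pow_le_pow_left₀ (norm_nonneg _) hun _) hvn (norm_nonneg _) (by positivity)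
  have h2 : ‖∑ i ∈ Finset.range K, (-1) ^ i * (a : ℂ)⁻¹ ^ (i + 1) * ((z - a) ^ (i + 1)
      - aeval (Complex.exp (z - a) - 1) (logPoly K) ^ (i + 1))‖
      ≤ (∑ i ∈ Finset.range K, M (i + 1)) * ‖z - a‖ ^ (K + 1) := by
    rw [Finset.sum_mul]
    refine norm_sum_le_of_le _ fun i hi => ?_
    rw [Finset.mem_range] at hi
    rw [norm_mul, norm_mul, norm_pow, norm_neg, norm_one, one_pow, one_mul, norm_pow, norm_inv,
      Complex.norm_real, Real.norm_of_nonneg ha0.le]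
    have h3 := hM (i + 1) (by omega) (z - a) hre
    calc a⁻¹ ^ (i + 1) * _ ≤ 1 * _ := by
          gcongr
          exact pow_le_one₀ hinv0 hinv
      _ ≤ _ := by rw [one_mul]; exact h3
  rw [add_mul, one_mul]
  linarith

theorem exists_logPoly_eq (K : ℕ) : ∃ g : ℝ[X], logPoly (K + 2) = X * (1 + X * g)
    ∧ g.coeff 0 = -1 / 2 := by
  refine ⟨∑ j ∈ Finset.range (K + 1), C ((-1) ^ (j + 3) / ((j + 2 : ℕ) : ℝ)) * X ^ j, ?_, ?_⟩
  · have h : ∀ j : ℕ, C ((-1) ^ (j + 1 + 1 + 1) / ((j + 1 + 1 : ℕ) : ℝ)) * X ^ (j + 1 + 1)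
        = X * (X * (C ((-1) ^ (j + 3) / ((j + 2 : ℕ) : ℝ)) * X ^ j)) := by
      intro j
      generalize C ((-1) ^ (j + 3) / ((j + 2 : ℕ) : ℝ)) = r
      ring
    have h1 : C ((-1) ^ (0 + 1 + 1) / ((0 + 1 : ℕ) : ℝ)) * X ^ (0 + 1) = (X : ℝ[X]) := by simp
    -- The term j = 0 of `logPoly` vanishes because division by zero gives 0.
    have h0 : C ((-1) ^ (0 + 1) / ((0 : ℕ) : ℝ)) * X ^ 0 = (0 : ℝ[X]) := by simp
    rw [logPoly, Finset.sum_range_succ', Finset.sum_range_succ', h1, h0, Finset.sum_congr rfl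
      fun j _ => h j, ← Finset.mul_sum, ← Finset.mul_sum]
    ring
  · rw [finsetSum_coeff, Finset.sum_range_succ']
    simp [coeff_X_pow]
    norm_num

theorem coeff_saddlePoly (K : ℕ) (b : ℝ) (j : ℕ) : (saddlePoly K b).coeff j
    = ∑ i ∈ Finset.range K, (-1) ^ i * b ^ (i + 1) * (logPoly K ^ (i + 1)).coeff j := by
  rw [saddlePoly, finsetSum_coeff]
  simp only [coeff_C_mul]

theorem exists_abs_coeff_saddlePoly_le (K j : ℕ) : ∃ M : ℝ, ∀ b : ℝ, 0 ≤ b → b ≤ 1 →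
    |(saddlePoly K b).coeff j| ≤ M * b := by
  refine ⟨∑ i ∈ Finset.range K, |(logPoly K ^ (i + 1)).coeff j|, fun b hb0 hb1 => ?_⟩
  rw [coeff_saddlePoly, Finset.sum_mul]
  refine (Finset.abs_sum_le_sum_abs _ _).trans (Finset.sum_le_sum fun i _ => ?_)
  rw [abs_mul, abs_mul, abs_pow, abs_neg, abs_one, one_pow, one_mul, abs_of_nonneg (by positivity),
    mul_comm]
  gcongr
  rw [pow_succ]
  exact mul_le_of_le_one_left hb0 (pow_le_one₀ hb0 hb1)

/-- Modulo s³ only b log(1 + s) − b² log²(1 + s) matters, with log(1 + s) = s − s²/2 + …. -/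
theorem coeff_saddlePoly_small (K : ℕ) (b : ℝ) : (saddlePoly (K + 2) b).coeff 0 = 0
    ∧ (saddlePoly (K + 2) b).coeff 1 = b ∧ (saddlePoly (K + 2) b).coeff 2 = -b / 2 - b ^ 2 := by
  obtain ⟨g, hg, hg0⟩ := exists_logPoly_eq K
  have h : ∃ q : ℝ[X], saddlePoly (K + 2) b
      = C b * (X * (1 + X * g)) - C (b ^ 2) * (X ^ 2 * (1 + X * g) ^ 2) + X ^ 3 * q := by
    refine ⟨∑ i ∈ Finset.range K, C ((-1) ^ (i + 2) * b ^ (i + 3))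
      * (X ^ i * (1 + X * g) ^ (i + 3)), ?_⟩
    rw [saddlePoly, Finset.sum_range_succ', Finset.sum_range_succ', Finset.mul_sum, hg]
    have : ∀ i : ℕ, C ((-1) ^ (i + 1 + 1) * b ^ (i + 1 + 1 + 1)) * (X * (1 + X * g)) ^ (i + 1 + 1 + 1)
        = X ^ 3 * (C ((-1) ^ (i + 2) * b ^ (i + 3)) * (X ^ i * (1 + X * g) ^ (i + 3))) := by
      intro i
      rw [mul_pow]
      ring
    simp only [this]
    simp
    ring
  obtain ⟨q, hq⟩ := h
  have h2 : C b * (X * (1 + X * g)) - C (b ^ 2) * (X ^ 2 * (1 + X * g) ^ 2) + X ^ 3 * q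
      = C b * X + X ^ 2 * (C b * g - C (b ^ 2) * (1 + X * g) ^ 2 + X * q) := by ring
  rw [hq, h2]
  have h3 : ∀ p : ℝ[X], (X ^ 2 * p).coeff 0 = 0 ∧ (X ^ 2 * p).coeff 1 = 0
      ∧ (X ^ 2 * p).coeff 2 = p.coeff 0 := by
    intro p
    simp only [coeff_X_pow_mul']
    norm_num
  obtain ⟨h4, h5, h6⟩ := h3 (C b * g - C (b ^ 2) * (1 + X * g) ^ 2 + X * q)
  simp only [coeff_add, h4, h5, h6, coeff_C_mul, coeff_X]
  refine ⟨by simp, by simp, ?_⟩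
  rw [coeff_zero_eq_eval_zero] at hg0
  rw [coeff_zero_eq_eval_zero, coeff_zero_eq_eval_zero]
  simp only [eval_sub, eval_add, eval_mul, eval_pow, eval_C, eval_X, eval_one, hg0]
  norm_num
  ring

theorem natDegree_saddlePoly_lt (K : ℕ) (b : ℝ) : (saddlePoly K b).natDegree < K * K + 1 := by
  have h1 : (logPoly K).natDegree ≤ K := by
    refine natDegree_sum_le_of_forall_le _ _ fun j hj => ?_
    refine (natDegree_C_mul_X_pow_le _ _).trans ?_
    rw [Finset.mem_range] at hj
    omega
  refine Nat.lt_succ_of_le (natDegree_sum_le_of_forall_le _ _ fun i hi => ?_)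
  rw [Finset.mem_range] at hi
  refine (natDegree_C_mul_le _ _).trans (natDegree_pow_le.trans ?_)
  exact Nat.mul_le_mul hi h1

end SaddleExpansion

/-! ### Orders of magnitude in powers of √c, and their propagation in double arrays. -/

section Order

theorem tendsto_alpha : Tendsto alpha atTop atTop := by
  refine tendsto_atTop.2 fun b => ?_
  filter_upwards [(tendsto_natCast_atTop_atTop (R := ℝ)).eventually_gt_atTop (|b| * Real.exp |b|)]
    with n hn
  by_contra h
  push Not at h
  obtain ⟨h0, h1⟩ := alpha_spec n
  have h2 : alpha n ≤ |b| := h.le.trans (le_abs_self b)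
  have h3 : alpha n * Real.exp (alpha n) ≤ |b| * Real.exp |b| :=
    mul_le_mul h2 (Real.exp_le_exp.2 h2) (Real.exp_pos _).le (abs_nonneg b)
  linarith

/-- The square root of the saddle point value `exp (alpha n)`. -/
noncomputable def sqrtScale (n : ℕ) : ℝ := Real.exp (alpha n / 2)

theorem sqrtScale_pos (n : ℕ) : 0 < sqrtScale n := Real.exp_pos _

theorem sqrtScale_ne_zero (n : ℕ) : sqrtScale n ≠ 0 := (sqrtScale_pos n).ne'

theorem sqrtScale_sq (n : ℕ) : sqrtScale n ^ 2 = Real.exp (alpha n) := by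
  rw [sqrtScale, ← Real.exp_nat_mul]
  congr 1
  push_cast
  ring

theorem one_le_sqrtScale (n : ℕ) : 1 ≤ sqrtScale n :=
  Real.one_le_exp (by have := (alpha_spec n).1; linarith)

/-- The sequence `f` is `O(exp (alpha n) ^ (e / 2))`. -/
def HasOrder {E : Type*} [NormedAddCommGroup E] (f : ℕ → E) (e : ℤ) : Prop :=
  f =O[atTop] fun n => sqrtScale n ^ e

namespace HasOrder

variable {E : Type*} [NormedAddCommGroup E] {f g : ℕ → E} {e e' : ℤ}

theorem mono (h : HasOrder f e) (he : e ≤ e') : HasOrder f e' := by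
  refine h.trans (IsBigO.of_norm_le fun n => ?_)
  rw [norm_zpow, Real.norm_of_nonneg (sqrtScale_pos n).le]
  exact zpow_le_zpow_right₀ (one_le_sqrtScale n) he

theorem add (hf : HasOrder f e) (hg : HasOrder g e) : HasOrder (fun n => f n + g n) e :=
  IsBigO.add hf hg

theorem sub (hf : HasOrder f e) (hg : HasOrder g e) : HasOrder (fun n => f n - g n) e :=
  IsBigO.sub hf hg

theorem neg (hf : HasOrder f e) : HasOrder (fun n => -f n) e := IsBigO.neg_left hf

theorem sum {ι : Type*} {s : Finset ι} {F : ι → ℕ → E} (h : ∀ i ∈ s, HasOrder (F i) e) :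
    HasOrder (fun n => ∑ i ∈ s, F i n) e := IsBigO.fun_sum h

theorem congr' (h : HasOrder f e) (hfg : ∀ᶠ n in atTop, f n = g n) : HasOrder g e :=
  IsBigO.congr' h hfg EventuallyEq.rfl

theorem congr (h : HasOrder f e) (hfg : ∀ n, f n = g n) : HasOrder g e :=
  h.congr' (Eventually.of_forall hfg)

theorem smul [NormedSpace ℝ E] {r : ℕ → ℝ} (hr : HasOrder r e) (hf : HasOrder f e') :
    HasOrder (fun n => r n • f n) (e + e') := by
  refine (IsBigO.smul hr hf).congr_right fun n => ?_
  rw [smul_eq_mul, zpow_add₀ (sqrtScale_ne_zero n)]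

theorem mul {f g : ℕ → ℝ} (hf : HasOrder f e) (hg : HasOrder g e') :
    HasOrder (fun n => f n * g n) (e + e') := hf.smul hg

theorem const_smul [NormedSpace ℝ E] (hf : HasOrder f e) (r : ℝ) :
    HasOrder (fun n => r • f n) e := IsBigO.const_smul_left hf r

theorem const_mul {f : ℕ → ℝ} (hf : HasOrder f e) (r : ℝ) :
    HasOrder (fun n => r * f n) e := hf.const_smul r

end HasOrder

theorem hasOrder_const (r : ℝ) : HasOrder (fun _ => r) 0 := by
  unfold HasOrder
  simp only [zpow_zero]
  exact isBigO_const_const r one_ne_zero _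

theorem hasOrder_ofReal {f : ℕ → ℝ} {e : ℤ} :
    HasOrder (fun n => (f n : ℂ)) e ↔ HasOrder f e := by
  unfold HasOrder
  rw [← isBigO_norm_left, ← isBigO_norm_left (f' := f)]
  simp only [Complex.norm_real]

theorem hasOrder_exp_alpha_zpow (k : ℤ) : HasOrder (fun n => Real.exp (alpha n) ^ k) (2 * k) := by
  unfold HasOrder
  refine (isBigO_refl _ _).congr_left fun n => ?_
  rw [← sqrtScale_sq, ← zpow_natCast, ← zpow_mul]
  rfl

theorem hasOrder_exp_alpha : HasOrder (fun n => Real.exp (alpha n)) 2 := by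
  simpa using hasOrder_exp_alpha_zpow 1

theorem hasOrder_inv_alpha : HasOrder (fun n => (alpha n)⁻¹) 0 := by
  unfold HasOrder
  simp only [zpow_zero]
  exact (tendsto_inv_atTop_zero.comp tendsto_alpha).isBigO_one ℝ

theorem hasOrder_inv_one_add_inv_alpha : HasOrder (fun n => (1 + (alpha n)⁻¹)⁻¹) 0 := by
  unfold HasOrder
  simp only [zpow_zero]
  refine IsBigO.of_norm_le fun n => ?_
  have h : 0 < (alpha n)⁻¹ := inv_pos.2 (alpha_spec n).1
  rw [Real.norm_of_nonneg (by positivity)]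
  exact inv_le_one_of_one_le₀ (by linarith)

/-- Any power of α is absorbed at the price of a single factor √c. -/
theorem hasOrder_alpha_pow (k : ℕ) : HasOrder (fun n => alpha n ^ k) 1 := by
  have h := (Real.isLittleO_pow_exp_atTop (n := k)).isBigO.comp_tendsto
    (tendsto_alpha.atTop_mul_const (by norm_num : (0 : ℝ) < 1 / 2))
  unfold HasOrder
  have h2 := h.const_mul_left ((2 : ℝ) ^ k)
  refine (h2.congr_left fun n => ?_).congr_right fun n => ?_
  · simp only [Function.comp]
    rw [← mul_pow]
    congr 1
    ring
  · simp only [Function.comp]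
    rw [zpow_one, sqrtScale]
    congr 1
    ring

/-- The relation which shifts the second index of an array into its first index. -/
def IsRaising {E : Type*} [NormedAddCommGroup E] [NormedSpace ℝ E] (F : ℕ → ℕ → ℕ → E) : Prop :=
  ∀ i j n, F i (j + 1) n = F (i + 1) j n
    + ∑ l ∈ Finset.range i, ((-1) ^ (i - l) * (i.choose l : ℝ)) •
        (F (l + 1) j n + Real.exp (alpha n) • F l j n)

section Raising

variable {E : Type*} [NormedAddCommGroup E] [NormedSpace ℝ E] {F : ℕ → ℕ → ℕ → E} {w : ℕ → ℤ}

/-- The factor c has order 2 and comes with a total index lower by at least two; the second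
condition on `w` makes these balance. -/
theorem hasOrder_raising_sum (hw : Monotone w) (hw2 : ∀ k, w k + 2 ≤ w (k + 2)) (i j : ℕ)
    (h1 : ∀ l < i, HasOrder (F (l + 1) j) (w (l + 1 + j)))
    (h2 : ∀ l < i, HasOrder (F l j) (w (l + j))) :
    HasOrder (fun n => ∑ l ∈ Finset.range i, ((-1) ^ (i - l) * (i.choose l : ℝ)) •
        (F (l + 1) j n + Real.exp (alpha n) • F l j n)) (w (i + j + 1)) := by
  refine HasOrder.sum fun l hl => HasOrder.const_smul (HasOrder.add ?_ ?_) _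
  · rw [Finset.mem_range] at hl
    exact (h1 l hl).mono (hw (by omega))
  · rw [Finset.mem_range] at hl
    refine (hasOrder_exp_alpha.smul (h2 l hl)).mono ?_
    have := hw2 (l + j)
    have := hw (show l + j + 2 ≤ i + j + 1 by omega)
    omega

/-- The relation is solved for `F (i + 1) j`. This serves contour integrals, where the entries with
`i = 0` can be estimated directly. -/
theorem IsRaising.hasOrder_of_left (hF : IsRaising F) (hw : Monotone w)
    (hw2 : ∀ k, w k + 2 ≤ w (k + 2)) (h : ∀ j, HasOrder (F 0 j) (w j)) (i : ℕ) :
    ∀ j, HasOrder (F i j) (w (i + j)) := by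
  induction i using Nat.strong_induction_on with
  | _ i ih =>
    intro j
    rcases i with _ | i
    · simpa using h j
    · have h1 := hasOrder_raising_sum hw hw2 i j (fun l hl => ih (l + 1) (by omega) j)
        (fun l hl => ih l (by omega) j)
      have h2 := ih i (by omega) (j + 1)
      rw [show i + 1 + j = i + j + 1 by ring]
      exact (h2.sub h1).congr fun n => by rw [hF i j n]; abel

theorem IsRaising.hasOrder_of_right (hF : IsRaising F) (hw : Monotone w)
    (hw2 : ∀ k, w k + 2 ≤ w (k + 2)) (h : ∀ i, HasOrder (F i 0) (w i)) (j : ℕ) :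
    ∀ i, HasOrder (F i j) (w (i + j)) := by
  induction j with
  | zero => exact fun i => h i
  | succ j ih =>
    intro i
    have h1 := hasOrder_raising_sum hw hw2 i j (fun l _ => ih (l + 1)) (fun l _ => ih l)
    have h2 := ih (i + 1)
    rw [show i + 1 + j = i + j + 1 by ring] at h2
    exact (h2.add h1).congr fun n => (hF i j n).symm

end Raising

end Order

/-! ### Moments of X − c mixed with powers of exp z − c. -/

section ShiftedMoments

open Polynomial

/-- The operator on polynomials which corresponds to the multiplication by `exp z - c`. -/
noncomputable def raise (c : ℝ) : ℝ[X] →ₗ[ℝ] ℝ[X] where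
  toFun p := X * p.comp (X - 1) - C c * p
  map_add' p q := by simp only [add_comp]; ring
  map_smul' r p := by
    simp only [smul_eq_C_mul, mul_comp, C_comp, RingHom.id_apply]
    ring

theorem raise_apply (c : ℝ) (p : ℝ[X]) : raise c p = X * p.comp (X - 1) - C c * p := rfl

/-- Binomial expansion of ((X − c) − 1)^i, followed by X(X − c)^l = (X − c)^{l+1} + c(X − c)^l. -/
theorem raise_pow (c : ℝ) (i : ℕ) : raise c ((X - C c) ^ i) = (X - C c) ^ (i + 1)
    + ∑ l ∈ Finset.range i, ((-1) ^ (i - l) * (i.choose l : ℝ)) •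
        ((X - C c) ^ (l + 1) + c • (X - C c) ^ l) := by
  have h1 : ((X - C c) ^ i).comp (X - 1) = ((X - C c) + (-1)) ^ i := by
    simp
    ring
  rw [raise_apply, h1, add_pow, Finset.sum_range_succ, Nat.sub_self, Nat.choose_self]
  have h2 : ∀ l, (X - C c) ^ l * (-1) ^ (i - l) * ((i.choose l : ℕ) : ℝ[X])
      = ((-1) ^ (i - l) * (i.choose l : ℝ)) • (X - C c) ^ l := by
    intro l
    rw [smul_eq_C_mul]
    simp
    ring
  have h3 : ∀ l, ((-1) ^ (i - l) * (i.choose l : ℝ)) •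
      ((X - C c) ^ (l + 1) + c • (X - C c) ^ l)
      = X * (((-1) ^ (i - l) * (i.choose l : ℝ)) • (X - C c) ^ l) := by
    intro l
    simp only [smul_eq_C_mul]
    ring
  simp only [h2, h3]
  rw [← Finset.mul_sum]
  push_cast
  ring

/-- The polynomials `(X - c) ^ i`, raised `j` times. -/
noncomputable def raisedPow (c : ℝ) (i j : ℕ) : ℝ[X] := (raise c)^[j] ((X - C c) ^ i)

theorem raisedPow_succ (c : ℝ) (i j : ℕ) : raisedPow c i (j + 1) = raisedPow c (i + 1) j
    + ∑ l ∈ Finset.range i, ((-1) ^ (i - l) * (i.choose l : ℝ)) •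
        (raisedPow c (l + 1) j + c • raisedPow c l j) := by
  simp only [raisedPow]
  rw [Function.iterate_succ_apply, raise_pow, ← Module.End.pow_apply, map_add, map_sum]
  simp only [map_smul, map_add, Module.End.pow_apply]

theorem poissonFun_raise (c : ℝ) (p : ℝ[X]) (z : ℂ) :
    poissonFun (raise c p) z = (Complex.exp z - c) * poissonFun p z := by
  rw [poissonFun, raise_apply, map_sub, ← one_add_X_mul_poissonMap, poissonMap_C_mul, poissonFun]
  simp
  ring

theorem poissonFun_raisedPow (c : ℝ) (i j : ℕ) (z : ℂ) :
    poissonFun (raisedPow c i j) z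
      = (Complex.exp z - c) ^ j * poissonFun ((X - C c) ^ i) z := by
  unfold raisedPow
  induction j with
  | zero => simp
  | succ j ih => rw [Function.iterate_succ_apply', poissonFun_raise, ih]; ring

/-- The value at `raisedPow (exp (alpha n)) i j` of the linear form of the Bell numbers. -/
noncomputable def bellMoment (i j n : ℕ) : ℝ := bellMean n (raisedPow (Real.exp (alpha n)) i j)

theorem isRaising_bellMoment : IsRaising bellMoment := by
  intro i j n
  unfold bellMoment
  rw [raisedPow_succ, map_add, map_sum]
  simp only [map_smul, map_add]

theorem poissonFun_add (p q : ℝ[X]) (z : ℂ) :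
    poissonFun (p + q) z = poissonFun p z + poissonFun q z := by
  simp [poissonFun]

theorem poissonFun_smul (r : ℝ) (p : ℝ[X]) (z : ℂ) :
    poissonFun (r • p) z = r * poissonFun p z := by
  simp [poissonFun]

theorem poissonFun_sum {ι : Type*} (s : Finset ι) (p : ι → ℝ[X]) (z : ℂ) :
    poissonFun (∑ i ∈ s, p i) z = ∑ i ∈ s, poissonFun (p i) z := by
  simp [poissonFun]

/-- The contour integral of `R` against `raisedPow (exp (alpha n)) i j`. -/
noncomputable def weightedMoment (R : ℕ → ℂ → ℂ) (i j n : ℕ) : ℂ :=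
  contourMean n (alpha n) fun z => R n z * poissonFun (raisedPow (Real.exp (alpha n)) i j) z

theorem isRaising_weightedMoment {R : ℕ → ℂ → ℂ}
    (hR : ∀ n, ContinuousOn (R n) (Metric.sphere 0 (alpha n))) : IsRaising (weightedMoment R) := by
  intro i j n
  have ha := (alpha_spec n).1
  unfold weightedMoment
  have hc : ∀ p : ℝ[X], ContinuousOn (fun z => R n z * poissonFun p z)
      (Metric.sphere 0 (alpha n)) := fun p => (hR n).mul (continuous_poissonFun p).continuousOn
  have hc2 : ∀ p : ℝ[X], ContinuousOn (fun z => ((Real.exp (alpha n) : ℝ) : ℂ)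
      * (R n z * poissonFun p z)) (Metric.sphere 0 (alpha n)) := fun p =>
    continuousOn_const.mul (hc p)
  have h1 : ∀ l, contourMean n (alpha n) (fun z => R n z * poissonFun
      (((-1) ^ (i - l) * (i.choose l : ℝ)) • (raisedPow (Real.exp (alpha n)) (l + 1) j
        + Real.exp (alpha n) • raisedPow (Real.exp (alpha n)) l j)) z)
      = ((-1) ^ (i - l) * (i.choose l : ℝ)) •
        (contourMean n (alpha n) (fun z => R n z
          * poissonFun (raisedPow (Real.exp (alpha n)) (l + 1) j) z) + Real.exp (alpha n) •
        contourMean n (alpha n) (fun z => R n z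
          * poissonFun (raisedPow (Real.exp (alpha n)) l j) z)) := by
    intro l
    rw [Complex.real_smul, Complex.real_smul, ← contourMean_const_mul, ← contourMean_add n ha
      (hc _) (hc2 _), ← contourMean_const_mul]
    congr 1
    funext z
    simp only [poissonFun_smul, poissonFun_add]
    ring
  simp only [← h1]
  rw [← contourMean_sum n ha _ _ fun l _ => hc _, ← contourMean_add n ha (hc _)
    (continuousOn_finsetSum _ fun l _ => hc _)]
  congr 1
  funext z
  rw [← Finset.mul_sum, ← poissonFun_sum, ← mul_add, ← poissonFun_add, ← raisedPow_succ]

theorem norm_exp_sub_one_le_two_mul {ζ : ℂ} (h : ζ.re ≤ 0) : ‖Complex.exp ζ - 1‖ ≤ 2 * ‖ζ‖ := by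
  rcases le_or_gt ‖ζ‖ 1 with h1 | h1
  · exact Complex.norm_exp_sub_one_le h1
  · have := norm_exp_sub_one_le_two h
    linarith

theorem exp_sub_exp_alpha (n : ℕ) (z : ℂ) : Complex.exp z - (Real.exp (alpha n) : ℝ)
    = (Real.exp (alpha n) : ℝ) * (Complex.exp (z - alpha n) - 1) := by
  rw [Complex.ofReal_exp, mul_sub, ← Complex.exp_add, add_sub_cancel, mul_one]

theorem re_sub_nonpos {a : ℝ} {z : ℂ} (hz : ‖z‖ = a) : (z - a).re ≤ 0 := by
  rw [Complex.sub_re, Complex.ofReal_re, ← hz]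
  have := Complex.re_le_norm z
  linarith

/-- For `i = 0` the integrand is R c^j (e^{z−α} − 1)^j, which vanishes to order L + j. The order is
2j from c^j, 10 from the crude bound, 1 from α^{L+j} and −(L + j) from the vanishing. -/
theorem hasOrder_weightedMoment {R : ℕ → ℂ → ℂ} (L : ℕ) {M : ℝ} (hM : 0 ≤ M)
    (hR : ∀ n, ContinuousOn (R n) (Metric.sphere 0 (alpha n)))
    (hRL : ∀ n, 1 ≤ alpha n → ∀ z, ‖z‖ = alpha n → ‖R n z‖ ≤ M * ‖z - alpha n‖ ^ L) (i j : ℕ) :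
    HasOrder (weightedMoment R i j) (((i + j : ℕ) : ℤ) + 11 - L) := by
  refine (isRaising_weightedMoment hR).hasOrder_of_left (w := fun k => (k : ℤ) + 11 - L)
    (fun a b h => by simp; omega) (fun k => by push_cast; linarith) (fun j => ?_) i j
  have h1 : ∀ᶠ n in atTop, ‖weightedMoment R 0 j n‖ ≤ (Real.exp 4
      * (1 + 6 ^ (L + j) * (L + j).factorial) * (M * 2 ^ j)) * ‖sqrtScale n ^ (2 * (j : ℤ))
        * sqrtScale n ^ (10 : ℤ) * (alpha n ^ (L + j) * sqrtScale n ^ (-((L + j : ℕ) : ℤ)))‖ := by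
    filter_upwards [tendsto_alpha.eventually_ge_atTop 1] with n hn
    have h2 := norm_contourMean_le_of_norm_le_pow (L + j) hn (M := M * 2 ^ j * Real.exp (alpha n) ^ j)
      (by positivity) (F := fun z => R n z * poissonFun (raisedPow (Real.exp (alpha n)) 0 j) z)
      (fun z hz => by
        rw [norm_mul, poissonFun_raisedPow, pow_zero, poissonFun, poissonMap_one, map_one, mul_one,
          exp_sub_exp_alpha, norm_pow, norm_mul, Complex.norm_real,
          Real.norm_of_nonneg (Real.exp_pos _).le, mul_pow]
        calc ‖R n z‖ * (Real.exp (alpha n) ^ j * ‖Complex.exp (z - alpha n) - 1‖ ^ j)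
            ≤ (M * ‖z - alpha n‖ ^ L) * (Real.exp (alpha n) ^ j * (2 * ‖z - alpha n‖) ^ j) := by
              gcongr
              · exact hRL n hn z hz
              · exact norm_exp_sub_one_le_two_mul (re_sub_nonpos hz)
          _ = _ := by rw [mul_pow]; ring)
    refine h2.trans (le_of_eq ?_)
    have hg := sqrtScale_pos n
    have ha := (alpha_spec n).1
    rw [Real.norm_of_nonneg (by positivity), ← sqrtScale_sq]
    change _ * sqrtScale n ^ 10 * (alpha n / sqrtScale n) ^ (L + j) = _
    rw [zpow_neg, zpow_natCast, div_pow, zpow_mul, zpow_natCast]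
    norm_cast
    ring
  have h3 : HasOrder (fun n => sqrtScale n ^ (2 * (j : ℤ)) * sqrtScale n ^ (10 : ℤ)
      * (alpha n ^ (L + j) * sqrtScale n ^ (-((L + j : ℕ) : ℤ)))) ((j : ℤ) + 11 - L) := by
    have hz : ∀ k : ℤ, HasOrder (fun n => sqrtScale n ^ k) k := fun k => isBigO_refl _ _
    refine (((hz (2 * (j : ℤ))).mul (hz 10)).mul ((hasOrder_alpha_pow (L + j)).mul
      (hz (-((L + j : ℕ) : ℤ))))).mono ?_
    push_cast
    linarith
  exact (IsBigO.of_bound _ h1).trans h3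

end ShiftedMoments

/-! ### The recursion for the moments and the bootstrap. -/

section MomentBounds

open Polynomial

/-- The coefficients of the expansion of `1 - alpha n / z` at the saddle point. -/
noncomputable def saddleCoeff (j n : ℕ) : ℝ := (saddlePoly 30 (alpha n)⁻¹).coeff j

/-- The error in the expansion of `1 - alpha n / z` at the saddle point. -/
noncomputable def saddleError (n : ℕ) (z : ℂ) : ℂ :=
  1 - alpha n * z⁻¹ - aeval (Complex.exp (z - alpha n) - 1) (saddlePoly 30 (alpha n)⁻¹)

theorem continuousOn_saddleError (n : ℕ) :
    ContinuousOn (saddleError n) (Metric.sphere 0 (alpha n)) := by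
  have hne : ∀ z ∈ Metric.sphere (0 : ℂ) (alpha n), z ≠ 0 := by
    rintro z hz rfl
    rw [Metric.mem_sphere, dist_self] at hz
    exact (alpha_spec n).1.ne hz
  refine ContinuousOn.sub (continuousOn_const.sub (continuousOn_const.mul
    (continuousOn_inv₀.mono fun z hz => hne z hz))) (Continuous.continuousOn ?_)
  exact (Polynomial.continuous_aeval (R := ℝ) (A := ℂ) _).comp
    ((Complex.continuous_exp.comp (continuous_id.sub continuous_const)).sub continuous_const)

theorem alpha_mul_exp_alpha (n : ℕ) : ((alpha n : ℝ) : ℂ) * (Real.exp (alpha n) : ℝ) = n + 1 := by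
  rw [← Complex.ofReal_mul, (alpha_spec n).2]
  push_cast
  rfl

/-- The degree is at most 30² = 900, and e^{z−α} − 1 = (e^z − c)/c. -/
theorem aeval_saddlePoly (n : ℕ) (z : ℂ) :
    aeval (Complex.exp (z - alpha n) - 1) (saddlePoly 30 (alpha n)⁻¹)
      = ∑ j ∈ Finset.range 901, ((saddleCoeff j n * Real.exp (alpha n) ^ (-(j : ℤ)) : ℝ) : ℂ)
        * (Complex.exp z - (Real.exp (alpha n) : ℝ)) ^ j := by
  rw [aeval_eq_sum_range' (natDegree_saddlePoly_lt 30 (alpha n)⁻¹)]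
  refine Finset.sum_congr rfl fun j _ => ?_
  have hc : ((Real.exp (alpha n) : ℝ) : ℂ) ≠ 0 := Complex.ofReal_ne_zero.2 (Real.exp_pos _).ne'
  rw [exp_sub_exp_alpha, Complex.real_smul, mul_pow, zpow_neg, zpow_natCast, saddleCoeff]
  push_cast at hc ⊢
  field_simp

/-- The error in the recursion for the moments. -/
noncomputable def momentError (k n : ℕ) : ℝ :=
  bellMoment (k + 1) 0 n + ∑ j ∈ Finset.range 901,
    saddleCoeff j n * Real.exp (alpha n) ^ (1 - (j : ℤ)) * bellMoment k j n

theorem weightedMoment_one (i j n : ℕ) :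
    weightedMoment (fun _ _ => 1) i j n = (bellMoment i j n : ℂ) := by
  rw [weightedMoment, bellMoment, ← contourMean_poissonFun n (alpha_spec n).1]
  simp only [one_mul]

/-- By parts, E[(X − c)p] = E[((n+1)/z − c)p], which is −c E[(1 − α/z)p] because n + 1 = αc;
expanding 1 − α/z leaves the saddle error. -/
theorem momentError_eq (k n : ℕ) : ((momentError k n : ℝ) : ℂ)
    = -((Real.exp (alpha n) : ℝ) : ℂ) * weightedMoment saddleError k 0 n := by
  have ha := (alpha_spec n).1
  have hne : ∀ z ∈ Metric.sphere (0 : ℂ) (alpha n), z ≠ 0 := by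
    rintro z hz rfl
    rw [Metric.mem_sphere, dist_self] at hz
    exact ha.ne hz
  set c : ℝ := Real.exp (alpha n) with hc
  have hc0 : (c : ℂ) ≠ 0 := Complex.ofReal_ne_zero.2 (Real.exp_pos _).ne'
  set p : ℝ[X] := (X - C c) ^ k with hp
  have hcont : ContinuousOn (fun z => z⁻¹ * poissonFun p z) (Metric.sphere 0 (alpha n)) :=
    (continuousOn_inv₀.mono fun z hz => hne z hz).mul (continuous_poissonFun p).continuousOn
  have h1 : (bellMoment (k + 1) 0 n : ℂ) = (n + 1) * contourMean n (alpha n)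
      (fun z => z⁻¹ * poissonFun p z) + (-(c : ℂ)) * contourMean n (alpha n) (poissonFun p) := by
    have h2 : raisedPow c (k + 1) 0 = X * p - C c * p := by
      rw [raisedPow, Function.iterate_zero, id, pow_succ', hp]
      ring
    rw [bellMoment, h2, map_sub, Complex.ofReal_sub, bellMean_X_mul n ha, bellMean_C_mul,
      contourMean_poissonFun n ha]
    push_cast
    ring
  have h2 : ∀ j, ((saddleCoeff j n * c ^ (1 - (j : ℤ)) * bellMoment k j n : ℝ) : ℂ)
      = contourMean n (alpha n) (fun z => (c : ℂ) * (((saddleCoeff j n * c ^ (-(j : ℤ)) : ℝ) : ℂ)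
        * ((Complex.exp z - c) ^ j * poissonFun p z))) := by
    intro j
    rw [contourMean_const_mul, contourMean_const_mul, Complex.ofReal_mul, ← weightedMoment_one,
      weightedMoment, sub_eq_add_neg, zpow_add₀ (Real.exp_pos _).ne', zpow_one]
    simp only [one_mul, poissonFun_raisedPow, ← hc, ← hp]
    rw [Complex.ofReal_mul, Complex.ofReal_mul, Complex.ofReal_mul]
    ring
  rw [momentError, Complex.ofReal_add, Complex.ofReal_sum, h1]
  simp only [← hc, h2]
  have hcj : ∀ j, ContinuousOn (fun z => (c : ℂ) * (((saddleCoeff j n * c ^ (-(j : ℤ)) : ℝ) : ℂ)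
        * ((Complex.exp z - c) ^ j * poissonFun p z))) (Metric.sphere 0 (alpha n)) := fun j =>
    (continuous_const.mul (continuous_const.mul
      (((Complex.continuous_exp.sub continuous_const).pow j).mul
        (continuous_poissonFun p)))).continuousOn
  have hc1 : ContinuousOn (fun z => ((n : ℂ) + 1) * (z⁻¹ * poissonFun p z))
      (Metric.sphere 0 (alpha n)) := continuousOn_const.mul hcont
  have hc2 : ContinuousOn (fun z => -(c : ℂ) * poissonFun p z) (Metric.sphere 0 (alpha n)) :=
    continuousOn_const.mul (continuous_poissonFun p).continuousOn
  have hc12 : ContinuousOn (fun z => ((n : ℂ) + 1) * (z⁻¹ * poissonFun p z)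
      + -(c : ℂ) * poissonFun p z) (Metric.sphere 0 (alpha n)) := hc1.add hc2
  rw [← contourMean_sum n ha _ _ fun j _ => hcj j, ← contourMean_const_mul,
    ← contourMean_const_mul, weightedMoment, ← contourMean_const_mul,
    ← contourMean_add n ha hc1 hc2,
    ← contourMean_add n ha hc12 (continuousOn_finsetSum _ fun j _ => hcj j)]
  refine contourMean_congr n ha fun z hz => ?_
  rw [saddleError, aeval_saddlePoly, ← alpha_mul_exp_alpha, ← hc, poissonFun_raisedPow, pow_zero,
    one_mul, ← hp, ← Finset.mul_sum]
  simp only [← mul_assoc]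
  rw [← Finset.sum_mul]
  ring

/-- Every coefficient is O(1/α). This is the source of the extra factor α in the estimates below,
hence of the 1/α in the final error terms. -/
theorem hasOrder_saddleCoeff (j : ℕ) : HasOrder (fun n => alpha n * saddleCoeff j n) 0 := by
  obtain ⟨M, hM⟩ := exists_abs_coeff_saddlePoly_le 30 j
  unfold HasOrder
  simp only [zpow_zero]
  refine IsBigO.of_bound M ?_
  filter_upwards [tendsto_alpha.eventually_ge_atTop 1] with n hn
  have ha := (alpha_spec n).1
  have h := hM (alpha n)⁻¹ (by positivity) (inv_le_one_of_one_le₀ hn)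
  rw [norm_one, mul_one, norm_mul, Real.norm_of_nonneg ha.le, Real.norm_eq_abs, saddleCoeff]
  calc alpha n * _ ≤ alpha n * (M * (alpha n)⁻¹) := by gcongr
    _ = M := by field_simp

theorem HasOrder.of_alpha_mul {f : ℕ → ℝ} {e : ℤ} (h : HasOrder (fun n => alpha n * f n) e) :
    HasOrder f e := by
  have h1 := hasOrder_inv_alpha.mul h
  rw [zero_add] at h1
  refine h1.congr fun n => ?_
  have := (alpha_spec n).1
  field_simp

/-- The expansion to degree 30 vanishes to order 31, more than enough to beat the loss of order 11
in `hasOrder_weightedMoment`. -/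
theorem hasOrder_momentError (k : ℕ) :
    HasOrder (fun n => alpha n * momentError k n) ((k : ℤ) - 17) := by
  obtain ⟨M, hM0, hM⟩ := exists_norm_sub_saddlePoly_le 30
  have h := hasOrder_weightedMoment (R := saddleError) 31 hM0 continuousOn_saddleError
    (fun n hn z hz => hM (alpha n) hn z hz) k 0
  have h1 : HasOrder (fun n => (momentError k n : ℂ)) (2 + ((k : ℤ) - 20)) := by
    refine ((hasOrder_exp_alpha.smul h).neg.mono ?_).congr fun n => ?_
    · push_cast; linarith
    · rw [momentError_eq, Complex.real_smul, neg_mul]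
  have h2 := (hasOrder_alpha_pow 1).mul (hasOrder_ofReal.1 h1)
  simp only [pow_one] at h2
  exact h2.mono (by linarith)

/-- The terms of order at least two in the recursion for the moments. -/
noncomputable def momentTail (k n : ℕ) : ℝ := ∑ j ∈ Finset.range 899,
  saddleCoeff (j + 2) n * Real.exp (alpha n) ^ (-1 - (j : ℤ)) * bellMoment k (j + 2) n

/-- The lower order moments in the recursion for the moments. -/
noncomputable def momentLower (k n : ℕ) : ℝ := ∑ l ∈ Finset.range k,
  ((-1) ^ (k - l) * (k.choose l : ℝ)) *
    (bellMoment (l + 1) 0 n + Real.exp (alpha n) * bellMoment l 0 n)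

theorem bellMoment_one_right (k n : ℕ) :
    bellMoment k 1 n = bellMoment (k + 1) 0 n + momentLower k n := isRaising_bellMoment k 0 n

/-- The term j = 0 vanishes, and the term j = 1 contains `bellMoment (k + 1) 0` once more, with the
factor 1/α. -/
theorem moment_recursion (k n : ℕ) : (1 + (alpha n)⁻¹) * bellMoment (k + 1) 0 n
    = momentError k n - momentTail k n - (alpha n)⁻¹ * momentLower k n := by
  obtain ⟨h0, h1, -⟩ := coeff_saddlePoly_small 28 (alpha n)⁻¹
  have h0' : saddleCoeff 0 n = 0 := h0
  have h1' : saddleCoeff 1 n = (alpha n)⁻¹ := h1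
  have h2 : ∀ j : ℕ, (1 - ((j + 1 + 1 : ℕ) : ℤ)) = -1 - (j : ℤ) := fun j => by push_cast; ring
  have h3 : momentError k n = bellMoment (k + 1) 0 n
      + (momentTail k n + (alpha n)⁻¹ * bellMoment k 1 n) := by
    rw [momentError, Finset.sum_range_succ', Finset.sum_range_succ', h0', zero_add, h1']
    simp only [h2]
    simp [momentTail]
  rw [h3, bellMoment_one_right]
  ring

theorem bellMoment_succ_eq (k n : ℕ) : bellMoment (k + 1) 0 n = (1 + (alpha n)⁻¹)⁻¹
    * (momentError k n - momentTail k n - (alpha n)⁻¹ * momentLower k n) := by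
  have h : 0 < (alpha n)⁻¹ := inv_pos.2 (alpha_spec n).1
  rw [← moment_recursion, inv_mul_cancel_left₀ (by positivity)]

theorem bellMoment_zero (n : ℕ) : bellMoment 0 0 n = 1 := by
  have h := bellMean_C_mul_X_pow n 1 0
  simp only [pow_zero, mul_one, C_1, one_mul, add_zero] at h
  rw [bellMoment, raisedPow, Function.iterate_zero, id, pow_zero, h]
  exact div_self (Nat.cast_ne_zero.2 (bellNumber_pos n).ne')

theorem hasOrder_momentTail_term {k j : ℕ} {e : ℤ} (h : HasOrder (bellMoment k (j + 2)) e) :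
    HasOrder (fun n => alpha n * (saddleCoeff (j + 2) n * Real.exp (alpha n) ^ (-1 - (j : ℤ))
      * bellMoment k (j + 2) n)) (e - 2 - 2 * j) :=
  ((((hasOrder_saddleCoeff (j + 2)).mul (hasOrder_exp_alpha_zpow (-1 - (j : ℤ)))).mul h).mono
    (by linarith)).congr fun n => by ring

theorem hasOrder_momentTail {k : ℕ} {e : ℤ}
    (h : ∀ j, HasOrder (bellMoment k (j + 2)) (e + 2 + 2 * j)) :
    HasOrder (fun n => alpha n * momentTail k n) e := by
  unfold momentTail
  simp only [Finset.mul_sum]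
  exact HasOrder.sum fun j _ => (hasOrder_momentTail_term (h j)).mono (by linarith)

theorem hasOrder_momentLower {k : ℕ} {e : ℤ} (h1 : ∀ l < k, HasOrder (bellMoment (l + 1) 0) e)
    (h2 : ∀ l < k, HasOrder (bellMoment l 0) (e - 2)) : HasOrder (momentLower k) e := by
  unfold momentLower
  refine HasOrder.sum fun l hl => HasOrder.const_mul (HasOrder.add ?_ ?_) _
  · exact h1 l (Finset.mem_range.1 hl)
  · exact (hasOrder_exp_alpha.mul (h2 l (Finset.mem_range.1 hl))).mono (by linarith)

theorem hasOrder_bellMoment_apriori (k : ℕ) : HasOrder (bellMoment k 0) ((k : ℤ) + 11) := by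
  have h := hasOrder_weightedMoment (R := fun _ _ => 1) 0 zero_le_one
    (fun _ => continuousOn_const) (fun n _ z _ => by simp) k 0
  refine hasOrder_ofReal.1 ((h.congr fun n => weightedMoment_one k 0 n).mono ?_)
  push_cast
  linarith

/-- In the recursion the tail at level k is at most of the order k + (e + 1), which is one better
than assumed for level k + 1; the lower moments are covered by induction from μ_0 = 1. -/
theorem hasOrder_bellMoment_improve {e : ℕ} (h : ∀ k : ℕ, HasOrder (bellMoment k 0) (k + (e + 1)))
    (k : ℕ) : HasOrder (bellMoment k 0) (k + e) := by
  have hr := fun j => isRaising_bellMoment.hasOrder_of_right (w := fun k => (k : ℤ) + (e + 1))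
    (fun a b h => by simp; omega) (fun k => by push_cast; linarith) h j
  induction k using Nat.strong_induction_on with
  | _ k ih =>
    rcases k with _ | k
    · refine ((hasOrder_const 1).mono ?_).congr fun n => (bellMoment_zero n).symm
      positivity
    · have h1 : HasOrder (fun n => alpha n * momentTail k n) (((k + 1 : ℕ) : ℤ) + e) :=
        hasOrder_momentTail fun j => (hr (j + 2) k).mono (by push_cast; linarith)
      have h2 : HasOrder (momentLower k) (((k + 1 : ℕ) : ℤ) + e) :=
        hasOrder_momentLower (fun l hl => (ih (l + 1) (by omega)).mono (by push_cast; omega))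
          (fun l hl => (ih l (by omega)).mono (by push_cast; omega))
      have h3 := (hasOrder_momentError k).of_alpha_mul
      have h4 := hasOrder_inv_one_add_inv_alpha.mul (((h3.mono (e' := ((k + 1 : ℕ) : ℤ) + e)
        (by push_cast; linarith)).sub h1.of_alpha_mul).sub
          ((hasOrder_inv_alpha.mul h2).mono (le_of_eq (zero_add _))))
      rw [zero_add] at h4
      exact h4.congr fun n => (bellMoment_succ_eq k n).symm

theorem hasOrder_bellMoment_left (k : ℕ) : HasOrder (bellMoment k 0) k := by
  have h : ∀ e : ℕ, (∀ k : ℕ, HasOrder (bellMoment k 0) (k + e)) →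
      ∀ k : ℕ, HasOrder (bellMoment k 0) k := by
    intro e
    induction e with
    | zero => exact fun h k => by simpa using h k
    | succ e ih => exact fun h => ih (hasOrder_bellMoment_improve (by exact_mod_cast h))
  exact h 11 (fun k => by exact_mod_cast hasOrder_bellMoment_apriori k) k

theorem hasOrder_bellMoment_crude (k j : ℕ) : HasOrder (bellMoment k j) ((k + j : ℕ) : ℤ) :=
  isRaising_bellMoment.hasOrder_of_right (w := fun k => (k : ℤ))
    (fun a b h => by simp; omega) (fun k => by push_cast; rfl) hasOrder_bellMoment_left j k

/-- Odd moments gain a factor √c, as for a nearly Gaussian variable: rerunning the recursion with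
the sharp orders leaves only even ones. -/
theorem hasOrder_alpha_mul_bellMoment (k : ℕ) :
    HasOrder (fun n => alpha n * bellMoment (k + 1) 0 n) (2 * ((k + 1) / 2 : ℕ)) := by
  induction k using Nat.strong_induction_on with
  | _ k ih =>
    have h1 : HasOrder (fun n => alpha n * momentTail k n) (2 * ((k + 1) / 2 : ℕ)) :=
      hasOrder_momentTail fun j => (hasOrder_bellMoment_crude k (j + 2)).mono (by push_cast; omega)
    have h2 : HasOrder (momentLower k) (2 * ((k + 1) / 2 : ℕ)) := by
      refine hasOrder_momentLower (fun l hl => ?_) (fun l hl => ?_)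
      · exact (hasOrder_bellMoment_left (l + 1)).mono (by push_cast; omega)
      · rcases l with _ | l
        · refine ((hasOrder_const 1).mono ?_).congr fun n => (bellMoment_zero n).symm
          omega
        · exact (ih l (by omega)).of_alpha_mul.mono (by push_cast; omega)
    have h3 := hasOrder_inv_one_add_inv_alpha.mul ((((hasOrder_momentError k).mono
      (e' := 2 * ((k + 1) / 2 : ℕ)) (by push_cast; omega)).sub h1).sub h2)
    rw [zero_add] at h3
    refine h3.congr fun n => ?_
    have ha := (alpha_spec n).1
    rw [bellMoment_succ_eq]
    field_simp

theorem hasOrder_bellMoment (k j : ℕ) : HasOrder (bellMoment k j) (2 * ((k + j) / 2 : ℕ)) := by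
  refine isRaising_bellMoment.hasOrder_of_right (w := fun k => 2 * ((k / 2 : ℕ) : ℤ))
    (fun a b h => ?_) (fun k => by push_cast; omega) (fun i => ?_) j k
  · have := Nat.div_le_div_right (c := 2) h
    simp only
    omega
  · rcases i with _ | k
    · refine ((hasOrder_const 1).mono ?_).congr fun n => (bellMoment_zero n).symm
      simp
    · exact (hasOrder_alpha_mul_bellMoment k).of_alpha_mul

end MomentBounds

/-! ### Leading terms of the first four moments. -/

section LeadingMoments

theorem saddleCoeff_two (n : ℕ) :
    saddleCoeff 2 n = -(alpha n)⁻¹ / 2 - (alpha n)⁻¹ ^ 2 := by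
  obtain ⟨-, -, h2⟩ := coeff_saddlePoly_small 28 (alpha n)⁻¹
  rw [saddleCoeff, h2]

theorem hasOrder_momentTail_sub (k : ℕ) : HasOrder (fun n => alpha n * (momentTail k n
    - saddleCoeff 2 n * (Real.exp (alpha n))⁻¹ * bellMoment k 2 n))
      (2 * ((k + 3) / 2 : ℕ) - 4) := by
  have h : HasOrder (fun n => ∑ j ∈ Finset.range 898, alpha n * (saddleCoeff (j + 1 + 2) n
      * Real.exp (alpha n) ^ (-1 - ((j + 1 : ℕ) : ℤ)) * bellMoment k (j + 1 + 2) n))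
      (2 * ((k + 3) / 2 : ℕ) - 4) :=
    HasOrder.sum fun j _ => (hasOrder_momentTail_term (hasOrder_bellMoment k (j + 1 + 2))).mono
      (by push_cast; omega)
  refine h.congr fun n => ?_
  have h1 : momentTail k n = (∑ j ∈ Finset.range 898, saddleCoeff (j + 1 + 2) n
      * Real.exp (alpha n) ^ (-1 - ((j + 1 : ℕ) : ℤ)) * bellMoment k (j + 1 + 2) n)
      + saddleCoeff 2 n * (Real.exp (alpha n))⁻¹ * bellMoment k 2 n := by
    rw [momentTail, Finset.sum_range_succ']
    simp only [Nat.cast_zero, sub_zero, zpow_neg_one, zero_add]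
  rw [h1, add_sub_cancel_right, Finset.mul_sum]

theorem hasOrder_one_add_inv_alpha_mul {f : ℕ → ℝ} {e : ℤ}
    (h : HasOrder (fun n => alpha n * ((1 + (alpha n)⁻¹) * f n)) e) :
    HasOrder (fun n => alpha n * f n) e := by
  have h1 := hasOrder_inv_one_add_inv_alpha.mul h
  rw [zero_add] at h1
  refine h1.congr fun n => ?_
  have ha := (alpha_spec n).1
  field_simp

/-- For k = 1 the only lower term of size c is −c μ_0, so (1 + 1/α) μ_2 ≈ c/α. -/
theorem hasOrder_bellMoment_two_sub :
    HasOrder (fun n => alpha n * (bellMoment 2 0 n - Real.exp (alpha n) / (alpha n + 1))) 0 := by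
  apply hasOrder_one_add_inv_alpha_mul
  have h1 := (hasOrder_momentError 1).mono (e' := 0) (by norm_num)
  have h2 : HasOrder (fun n => alpha n * momentTail 1 n) 0 :=
    hasOrder_momentTail fun j => (hasOrder_bellMoment 1 (j + 2)).mono (by push_cast; omega)
  have h3 := hasOrder_bellMoment 1 0
  refine ((h1.sub h2).add h3).congr fun n => ?_
  have ha := (alpha_spec n).1
  rw [mul_sub, moment_recursion]
  simp only [momentLower, Finset.sum_range_succ, Finset.sum_range_zero, bellMoment_zero]
  norm_num
  field_simp
  ring

/-- For k = 0 there are no lower moments. The second-order tail term decides, through `bellMoment 0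
2` = μ_2 − μ_1 − c ≈ −αc/(α + 1). -/
theorem hasOrder_bellMoment_one_sub : HasOrder (fun n => alpha n * (bellMoment 1 0 n
    - (-(alpha n + 2) / (2 * (alpha n + 1) ^ 2)))) (-2) := by
  apply hasOrder_one_add_inv_alpha_mul
  have h1 := (hasOrder_momentError 0).mono (e' := -2) (by norm_num)
  have h2 := (hasOrder_momentTail_sub 0).mono (e' := -2) (by norm_num)
  have h3 : HasOrder (fun n => (alpha n * saddleCoeff 2 n) * Real.exp (alpha n) ^ (-1 : ℤ)
      * (bellMoment 2 0 n - Real.exp (alpha n) / (alpha n + 1) - bellMoment 1 0 n)) (-2) :=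
    (((hasOrder_saddleCoeff 2).mul (hasOrder_exp_alpha_zpow (-1))).mul
      (hasOrder_bellMoment_two_sub.of_alpha_mul.sub (hasOrder_bellMoment 1 0))).mono (by norm_num)
  refine ((h1.sub h2).sub h3).congr fun n => ?_
  have ha := (alpha_spec n).1
  have hc := Real.exp_pos (alpha n)
  rw [mul_sub (1 + (alpha n)⁻¹), moment_recursion, isRaising_bellMoment 0 1,
    isRaising_bellMoment 1 0, saddleCoeff_two, zpow_neg_one]
  simp only [momentLower, Finset.sum_range_succ, Finset.sum_range_zero, bellMoment_zero]
  norm_num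
  field_simp
  ring

/-- The dominant lower term is −3c μ_2, which produces the Gaussian value 3(c/(α + 1))². -/
theorem hasOrder_bellMoment_four_sub : HasOrder (fun n => alpha n * (bellMoment 4 0 n
    - 3 * Real.exp (alpha n) ^ 2 / (alpha n + 1) ^ 2)) 2 := by
  apply hasOrder_one_add_inv_alpha_mul
  have h1 := (hasOrder_momentError 3).mono (e' := 2) (by norm_num)
  have h2 : HasOrder (fun n => alpha n * momentTail 3 n) 2 :=
    hasOrder_momentTail fun j => (hasOrder_bellMoment 3 (j + 2)).mono (by push_cast; omega)
  have h3 := (hasOrder_exp_alpha.mul hasOrder_bellMoment_two_sub.of_alpha_mul).const_mul 3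
  have h4 := hasOrder_exp_alpha.mul (hasOrder_bellMoment 1 0)
  have h5 := (hasOrder_bellMoment 1 0).mono (e' := 2) (by norm_num)
  have h6 := hasOrder_bellMoment 2 0
  have h7 := (hasOrder_bellMoment 3 0).mono (e' := 2) (by norm_num)
  refine (((h1.sub h2).add h3).sub (((h6.add (h4.mono (e' := 2) (by norm_num))).const_mul 3
    |>.sub (h7.const_mul 3)).sub (h5.add hasOrder_exp_alpha))).congr fun n => ?_
  have ha := (alpha_spec n).1
  rw [mul_sub (1 + (alpha n)⁻¹), moment_recursion]
  simp only [momentLower, Finset.sum_range_succ, Finset.sum_range_zero, bellMoment_zero]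
  norm_num [Nat.choose]
  field_simp
  ring

theorem hasOrder_bellMoment_three_sub : HasOrder (fun n => alpha n * (bellMoment 3 0 n
    - (alpha n - 4) * Real.exp (alpha n) / (2 * (alpha n + 1) ^ 3))) 0 := by
  apply hasOrder_one_add_inv_alpha_mul
  have h1 := (hasOrder_momentError 2).mono (e' := 0) (by norm_num)
  have h2 := (hasOrder_momentTail_sub 2).mono (e' := 0) (by norm_num)
  have h3 := hasOrder_bellMoment_one_sub.of_alpha_mul
  have h4 := hasOrder_bellMoment_two_sub.of_alpha_mul
  -- The raising relation expands `bellMoment 2 2` as μ_4 − 5cμ_2 + 2c² plus this combination of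
  -- lower order.
  have h5 : HasOrder (fun n => -4 * bellMoment 1 0 n - 4 * Real.exp (alpha n)
      + 8 * bellMoment 2 0 n + 10 * (Real.exp (alpha n) * bellMoment 1 0 n)
      - 5 * bellMoment 3 0 n) 2 :=
    (((((hasOrder_bellMoment 1 0).const_mul (-4)).mono (by norm_num)).sub
      (hasOrder_exp_alpha.const_mul 4)).add ((hasOrder_bellMoment 2 0).const_mul 8)).add
      ((hasOrder_exp_alpha.mul (hasOrder_bellMoment 1 0)).const_mul 10) |>.sub
      ((hasOrder_bellMoment 3 0).const_mul 5)
  have h6 := (hasOrder_saddleCoeff 2).mul ((hasOrder_exp_alpha_zpow (-1)).mul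
    ((hasOrder_bellMoment_four_sub.of_alpha_mul.sub
      ((hasOrder_exp_alpha.mul h4).const_mul 5)).add h5))
  have h7 := ((hasOrder_bellMoment 1 0).sub (h4.const_mul 2)).sub
    ((hasOrder_exp_alpha.mul h3).const_mul 2)
  refine (((h1.sub h2).sub h6).sub h7).congr fun n => ?_
  have ha := (alpha_spec n).1
  have hc := Real.exp_pos (alpha n)
  rw [mul_sub (1 + (alpha n)⁻¹), moment_recursion, isRaising_bellMoment 2 1,
    isRaising_bellMoment 3 0, saddleCoeff_two, zpow_neg_one]
  simp only [momentLower, Finset.sum_range_succ, Finset.sum_range_zero]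
  rw [isRaising_bellMoment 2 0, isRaising_bellMoment 1 0, isRaising_bellMoment 0 0]
  simp only [Finset.sum_range_succ, Finset.sum_range_zero, bellMoment_zero]
  norm_num [Nat.choose]
  field_simp
  ring

end LeadingMoments

/-! ### Joint cumulants of ξ = X − c and ξ² under the form E, and covariances with ξ³. -/

section JointCumulants

theorem hasOrder_cumulant_one_one : HasOrder (fun n => alpha n * (bellMoment 2 0 n
    - bellMoment 1 0 n ^ 2 - Real.exp (alpha n) / (alpha n + 1))) 0 :=
  (hasOrder_bellMoment_two_sub.sub ((hasOrder_alpha_mul_bellMoment 0).mul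
    (hasOrder_bellMoment 1 0))).congr fun n => by ring

theorem hasOrder_cumulant_one_two : HasOrder (fun n => alpha n * (bellMoment 3 0 n
    - bellMoment 1 0 n * bellMoment 2 0 n)) 2 :=
  ((hasOrder_alpha_mul_bellMoment 2).sub ((hasOrder_alpha_mul_bellMoment 0).mul
    (hasOrder_bellMoment 2 0))).congr fun n => by ring

theorem hasOrder_cumulant_one_three : HasOrder (fun n => alpha n * (bellMoment 4 0 n
    - bellMoment 1 0 n * bellMoment 3 0 n)) 4 :=
  ((hasOrder_alpha_mul_bellMoment 3).sub (((hasOrder_alpha_mul_bellMoment 0).mul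
    (hasOrder_bellMoment 3 0)).mono (by norm_num))).congr fun n => by ring

theorem hasOrder_cumulant_two_two : HasOrder (fun n => alpha n * (bellMoment 4 0 n
    - bellMoment 2 0 n ^ 2)) 4 :=
  ((hasOrder_alpha_mul_bellMoment 3).sub ((hasOrder_alpha_mul_bellMoment 1).mul
    (hasOrder_bellMoment 2 0))).congr fun n => by ring

theorem hasOrder_cumulant_two_three : HasOrder (fun n => alpha n * (bellMoment 5 0 n
    - bellMoment 2 0 n * bellMoment 3 0 n)) 4 :=
  ((hasOrder_alpha_mul_bellMoment 4).sub ((hasOrder_alpha_mul_bellMoment 1).mul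
    (hasOrder_bellMoment 3 0))).congr fun n => by ring

/-- The main term collects those of μ_3 and −3μ_1μ_2: (α − 4)/2 + 3(α + 2)/2 = 2α + 1. -/
theorem hasOrder_cumulant_one_one_one : HasOrder (fun n => alpha n * (bellMoment 3 0 n
    - 3 * bellMoment 1 0 n * bellMoment 2 0 n + 2 * bellMoment 1 0 n ^ 3
    - (2 * alpha n + 1) / (alpha n + 1) ^ 3 * Real.exp (alpha n))) 0 := by
  have h1 := (hasOrder_bellMoment_one_sub.mul (hasOrder_bellMoment 2 0)).const_mul 3
  have h2 := (((hasOrder_bellMoment 1 0).sub (hasOrder_bellMoment_one_sub.of_alpha_mul.mono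
    (e' := 0) (by norm_num))).mul hasOrder_bellMoment_two_sub).const_mul 3
  have h3 := (((hasOrder_alpha_mul_bellMoment 0).mul (hasOrder_bellMoment 1 0)).mul
    (hasOrder_bellMoment 1 0)).const_mul 2
  refine (((hasOrder_bellMoment_three_sub.sub h1).sub h2).add h3).congr fun n => ?_
  have ha := (alpha_spec n).1
  field_simp
  ring

theorem hasOrder_cumulant_one_one_two : HasOrder (fun n => alpha n * (bellMoment 4 0 n
    - bellMoment 2 0 n ^ 2 - 2 * bellMoment 1 0 n * bellMoment 3 0 n
    + 2 * bellMoment 1 0 n ^ 2 * bellMoment 2 0 n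
    - 2 * Real.exp (alpha n) ^ 2 / (alpha n + 1) ^ 2)) 2 := by
  have h1 := hasOrder_bellMoment_two_sub.mul (((hasOrder_bellMoment 2 0).const_mul 2).sub
    (hasOrder_bellMoment_two_sub.of_alpha_mul.mono (e' := 2) (by norm_num)))
  have h2 := ((hasOrder_alpha_mul_bellMoment 0).mul (hasOrder_bellMoment 3 0)).const_mul 2
  have h3 := (((hasOrder_alpha_mul_bellMoment 0).mul (hasOrder_bellMoment 1 0)).mul
    (hasOrder_bellMoment 2 0)).const_mul 2
  refine (((hasOrder_bellMoment_four_sub.sub h1).sub h2).add h3).congr fun n => ?_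
  have ha := (alpha_spec n).1
  field_simp
  ring

theorem hasOrder_cumulant_one_two_two : HasOrder (fun n => alpha n * (bellMoment 5 0 n
    - bellMoment 1 0 n * bellMoment 4 0 n - 2 * bellMoment 2 0 n * bellMoment 3 0 n
    + 2 * bellMoment 1 0 n * bellMoment 2 0 n ^ 2)) 4 := by
  have h1 := (hasOrder_alpha_mul_bellMoment 0).mul (hasOrder_bellMoment 4 0)
  have h2 := ((hasOrder_alpha_mul_bellMoment 1).mul (hasOrder_bellMoment 3 0)).const_mul 2
  have h3 := (((hasOrder_alpha_mul_bellMoment 0).mul (hasOrder_bellMoment 2 0)).mul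
    (hasOrder_bellMoment 2 0)).const_mul 2
  exact ((((hasOrder_alpha_mul_bellMoment 4).sub h1).sub h2).add h3).congr fun n => by ring

theorem hasOrder_cumulant_two_two_two : HasOrder (fun n => alpha n * (bellMoment 6 0 n
    - 3 * bellMoment 2 0 n * bellMoment 4 0 n + 2 * bellMoment 2 0 n ^ 3)) 6 := by
  have h1 := ((hasOrder_alpha_mul_bellMoment 1).mul (hasOrder_bellMoment 4 0)).const_mul 3
  have h2 := (((hasOrder_alpha_mul_bellMoment 1).mul (hasOrder_bellMoment 2 0)).mul
    (hasOrder_bellMoment 2 0)).const_mul 2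
  exact (((hasOrder_alpha_mul_bellMoment 5).sub h1).add h2).congr fun n => by ring

end JointCumulants

/-! ### Moments of d in terms of the moments of ξ. -/

section DimensionMoments

open Polynomial

theorem bellNumber_add_eq (n j : ℕ) : (bellNumber (n + j) : ℝ)
    = (∑ i ∈ Finset.range (j + 1), bellMoment i 0 n * Real.exp (alpha n) ^ (j - i) * (j.choose i))
      * bellNumber n := by
  have hB : (bellNumber n : ℝ) ≠ 0 := Nat.cast_ne_zero.2 (bellNumber_pos n).ne'
  have h1 := bellMean_C_mul_X_pow n 1 j
  rw [C_1, one_mul, one_mul, show (X : ℝ[X]) = (X - C (Real.exp (alpha n))) + C (Real.exp (alpha n))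
    by ring, add_pow, map_sum] at h1
  rw [← div_eq_iff hB, ← h1]
  refine Finset.sum_congr rfl fun i _ => ?_
  have h2 : (X - C (Real.exp (alpha n))) ^ i * C (Real.exp (alpha n)) ^ (j - i)
      * ((j.choose i : ℕ) : ℝ[X]) = C (Real.exp (alpha n) ^ (j - i) * (j.choose i))
        * (X - C (Real.exp (alpha n))) ^ i := by
    simp only [map_mul, map_pow, map_natCast]
    ring
  rw [h2, bellMean_C_mul, bellMoment, raisedPow, Function.iterate_zero, id]
  ring

theorem natCast_eq_alpha_mul (n : ℕ) : (n : ℝ) = alpha n * Real.exp (alpha n) - 1 := by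
  rw [(alpha_spec n).2]
  ring

theorem meanDim_eq (n : ℕ) : meanDim n = (alpha n * Real.exp (alpha n) + 3)
      * (Real.exp (alpha n) + bellMoment 1 0 n) - 2 * (Real.exp (alpha n) ^ 2
      + 2 * Real.exp (alpha n) * bellMoment 1 0 n + bellMoment 2 0 n) := by
  have hB : (bellNumber n : ℝ) ≠ 0 := Nat.cast_ne_zero.2 (bellNumber_pos n).ne'
  rw [meanDim, sum_dimExponent, bellNumber_add_eq, bellNumber_add_eq, natCast_eq_alpha_mul n]
  simp only [Finset.sum_range_succ, Finset.sum_range_zero, bellMoment_zero]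
  norm_num [Nat.choose]
  field_simp
  ring

theorem centeredMomentDim_two (n : ℕ) : centeredMomentDim 2 n
    = (∑ P : SetPartition n, (dimExponent P : ℝ) ^ 2) / bellNumber n - meanDim n ^ 2 := by
  have hB : (bellNumber n : ℝ) ≠ 0 := Nat.cast_ne_zero.2 (bellNumber_pos n).ne'
  have h1 : ∑ P : SetPartition n, (dimExponent P : ℝ) = meanDim n * bellNumber n :=
    (div_mul_cancel₀ _ hB).symm
  have h2 : ∑ P : SetPartition n, ((dimExponent P : ℝ) - meanDim n) ^ 2
      = ∑ P : SetPartition n, (dimExponent P : ℝ) ^ 2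
        - 2 * meanDim n * ∑ P : SetPartition n, (dimExponent P : ℝ)
        + bellNumber n * meanDim n ^ 2 := by
    have h3 : ∑ _P : SetPartition n, meanDim n ^ 2 = bellNumber n * meanDim n ^ 2 := by
      rw [Finset.sum_const, nsmul_eq_mul]
      rfl
    rw [← h3, Finset.mul_sum, ← Finset.sum_sub_distrib, ← Finset.sum_add_distrib]
    exact Finset.sum_congr rfl fun P _ => by ring
  rw [centeredMomentDim, h2, h1]
  field_simp
  ring

theorem centeredMomentDim_three (n : ℕ) : centeredMomentDim 3 n
    = (∑ P : SetPartition n, (dimExponent P : ℝ) ^ 3) / bellNumber n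
      - 3 * meanDim n * ((∑ P : SetPartition n, (dimExponent P : ℝ) ^ 2) / bellNumber n)
      + 2 * meanDim n ^ 3 := by
  have hB : (bellNumber n : ℝ) ≠ 0 := Nat.cast_ne_zero.2 (bellNumber_pos n).ne'
  have h1 : ∑ P : SetPartition n, (dimExponent P : ℝ) = meanDim n * bellNumber n :=
    (div_mul_cancel₀ _ hB).symm
  have h2 : ∑ P : SetPartition n, ((dimExponent P : ℝ) - meanDim n) ^ 3
      = ∑ P : SetPartition n, (dimExponent P : ℝ) ^ 3
        - 3 * meanDim n * ∑ P : SetPartition n, (dimExponent P : ℝ) ^ 2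
        + 3 * meanDim n ^ 2 * ∑ P : SetPartition n, (dimExponent P : ℝ)
        - bellNumber n * meanDim n ^ 3 := by
    have h3 : ∑ _P : SetPartition n, meanDim n ^ 3 = bellNumber n * meanDim n ^ 3 := by
      rw [Finset.sum_const, nsmul_eq_mul]
      rfl
    rw [← h3, Finset.mul_sum, Finset.mul_sum, ← Finset.sum_sub_distrib, ← Finset.sum_add_distrib,
      ← Finset.sum_sub_distrib]
    exact Finset.sum_congr rfl fun P _ => by ring
  rw [centeredMomentDim, h2, h1]
  field_simp
  ring

/-- The mean of d² is E[Q² + V] with Q = (n+4)X − 2X² and V = X³ − 7X² − (4n+3)X + n. The first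
bracket is E V; the second is the variance of Q, which equals aξ − 2ξ² up to a constant. -/
theorem centeredMomentDim_two_eq (n : ℕ) {A c a m₁ m₂ m₃ m₄ : ℝ} (hA : alpha n = A)
    (hc : Real.exp A = c) (ha : (A - 4) * c + 3 = a) (h₁ : bellMoment 1 0 n = m₁)
    (h₂ : bellMoment 2 0 n = m₂) (h₃ : bellMoment 3 0 n = m₃) (h₄ : bellMoment 4 0 n = m₄) :
    centeredMomentDim 2 n = (c ^ 3 - 7 * c ^ 2 - (4 * A * c - 1) * c + A * c - 1
        + (3 * c ^ 2 - 14 * c - 4 * A * c + 1) * m₁ + (3 * c - 7) * m₂ + m₃)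
      + (a ^ 2 * (m₂ - m₁ ^ 2) - 4 * a * (m₃ - m₁ * m₂) + 4 * (m₄ - m₂ ^ 2)) := by
  have hB : (bellNumber n : ℝ) ≠ 0 := Nat.cast_ne_zero.2 (bellNumber_pos n).ne'
  rw [centeredMomentDim_two, sum_dimExponent_sq, meanDim_eq]
  simp only [bellNumber_add_eq, natCast_eq_alpha_mul n, Finset.sum_range_succ,
    Finset.sum_range_zero, bellMoment_zero, hc, hA, h₁, h₂, h₃, h₄]
  subst ha
  norm_num [Nat.choose]
  field_simp
  ring

/-- The mean of d³ is E[Q³ + 3QV + T] with T of degree 4, and the three groups are E T, 3 Cov(Q, V)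
and the third cumulant of Q. -/
theorem centeredMomentDim_three_eq (n : ℕ) {A c a m₁ m₂ m₃ m₄ m₅ m₆ : ℝ} (hA : alpha n = A)
    (hc : Real.exp A = c) (ha : (A - 4) * c + 3 = a) (h₁ : bellMoment 1 0 n = m₁)
    (h₂ : bellMoment 2 0 n = m₂) (h₃ : bellMoment 3 0 n = m₃) (h₄ : bellMoment 4 0 n = m₄)
    (h₅ : bellMoment 5 0 n = m₅) (h₆ : bellMoment 6 0 n = m₆) :
    centeredMomentDim 3 n = (-1 + c * (A + 17 / 3) + c ^ 2 * (-6 * A + 62 / 3)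
        + c ^ 3 * (18 * A + 20) - 5 / 3 * c ^ 4
        + m₁ * (17 / 3 + c * (-6 * A + 124 / 3) + c ^ 2 * (36 * A + 60) - 20 / 3 * c ^ 3)
        + m₂ * (62 / 3 + c * (18 * A + 60) - 10 * c ^ 2) + m₃ * (20 - 20 / 3 * c) - 5 / 3 * m₄)
      + 3 * ((3 * c ^ 2 - 14 * c - 4 * A * c + 1) * (a * (m₂ - m₁ ^ 2) - 2 * (m₃ - m₁ * m₂))
        + (3 * c - 7) * (a * (m₃ - m₁ * m₂) - 2 * (m₄ - m₂ ^ 2))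
        + (a * (m₄ - m₁ * m₃) - 2 * (m₅ - m₂ * m₃)))
      + (a ^ 3 * (m₃ - 3 * m₁ * m₂ + 2 * m₁ ^ 3)
        - 6 * a ^ 2 * (m₄ - m₂ ^ 2 - 2 * m₁ * m₃ + 2 * m₁ ^ 2 * m₂)
        + 12 * a * (m₅ - m₁ * m₄ - 2 * m₂ * m₃ + 2 * m₁ * m₂ ^ 2)
        - 8 * (m₆ - 3 * m₂ * m₄ + 2 * m₂ ^ 3)) := by
  have hB : (bellNumber n : ℝ) ≠ 0 := Nat.cast_ne_zero.2 (bellNumber_pos n).ne'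
  rw [centeredMomentDim_three, sum_dimExponent_sq, sum_dimExponent_cube, meanDim_eq]
  simp only [bellNumber_add_eq, natCast_eq_alpha_mul n, Finset.sum_range_succ,
    Finset.sum_range_zero, bellMoment_zero, hc, hA, h₁, h₂, h₃, h₄, h₅, h₆]
  subst ha
  norm_num [Nat.choose]
  field_simp
  ring

end DimensionMoments

/-! ### Exact residuals as an explicit scale times a polynomial in bounded quantities. -/

section Residuals

theorem mean_residual {A c : ℝ} (hA : 0 < A) (hc : 0 < c) (m₁ m₂ : ℝ) {b s w₁ w₂ : ℝ}
    (hb : b = A⁻¹) (hs : s = c⁻¹) (hw₁ : w₁ = A * m₁) (hw₂ : w₂ = A * m₂ * s) :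
    (A * c + 3) * (c + m₁) - 2 * (c ^ 2 + 2 * c * m₁ + m₂)
        - (A - 2) / A ^ 2 * (A * c - 1) ^ 2
      = c * (3 + 3 * s * b * w₁ + w₁ - 4 * b * w₁ - 2 * b * w₂ + (1 - 2 * b) * (2 - b * s)) := by
  subst hb hs hw₁ hw₂
  field_simp
  ring

/-- The main term is c³ from E V plus (A − 4)²c³/(A + 1) from the variance of Q, and (A − 4)² + (A +
1) = A² − 7A + 17. The auxiliary variables are normalized to be bounded along the sequence. -/
theorem second_residual {A c : ℝ} (hA : 0 < A) (hc : 0 < c) (m₁ m₂ m₃ v d₁₂ d₂₂ : ℝ)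
    {a b s t u r w₁ w₂ w₃ x y₁₂ y₂₂ : ℝ} (ha : a = (A - 4) * c + 3) (hb : b = A⁻¹) (hs : s = c⁻¹)
    (ht : t = A * s) (hu : u = (A + 1)⁻¹) (hr : r = 1 - 4 * b + 3 * b * s) (hw₁ : w₁ = A * m₁)
    (hw₂ : w₂ = A * m₂ * s) (hw₃ : w₃ = A * m₃ * s) (hx : x = A * (v - c / (A + 1)))
    (hy₁₂ : y₁₂ = A * d₁₂ * s) (hy₂₂ : y₂₂ = A * d₂₂ * s ^ 2) :
    (c ^ 3 - 7 * c ^ 2 - (4 * A * c - 1) * c + A * c - 1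
        + (3 * c ^ 2 - 14 * c - 4 * A * c + 1) * m₁ + (3 * c - 7) * m₂ + m₃)
      + (a ^ 2 * v - 4 * a * d₁₂ + 4 * d₂₂)
      - (A ^ 2 - 7 * A + 17) / (A ^ 3 * (A + 1)) * (A * c - 1) ^ 3
    = A * c ^ 2 * (r ^ 2 * x + (6 * (1 - 4 * b) + 9 * b * s) * u - 4 * r * b * y₁₂
      + 4 * b ^ 2 * y₂₂ - 7 * b - 4 + b * s + s - b * s ^ 2
      + (3 - 14 * s - 4 * t + s ^ 2) * b ^ 2 * w₁ + (3 - 7 * s) * b ^ 2 * w₂ + b ^ 2 * s * w₃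
      + (1 - 7 * b + 17 * b ^ 2) * u * (3 - 3 * b * s + b ^ 2 * s ^ 2)) := by
  subst ht hx hy₁₂ hy₂₂ hw₁ hw₂ hw₃ hu hr ha
  subst hb hs
  field_simp
  ring

/-- The main term is written with c − b, which is n/A exactly when n = Ac − 1, to match the power n⁴
in the theorem. -/
theorem third_residual_mean {A c : ℝ} (hA : 0 < A) (hc : 0 < c) (m₁ m₂ m₃ m₄ : ℝ)
    {b s t w₁ w₂ w₃ w₄ : ℝ} (hb : b = A⁻¹) (hs : s = c⁻¹) (ht : t = A * s) (hw₁ : w₁ = A * m₁)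
    (hw₂ : w₂ = A * m₂ * s) (hw₃ : w₃ = A * m₃ * s) (hw₄ : w₄ = A * m₄ * s ^ 2) :
    (-1 + c * (A + 17 / 3) + c ^ 2 * (-6 * A + 62 / 3)
        + c ^ 3 * (18 * A + 20) - 5 / 3 * c ^ 4
        + m₁ * (17 / 3 + c * (-6 * A + 124 / 3) + c ^ 2 * (36 * A + 60) - 20 / 3 * c ^ 3)
        + m₂ * (62 / 3 + c * (18 * A + 60) - 10 * c ^ 2) + m₃ * (20 - 20 / 3 * c) - 5 / 3 * m₄)
      = -(5 / 3) * (c - b) ^ 4 + A ^ 2 * c ^ 3 * (-b ^ 2 * s ^ 3 + b * s ^ 2 * (1 + 17 / 3 * b)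
        + b * s * (-6 + 62 / 3 * b) + b * (18 + 20 * b)
        + b ^ 3 * (w₁ * (17 / 3 * s ^ 3 - 6 * t * s + 124 / 3 * s ^ 2 + 36 * t + 60 * s - 20 / 3)
          + w₂ * (62 / 3 * s ^ 2 + 18 * t + 60 * s - 10) + w₃ * (20 * s ^ 2 - 20 / 3 * s)
          - 5 / 3 * s * w₄)
        - 5 / 3 * b ^ 2 * (4 * b - 6 * b ^ 2 * s + 4 * b ^ 3 * s ^ 2 - b ^ 4 * s ^ 3)) := by
  subst ht hw₁ hw₂ hw₃ hw₄
  subst hb hs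
  field_simp
  ring

theorem third_residual_covariance {A c : ℝ} (hA : 0 < A) (hc : 0 < c) (v d₁₂ d₂₂ d₁₃ d₂₃ : ℝ)
    {a b s t u r x y₁₂ y₂₂ y₁₃ y₂₃ : ℝ} (ha : a = (A - 4) * c + 3) (hb : b = A⁻¹) (hs : s = c⁻¹)
    (ht : t = A * s) (hu : u = (A + 1)⁻¹) (hr : r = 1 - 4 * b + 3 * b * s)
    (hx : x = A * (v - c / (A + 1))) (hy₁₂ : y₁₂ = A * d₁₂ * s) (hy₂₂ : y₂₂ = A * d₂₂ * s ^ 2)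
    (hy₁₃ : y₁₃ = A * d₁₃ * s ^ 2) (hy₂₃ : y₂₃ = A * d₂₃ * s ^ 2) :
    3 * ((3 * c ^ 2 - 14 * c - 4 * A * c + 1) * (a * v - 2 * d₁₂)
        + (3 * c - 7) * (a * d₁₂ - 2 * d₂₂) + (a * d₁₃ - 2 * d₂₃))
      = 9 * (A - 4) * u * (c - b) ^ 4 + A ^ 2 * c ^ 3
        * (3 * ((3 - 14 * s - 4 * t + s ^ 2) * r * b ^ 2 * x + 9 * b ^ 2 * u
          + (-14 * b - 4 + b * s) * r * u - 2 * (3 - 14 * s - 4 * t + s ^ 2) * b ^ 3 * y₁₂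
          + (3 - 7 * s) * r * b ^ 2 * y₁₂ - 2 * (3 - 7 * s) * b ^ 3 * y₂₂ + r * b ^ 2 * y₁₃
          - 2 * b ^ 3 * s * y₂₃)
        + 9 * (1 - 4 * b) * u * b * (4 * b - 6 * b ^ 2 * s + 4 * b ^ 3 * s ^ 2 - b ^ 4 * s ^ 3)) := by
  subst ht hx hy₁₂ hy₂₂ hy₁₃ hy₂₃ hu hr ha
  subst hb hs
  field_simp
  ring

theorem third_residual_cumulant {A c : ℝ} (hA : 0 < A) (hc : 0 < c) (k₁ k₂ k₃ k₄ : ℝ)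
    {a b s u r x₁ x₂ x₃ x₄ : ℝ} (ha : a = (A - 4) * c + 3) (hb : b = A⁻¹) (hs : s = c⁻¹)
    (hu : u = (A + 1)⁻¹) (hr : r = 1 - 4 * b + 3 * b * s)
    (hx₁ : x₁ = A * (k₁ - (2 * A + 1) / (A + 1) ^ 3 * c))
    (hx₂ : x₂ = A * (k₂ - 2 * c ^ 2 / (A + 1) ^ 2) * s) (hx₃ : x₃ = A * k₃ * s ^ 2)
    (hx₄ : x₄ = A * k₄ * s ^ 3) :
    a ^ 3 * k₁ - 6 * a ^ 2 * k₂ + 12 * a * k₃ - 8 * k₄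
      = ((A - 4) ^ 3 * (2 * A + 1) * u ^ 3 - 12 * (A - 4) ^ 2 * u ^ 2) * (c - b) ^ 4
        + A ^ 2 * c ^ 3 * (r ^ 3 * x₁ + (2 - u) * u ^ 2 * (9 * (1 - 4 * b) ^ 2
          + 27 * (1 - 4 * b) * b * s + 27 * b ^ 2 * s ^ 2) - 6 * r ^ 2 * b * x₂
          - 12 * u ^ 2 * b * (6 * (1 - 4 * b) + 9 * b * s) + 12 * r * b ^ 2 * x₃ - 8 * b ^ 3 * x₄
          + ((1 - 4 * b) ^ 3 * (2 - u) * u ^ 2 - 12 * (1 - 4 * b) ^ 2 * b * u ^ 2)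
            * (4 - 6 * b * s + 4 * b ^ 2 * s ^ 2 - b ^ 3 * s ^ 3)) := by
  subst hx₁ hx₂ hx₃ hx₄ hu hr ha
  subst hb hs
  field_simp
  ring

end Residuals

/-! ### Asymptotics of α_n and the final estimates. -/

section Conclusion

theorem HasOrder.mul_bounded {f g : ℕ → ℝ} (hf : HasOrder f 0) (hg : HasOrder g 0) :
    HasOrder (fun n => f n * g n) 0 := hf.mul hg

theorem HasOrder.pow_bounded {f : ℕ → ℝ} (hf : HasOrder f 0) (k : ℕ) :
    HasOrder (fun n => f n ^ k) 0 := by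
  induction k with
  | zero => simpa using hasOrder_const 1
  | succ k ih => simpa only [pow_succ] using ih.mul_bounded hf

theorem hasOrder_mul_inv_exp_pow {f : ℕ → ℝ} (k : ℕ) {e : ℤ} (hf : HasOrder f e)
    (he : e ≤ 2 * k) : HasOrder (fun n => f n * (Real.exp (alpha n))⁻¹ ^ k) 0 := by
  refine ((hf.mul (hasOrder_exp_alpha_zpow (-(k : ℤ)))).mono (by linarith)).congr fun n => ?_
  rw [zpow_neg, zpow_natCast, inv_pow]

/-- As αc = n + 1, the scale α^k c^{k+1} is (n + 1)^{k+1}/α. -/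
theorem HasOrder.isBigO_pow {f g : ℕ → ℝ} (k : ℕ) (hg : HasOrder g 0)
    (h : ∀ n, f n = alpha n ^ k * Real.exp (alpha n) ^ (k + 1) * g n) :
    f =O[atTop] fun n : ℕ => (n : ℝ) ^ (k + 1) * (alpha n)⁻¹ := by
  have h1 : (fun n : ℕ => alpha n * Real.exp (alpha n)) =O[atTop] fun n : ℕ => (n : ℝ) := by
    refine IsBigO.of_bound 2 ?_
    filter_upwards [eventually_ge_atTop 1] with n hn
    have hn' : (1 : ℝ) ≤ n := Nat.one_le_cast.2 hn
    rw [(alpha_spec n).2, Real.norm_of_nonneg (by positivity), Real.norm_of_nonneg (by positivity)]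
    linarith
  have h2 : (fun n => g n * (alpha n)⁻¹) =O[atTop] fun n => (alpha n)⁻¹ := by
    unfold HasOrder at hg
    simpa using hg.mul (isBigO_refl (fun n => (alpha n)⁻¹) atTop)
  refine ((h1.pow (k + 1)).mul h2).congr_left fun n => ?_
  have ha := (alpha_spec n).1
  rw [h, mul_pow]
  field_simp
  ring

/-- Taking logarithms, log(n + 1) = α + log α; hence log n/α → 1, and log α may be replaced by log
log n. -/
theorem isLittleO_alpha_sub : (fun n : ℕ => alpha n - (Real.log n - Real.log (Real.log n)))
    =o[atTop] (fun _ : ℕ => (1 : ℝ)) := by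
  rw [isLittleO_one_iff]
  have hlog : Tendsto (fun n : ℕ => Real.log n) atTop atTop :=
    Real.tendsto_log_atTop.comp tendsto_natCast_atTop_atTop
  have h1 : ∀ n : ℕ, Real.log ((n : ℝ) + 1) = Real.log (alpha n) + alpha n := fun n => by
    rw [← (alpha_spec n).2, Real.log_mul (alpha_spec n).1.ne' (Real.exp_pos _).ne', Real.log_exp]
  have h2 : Tendsto (fun n : ℕ => Real.log ((n : ℝ) + 1) - Real.log n) atTop (𝓝 0) := by
    have h3 : Tendsto (fun n : ℕ => Real.log (1 + 1 / (n : ℝ))) atTop (𝓝 (Real.log (1 + 0))) :=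
      (Real.continuousAt_log (by norm_num)).tendsto.comp
        (tendsto_const_nhds.add tendsto_one_div_atTop_nhds_zero_nat)
    rw [add_zero, Real.log_one] at h3
    refine h3.congr' ?_
    filter_upwards [eventually_gt_atTop 0] with n hn
    have hn' : (0 : ℝ) < n := Nat.cast_pos.2 hn
    rw [← Real.log_div (by positivity) hn'.ne']
    congr 1
    field_simp
  have h3 : Tendsto (fun n : ℕ => Real.log n / alpha n) atTop (𝓝 1) := by
    have h4 : Tendsto (fun n : ℕ => Real.log (alpha n) / alpha n) atTop (𝓝 0) :=
      (Real.isLittleO_log_id_atTop.tendsto_div_nhds_zero).comp tendsto_alpha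
    have h5 := (h4.const_add 1).sub (h2.mul (tendsto_inv_atTop_zero.comp tendsto_alpha))
    simp only [add_zero, mul_zero, sub_zero] at h5
    refine h5.congr fun n => ?_
    have ha := (alpha_spec n).1
    simp only [Function.comp]
    rw [h1]
    field_simp
    ring
  have h4 : Tendsto (fun n : ℕ => Real.log (Real.log n / alpha n)) atTop (𝓝 0) := by
    have h5 := (Real.continuousAt_log one_ne_zero).tendsto.comp h3
    rwa [Real.log_one] at h5
  have h5 := h2.add h4
  rw [add_zero] at h5
  refine h5.congr' ?_
  filter_upwards [hlog.eventually_gt_atTop 0] with n hn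
  rw [h1, Real.log_div hn.ne' (alpha_spec n).1.ne']
  ring

theorem hasOrder_inv_alpha_add_one : HasOrder (fun n => (alpha n + 1)⁻¹) 0 := by
  refine (hasOrder_inv_alpha.mul_bounded hasOrder_inv_one_add_inv_alpha).congr fun n => ?_
  have := (alpha_spec n).1
  field_simp

theorem hasOrder_shift {b s : ℕ → ℝ} (hb : HasOrder b 0) (hs : HasOrder s 0) :
    HasOrder (fun n => 1 - 4 * b n + 3 * b n * s n) 0 :=
  ((hasOrder_const 1).sub (hb.const_mul 4)).add ((hb.const_mul 3).mul_bounded hs)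

theorem isBigO_meanDim_sub :
    (fun n : ℕ => meanDim n - (alpha n - 2) / alpha n ^ 2 * (n : ℝ) ^ 2) =O[atTop]
      (fun n : ℕ => (n : ℝ) * (alpha n)⁻¹) := by
  have hb := hasOrder_inv_alpha
  have hs := hasOrder_mul_inv_exp_pow 1 (hasOrder_const 1) (by norm_num)
  have hw₁ := hasOrder_alpha_mul_bellMoment 0
  have hw₂ := hasOrder_mul_inv_exp_pow 1 (hasOrder_alpha_mul_bellMoment 1) (by norm_num)
  simp only [one_mul, pow_one, Nat.reduceAdd] at hs hw₁ hw₂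
  have h := HasOrder.isBigO_pow (f := fun n : ℕ => meanDim n
    - (alpha n - 2) / alpha n ^ 2 * (n : ℝ) ^ 2) 0 ?_ fun n => by
      rw [meanDim_eq, natCast_eq_alpha_mul n, mean_residual (alpha_spec n).1 (Real.exp_pos _) _ _
        rfl rfl rfl rfl, pow_zero, one_mul, zero_add, pow_one]
  · simpa only [zero_add, pow_one] using h
  -- It remains to see that the cofactor, a polynomial in bounded sequences, is bounded.
  repeat' first
    | assumption | exact hasOrder_const _ | apply HasOrder.pow_bounded | apply HasOrder.neg
    | apply HasOrder.sub | apply HasOrder.add | apply HasOrder.mul_bounded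

theorem isBigO_centeredMomentDim_two_sub : (fun n : ℕ => centeredMomentDim 2 n
      - (alpha n ^ 2 - 7 * alpha n + 17) / (alpha n ^ 3 * (alpha n + 1)) * (n : ℝ) ^ 3)
    =O[atTop] (fun n : ℕ => (n : ℝ) ^ 2 * (alpha n)⁻¹) := by
  have hb := hasOrder_inv_alpha
  have hu := hasOrder_inv_alpha_add_one
  have hs := hasOrder_mul_inv_exp_pow 1 (hasOrder_const 1) (by norm_num)
  have ht := hasOrder_mul_inv_exp_pow 1 (hasOrder_alpha_pow 1) (by norm_num)
  have hw₁ := hasOrder_alpha_mul_bellMoment 0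
  have hw₂ := hasOrder_mul_inv_exp_pow 1 (hasOrder_alpha_mul_bellMoment 1) (by norm_num)
  have hw₃ := hasOrder_mul_inv_exp_pow 1 (hasOrder_alpha_mul_bellMoment 2) (by norm_num)
  have hx := hasOrder_cumulant_one_one
  have hy₁₂ := hasOrder_mul_inv_exp_pow 1 hasOrder_cumulant_one_two (by norm_num)
  have hy₂₂ := hasOrder_mul_inv_exp_pow 2 hasOrder_cumulant_two_two (by norm_num)
  simp only [one_mul, pow_one, Nat.reduceAdd] at hs ht hw₁ hw₂ hw₃ hy₁₂
  have hr := hasOrder_shift hb hs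
  refine HasOrder.isBigO_pow 1 ?_ fun n => by
    rw [centeredMomentDim_two_eq n rfl rfl rfl rfl rfl rfl rfl, natCast_eq_alpha_mul n,
      second_residual (alpha_spec n).1 (Real.exp_pos _) _ _ _ _ _ _ rfl rfl rfl rfl rfl rfl rfl rfl
        rfl rfl rfl rfl, pow_one]
  repeat' first
    | assumption | exact hasOrder_const _ | apply HasOrder.pow_bounded | apply HasOrder.neg
    | apply HasOrder.sub | apply HasOrder.add | apply HasOrder.mul_bounded

/-- The quartic in A splits into the contributions of E T, of 3 Cov(Q, V) and of the third cumulant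
of Q. -/
theorem third_main_term {A : ℝ} (hA : 0 < A) (c : ℝ) {b u : ℝ} (hb : b = A⁻¹)
    (hu : u = (A + 1)⁻¹) :
    (-(881 / 3 : ℝ) - 244 * A + 145 * A ^ 2 - (83 / 3 : ℝ) * A ^ 3 + 2 * A ^ 4)
        * ((A * c - 1) ^ 4 / (A ^ 4 * (A + 1) ^ 3))
      = -(5 / 3) * (c - b) ^ 4 + 9 * (A - 4) * u * (c - b) ^ 4
        + ((A - 4) ^ 3 * (2 * A + 1) * u ^ 3 - 12 * (A - 4) ^ 2 * u ^ 2) * (c - b) ^ 4 := by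
  subst hb hu
  field_simp
  ring

theorem add_mul_sub_main_terms {R : Type*} [CommRing R] (l₁ l₂ l₃ k g₁ g₂ g₃ : R) :
    l₁ + k * g₁ + (l₂ + k * g₂) + (l₃ + k * g₃) - (l₁ + l₂ + l₃) = k * (g₁ + g₂ + g₃) := by
  ring

set_option maxHeartbeats 1000000 in
theorem isBigO_centeredMomentDim_three_sub : (fun n : ℕ => centeredMomentDim 3 n
      - (-(881 / 3 : ℝ) - 244 * alpha n + 145 * alpha n ^ 2 - (83 / 3 : ℝ) * alpha n ^ 3
          + 2 * alpha n ^ 4) * ((n : ℝ) ^ 4 / (alpha n ^ 4 * (alpha n + 1) ^ 3)))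
    =O[atTop] (fun n : ℕ => (n : ℝ) ^ 3 * (alpha n)⁻¹) := by
  have hb := hasOrder_inv_alpha
  have hu := hasOrder_inv_alpha_add_one
  have hs := hasOrder_mul_inv_exp_pow 1 (hasOrder_const 1) (by norm_num)
  have ht := hasOrder_mul_inv_exp_pow 1 (hasOrder_alpha_pow 1) (by norm_num)
  have hw₁ := hasOrder_alpha_mul_bellMoment 0
  have hw₂ := hasOrder_mul_inv_exp_pow 1 (hasOrder_alpha_mul_bellMoment 1) (by norm_num)
  have hw₃ := hasOrder_mul_inv_exp_pow 1 (hasOrder_alpha_mul_bellMoment 2) (by norm_num)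
  have hw₄ := hasOrder_mul_inv_exp_pow 2 (hasOrder_alpha_mul_bellMoment 3) (by norm_num)
  have hx := hasOrder_cumulant_one_one
  have hy₁₂ := hasOrder_mul_inv_exp_pow 1 hasOrder_cumulant_one_two (by norm_num)
  have hy₂₂ := hasOrder_mul_inv_exp_pow 2 hasOrder_cumulant_two_two (by norm_num)
  have hy₁₃ := hasOrder_mul_inv_exp_pow 2 hasOrder_cumulant_one_three (by norm_num)
  have hy₂₃ := hasOrder_mul_inv_exp_pow 2 hasOrder_cumulant_two_three (by norm_num)
  have hx₁ := hasOrder_cumulant_one_one_one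
  have hx₂ := hasOrder_mul_inv_exp_pow 1 hasOrder_cumulant_one_one_two (by norm_num)
  have hx₃ := hasOrder_mul_inv_exp_pow 2 hasOrder_cumulant_one_two_two (by norm_num)
  have hx₄ := hasOrder_mul_inv_exp_pow 3 hasOrder_cumulant_two_two_two (by norm_num)
  simp only [one_mul, pow_one, Nat.reduceAdd] at hs ht hw₁ hw₂ hw₃ hw₄ hy₁₂ hx₂
  have hr := hasOrder_shift hb hs
  refine HasOrder.isBigO_pow 2 ?_ fun n => by
    rw [centeredMomentDim_three_eq n rfl rfl rfl rfl rfl rfl rfl rfl rfl, natCast_eq_alpha_mul n,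
      third_main_term (alpha_spec n).1 _ rfl rfl,
      third_residual_mean (alpha_spec n).1 (Real.exp_pos _) _ _ _ _ rfl rfl rfl rfl rfl rfl rfl,
      third_residual_covariance (alpha_spec n).1 (Real.exp_pos _) _ _ _ _ _ rfl rfl rfl rfl rfl
        rfl rfl rfl rfl rfl rfl,
      third_residual_cumulant (alpha_spec n).1 (Real.exp_pos _) _ _ _ _ rfl rfl rfl rfl rfl
        rfl rfl rfl rfl]
    exact add_mul_sub_main_terms _ _ _ _ _ _ _
  repeat' first
    | assumption | exact hasOrder_const _ | apply HasOrder.pow_bounded | apply HasOrder.neg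
    | apply HasOrder.sub | apply HasOrder.add | apply HasOrder.mul_bounded

end Conclusion

theorem theorem3p3 :
    ((fun n : ℕ => alpha n - (Real.log n - Real.log (Real.log n))) =o[atTop]
      (fun _ : ℕ => (1 : ℝ)))
    ∧ ((fun n : ℕ => meanDim n - (alpha n - 2) / alpha n ^ 2 * (n : ℝ) ^ 2) =O[atTop]
      (fun n : ℕ => (n : ℝ) * (alpha n)⁻¹))
    ∧ ((fun n : ℕ => centeredMomentDim 2 n
        - (alpha n ^ 2 - 7 * alpha n + 17) / (alpha n ^ 3 * (alpha n + 1)) * (n : ℝ) ^ 3)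
      =O[atTop] (fun n : ℕ => (n : ℝ) ^ 2 * (alpha n)⁻¹))
    ∧ ((fun n : ℕ => centeredMomentDim 3 n
        - (-(881 / 3 : ℝ) - 244 * alpha n + 145 * alpha n ^ 2 - (83 / 3 : ℝ) * alpha n ^ 3
            + 2 * alpha n ^ 4) * ((n : ℝ) ^ 4 / (alpha n ^ 4 * (alpha n + 1) ^ 3)))
      =O[atTop] (fun n : ℕ => (n : ℝ) ^ 3 * (alpha n)⁻¹)) :=
  ⟨isLittleO_alpha_sub, isBigO_meanDim_sub, isBigO_centeredMomentDim_two_sub,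
    isBigO_centeredMomentDim_three_sub⟩
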